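/- Let $P=\{p_1,\dots,p_n\}$ with $n\ge 2$. A distance function on $P$ is a function $d:P\times P\to\mathbb{R}_{\ge 0}$ with $d(p_i,p_i)=0$ and $d(p_i,p_j)=d(p_j,p_i)>0$ for $i\ne j$ (no triangle inequality is required). $P$ is in general position if $d(p_i,p_j)\ne d(p_i,p_k)$ for all $i$ and all $j\ne k$. A directed graph $G=(P,E)$ is navigable if for all $p_i\ne p_j$ there is a $p_k$ with $(p_i,p_k)\in E$ and $d(p_k,p_j)<d(p_i,p_j)$. Theorem. There is a constant $k$ such that for every constant $a$ there are constants $C,c$ and a randomized algorithm (a single program, independent of $n$ and $d$, for a word RAM with words of $O(\log n)$ bits that has access to $d$ through an oracle, can store, move and compare distances, and can draw uniformly random integers below a given word, each in one step) with the following property. For every $n\ge 2$, every $n$-point set $P$ and every distance function $d$ on $P$ such that $P$ is in general position, the algorithm always halts within $C n^2(\log n)^k$ steps and evaluates $d$ at most $C n^2$ times (so it runs in time $\tilde O(n^2)$ if an evaluation of $d$ takes $O(1)$ time, and $\tilde O(n^2)+O(n^2T)$ if it takes time $T$), and it outputs a directed graph $G$ on $P$ such that, with probability at least $1-1/n^a$,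 $G$ is navigable and the average out-degree of $G$ is at most $c\log n$ times the average out-degree of the sparsest navigable graph for $P$. -/

import Mathlib

open scoped BigOperators

namespace NavGraph

/-! ### Distance functions and navigable graphs

The point set is `P = {p_0, …, p_{n-1}}`; a point is identified with its index in `Fin n`. -/

/-- A distance function: zero on the diagonal, symmetric, positive off the diagonal.
No triangle inequality is required. -/
structure IsDistance {n : ℕ} (d : Fin n → Fin n → ℝ) : Prop where
  self : ∀ i, d i i = 0
  symm : ∀ i j, d i j = d j i
  pos : ∀ i j, i ≠ j → 0 < d i j

/-- General position: no two distinct points are equally far from a third one. -/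
def GeneralPosition {n : ℕ} (d : Fin n → Fin n → ℝ) : Prop :=
  ∀ i j k, j ≠ k → d i j ≠ d i k

/-- A directed graph is navigable if every `p_i` has, for every other `p_j`, an out-neighbor
`p_k` that is closer to `p_j` than `p_i` is. -/
def Navigable {n : ℕ} (d : Fin n → Fin n → ℝ) (G : Digraph (Fin n)) : Prop :=
  ∀ i j, i ≠ j → ∃ k, G.Adj i k ∧ d k j < d i j

/-- Average out-degree of a directed graph on `n` nodes. -/
noncomputable def avgOutDegree {n : ℕ} (G : Digraph (Fin n)) : ℝ :=
  (∑ i : Fin n, (({j | G.Adj i j} : Set (Fin n)).ncard : ℝ)) / n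

/-! ### The machine model

A randomized word RAM with access to the distance function, programmed by while-programs.

* Words are natural numbers below `2 ^ (κ * ⌈log₂ (n + 1)⌉)` with a constant `κ`, so they have
  `O(log n)` bits. Arithmetic wraps around.
* The data are finitely many word variables, finitely many random-access arrays of words, and
  finitely many random-access arrays of real numbers. The latter can only be filled with values of
  the distance function, moved, and compared.
* Every command, including every test of a branch or a loop, takes one step. A program is a fixed
  finite text that does not depend on `n` or on the input, so the expressions in it have constant
  size. -/

/-- Binary word operations. -/
inductive BinOp where
  | add | sub | mul | div | mod

/-- Word expressions: constants, variables, entry `e` of array `a`, and arithmetic. -/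
inductive WordExpr where
  | const (c : ℕ)
  | var (x : ℕ)
  | get (a : ℕ) (e : WordExpr)
  | bin (o : BinOp) (e f : WordExpr)

/-- Tests: comparisons of two words, or of two stored distances
(entry `e` of distance array `a` with entry `f` of distance array `b`). -/
inductive Test where
  | lt (e f : WordExpr)
  | eq (e f : WordExpr)
  | distLt (a : ℕ) (e : WordExpr) (b : ℕ) (f : WordExpr)

/-- Commands.
* `assign x e`: `x := e`.
* `store a e f`: entry `e` of word array `a` becomes `f`.
* `sample x e`: `x` becomes a uniformly random element of `{0, …, e - 1}`, independent of
  everything before (and `0` if `e = 0`).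
* `query a e f g`: entry `e` of distance array `a` becomes `d(p_f, p_g)`.
* `move a e b f`: entry `e` of distance array `a` becomes entry `f` of distance array `b`. -/
inductive Program where
  | skip
  | assign (x : ℕ) (e : WordExpr)
  | store (a : ℕ) (e f : WordExpr)
  | sample (x : ℕ) (e : WordExpr)
  | query (a : ℕ) (e f g : WordExpr)
  | move (a : ℕ) (e : WordExpr) (b : ℕ) (f : WordExpr)
  | seq (p q : Program)
  | ite (t : Test) (p q : Program)
  | loop (t : Test) (p : Program)

/-- A configuration: contents of the word variables, the word arrays and the distance arrays, the
number of distance evaluations so far, and the stack of programs that remain to be executed. -/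
structure Config where
  vars : ℕ → ℕ
  words : ℕ → ℕ → ℕ
  dists : ℕ → ℕ → ℝ
  queries : ℕ
  todo : List Program

/-- The machine has halted when nothing remains to be executed. -/
def Config.Halted (s : Config) : Prop := s.todo = []

/-- Number of word values for inputs with `n` points: words have `κ * (number of bits of n)` bits. -/
def wordBound (κ n : ℕ) : ℕ := 2 ^ (κ * Nat.size n)

/-- Operations on words modulo `W`. Subtraction is truncated at `0`, and division rounds down. -/
def BinOp.apply (W : ℕ) : BinOp → ℕ → ℕ → ℕ
  | .add, x, y => (x + y) % W
  | .sub, x, y => (x - y) % W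
  | .mul, x, y => (x * y) % W
  | .div, x, y => (x / y) % W
  | .mod, x, y => (x % y) % W

/-- Value of a word expression. -/
def WordExpr.value (W : ℕ) (s : Config) : WordExpr → ℕ
  | .const c => c % W
  | .var x => s.vars x
  | .get a e => s.words a (e.value W s)
  | .bin o e f => o.apply W (e.value W s) (f.value W s)

/-- Whether a test succeeds. -/
def Test.Holds (W : ℕ) (s : Config) : Test → Prop
  | .lt e f => e.value W s < f.value W s
  | .eq e f => e.value W s = f.value W s
  | .distLt a e b f => s.dists a (e.value W s) < s.dists b (f.value W s)

/-- The array of arrays `m` with entry `k` of array `a` replaced by `v`. -/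
def setEntry {α : Type} (m : ℕ → ℕ → α) (a k : ℕ) (v : α) : ℕ → ℕ → α :=
  Function.update m a (Function.update (m a) k v)

/-- Answer of the distance oracle to a pair of words (`0` if one of them is not an index). -/
noncomputable def oracle {n : ℕ} (d : Fin n → Fin n → ℝ) (i j : ℕ) : ℝ :=
  if h : i < n ∧ j < n then d ⟨i, h.1⟩ ⟨j, h.2⟩ else 0

/-- Uniform distribution on `{0, …, m - 1}` (the point mass at `0` if `m = 0`). -/
noncomputable def uniformBelow (m : ℕ) : PMF ℕ :=
  if h : (Finset.range m).Nonempty then PMF.uniformOfFinset (Finset.range m) h else PMF.pure 0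

open Classical in
/-- One step of the machine with word bound `W` and distance function `d`.
A halted machine stays where it is. -/
noncomputable def step {n : ℕ} (W : ℕ) (d : Fin n → Fin n → ℝ) (s : Config) : PMF Config :=
  match s.todo with
  | [] => PMF.pure s
  | .skip :: k => PMF.pure { s with todo := k }
  | .assign x e :: k =>
      PMF.pure { s with vars := Function.update s.vars x (e.value W s), todo := k }
  | .store a e f :: k =>
      PMF.pure { s with words := setEntry s.words a (e.value W s) (f.value W s), todo := k }
  | .sample x e :: k =>
      (uniformBelow (e.value W s)).map fun v =>
        { s with vars := Function.update s.vars x v, todo := k }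
  | .query a e f g :: k =>
      PMF.pure { s with
        dists := setEntry s.dists a (e.value W s) (oracle d (f.value W s) (g.value W s))
        queries := s.queries + 1
        todo := k }
  | .move a e b f :: k =>
      PMF.pure { s with
        dists := setEntry s.dists a (e.value W s) (s.dists b (f.value W s))
        todo := k }
  | .seq p q :: k => PMF.pure { s with todo := p :: q :: k }
  | .ite t p q :: k => PMF.pure { s with todo := (if t.Holds W s then p else q) :: k }
  | .loop t p :: k =>
      PMF.pure { s with todo := if t.Holds W s then p :: .loop t p :: k else k }

/-- Initial configuration: variable `0` holds `n`, everything else is `0`. -/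
def initial (p : Program) (n : ℕ) : Config where
  vars := Function.update (fun _ => 0) 0 n
  words := fun _ _ => 0
  dists := fun _ _ => 0
  queries := 0
  todo := [p]

/-- Distribution of the configuration after `t` steps of program `p` on the distance function `d`,
with word length `κ * (number of bits of n)`. -/
noncomputable def run (p : Program) (κ : ℕ) {n : ℕ} (d : Fin n → Fin n → ℝ) : ℕ → PMF Config
  | 0 => PMF.pure (initial p n)
  | t + 1 => (run p κ d t).bind (step (wordBound κ n) d)

/-- The graph that a configuration holds as its output, as an adjacency matrix in word array `0`:
there is an edge from `p_i` to `p_j` iff entry `i * n + j` is not `0`. -/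
def outputGraph (n : ℕ) (s : Config) : Digraph (Fin n) where
  Adj i j := s.words 0 (i * n + j) ≠ 0

/-- Whatever the random choices, `p` halts on `d` after at most `t` steps and at most `q`
distance evaluations. -/
def HaltsWithin (p : Program) (κ : ℕ) {n : ℕ} (d : Fin n → Fin n → ℝ) (t q : ℕ) : Prop :=
  ∀ s ∈ (run p κ d t).support, s.Halted ∧ s.queries ≤ q

/-- Distribution of the graph in the output array after `t` steps. -/
noncomputable def outputAfter (p : Program) (κ : ℕ) {n : ℕ} (d : Fin n → Fin n → ℝ) (t : ℕ) :
    PMF (Digraph (Fin n)) :=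
  (run p κ d t).map (outputGraph n)

end NavGraph

/-! For a fixed point `i`, a graph is navigable at `i` exactly if the out-neighbors of `i` solve a
set cover problem: the elements are the points `j ≠ i`, and `k` covers `j` if `rk j k < rk j i`,
where `rk j` ranks the points by their distance from `j`. The problems for different `i` are
independent, so it suffices to be within a factor `O(log n)` of the optimum at every vertex
(`Navigable.hasCover`). Written out, the `n` instances have cubic size; the point is to solve them
all in time `Õ(n²)` from the sorted rows of the distance matrix.

Let `σ = 2 ^ t` be a guess for the optimum and `R = n / σ + 1`. An element with `rk j i ≥ R` has at
least `R` covering points, and `O(σ log n)` random points contain, with high probability, one of the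
`R` points nearest to `j`, for all `j` at once (`card_missing_top`). The other elements are rare:
there are at most `n * R` of them in all instances together (`sum_card_rareElements_le`), and the
fewer than `R` points covering one of them form a prefix of a sorted row. They are treated in `O(log
n)` rounds. A round samples `σ * B` uncovered elements and scans the points, picking each one that
covers more than a `1 / (2 * σ)` fraction of the samples among those still uncovered. At most `2 *
σ` points are picked, and if `σ` points cover everything, at most half of the samples stay uncovered
(`round_spec`). If samples are representative, at most `15/16` of the uncovered elements remain, so
after `11 * L` rounds none is left (`solveInstance_spec`). As `σ * R = O(n)`, the cost of all
instances is `Õ(n²)` (`solveAll_spec`).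

One random tape serves all rounds, instances and guesses. The sets that occur depend on the tape,
but `Representative` quantifies over all pairs of small sets, and a union bound over the `n ^ O(σ
log n)` pairs is affordable, because one pair fails with probability at most `2 ^ (-σ * H)`, `H`
being half of `B` (`card_unrepresentative`, `card_not_goodTape`). On a good tape every guess that is
at least the optimum succeeds, and success is checked, so the first successful guess is at most
twice the optimum (`Status.exists_solvedAt`).

Once the tape is drawn, the run is deterministic. It is analysed with a weakest precondition
calculus that counts steps, and the output distribution is the image of the uniform distribution on
tapes (`run_algorithm_of_wp`), so probabilities become counts of tapes. -/

namespace NavGraph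

/-! ### Big-step semantics of the sampling-free programs, with exact running times -/

/-- A configuration without the stack of programs that remain to be executed. -/
structure Mem where
  vars : ℕ → ℕ
  words : ℕ → ℕ → ℕ
  dists : ℕ → ℕ → ℝ
  queries : ℕ

/-- The configuration with memory `s` and stack `k`. -/
def Mem.cfg (s : Mem) (k : List Program) : Config :=
  ⟨s.vars, s.words, s.dists, s.queries, k⟩

/-- Memory with variable `x` set to `v`. -/
def Mem.setVar (s : Mem) (x v : ℕ) : Mem := { s with vars := Function.update s.vars x v }

/-- Memory with entry `k` of word array `a` set to `v`. -/
def Mem.setWord (s : Mem) (a k v : ℕ) : Mem := { s with words := setEntry s.words a k v }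

/-- Memory with entry `k` of distance array `a` set to `v`. -/
def Mem.setDist (s : Mem) (a k : ℕ) (v : ℝ) : Mem := { s with dists := setEntry s.dists a k v }

/-- Memory with one more counted query. -/
def Mem.addQuery (s : Mem) : Mem := { s with queries := s.queries + 1 }

theorem setEntry_apply {α : Type} (m : ℕ → ℕ → α) (a k : ℕ) (v : α) (b l : ℕ) :
    setEntry m a k v b l = if b = a ∧ l = k then v else m b l := by
  unfold setEntry
  by_cases hb : b = a
  · subst hb
    by_cases hl : l = k <;> simp [hl]
  · simp [hb]

section simps
variable (s : Mem) (x v a k : ℕ) (r : ℝ)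

@[simp] theorem Mem.setVar_vars (y : ℕ) :
    (s.setVar x v).vars y = if y = x then v else s.vars y := by
  simp [Mem.setVar, Function.update_apply]
@[simp] theorem Mem.setVar_words : (s.setVar x v).words = s.words := rfl
@[simp] theorem Mem.setVar_dists : (s.setVar x v).dists = s.dists := rfl
@[simp] theorem Mem.setVar_queries : (s.setVar x v).queries = s.queries := rfl
@[simp] theorem Mem.setWord_vars : (s.setWord a k v).vars = s.vars := rfl
@[simp] theorem Mem.setWord_words (b l : ℕ) :
    (s.setWord a k v).words b l = if b = a ∧ l = k then v else s.words b l :=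
  setEntry_apply ..
@[simp] theorem Mem.setDist_dists (b l : ℕ) :
    (s.setDist a k r).dists b l = if b = a ∧ l = k then r else s.dists b l :=
  setEntry_apply ..
@[simp] theorem Mem.setDist_queries : (s.setDist a k r).queries = s.queries := rfl
@[simp] theorem Mem.addQuery_dists : s.addQuery.dists = s.dists := rfl
@[simp] theorem Mem.addQuery_queries : s.addQuery.queries = s.queries + 1 := rfl

end simps

instance : Add WordExpr := ⟨.bin .add⟩
instance : Sub WordExpr := ⟨.bin .sub⟩
instance : Mul WordExpr := ⟨.bin .mul⟩
instance : Div WordExpr := ⟨.bin .div⟩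
instance : Mod WordExpr := ⟨.bin .mod⟩

/-- Sequential composition. -/
infixr:60 " ;; " => Program.seq

/-- Value of a word expression in a memory. -/
def ev (W : ℕ) (s : Mem) (e : WordExpr) : ℕ := e.value W (s.cfg [])

/-- Whether a test succeeds in a memory. -/
def holds (W : ℕ) (s : Mem) (t : Test) : Prop := t.Holds W (s.cfg [])

section values
variable (W : ℕ) (s : Mem)

@[simp] theorem ev_const (c : ℕ) : ev W s (.const c) = c % W := rfl
@[simp] theorem ev_var (x : ℕ) : ev W s (.var x) = s.vars x := rfl
@[simp] theorem ev_get (a : ℕ) (e : WordExpr) : ev W s (.get a e) = s.words a (ev W s e) := rfl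
@[simp] theorem ev_add (e f : WordExpr) : ev W s (e + f) = (ev W s e + ev W s f) % W := rfl
@[simp] theorem ev_sub (e f : WordExpr) : ev W s (e - f) = (ev W s e - ev W s f) % W := rfl
@[simp] theorem ev_mul (e f : WordExpr) : ev W s (e * f) = (ev W s e * ev W s f) % W := rfl
@[simp] theorem ev_div (e f : WordExpr) : ev W s (e / f) = (ev W s e / ev W s f) % W := rfl
@[simp] theorem ev_mod (e f : WordExpr) : ev W s (e % f) = (ev W s e % ev W s f) % W := rfl
@[simp] theorem holds_lt (e f : WordExpr) : holds W s (.lt e f) ↔ ev W s e < ev W s f := Iff.rfl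
@[simp] theorem holds_eq (e f : WordExpr) : holds W s (.eq e f) ↔ ev W s e = ev W s f := Iff.rfl
@[simp] theorem holds_distLt (a b : ℕ) (e f : WordExpr) :
    holds W s (.distLt a e b f) ↔ s.dists a (ev W s e) < s.dists b (ev W s f) := Iff.rfl

theorem value_cfg (k : List Program) (e : WordExpr) : e.value W (s.cfg k) = ev W s e := by
  induction e with
  | const c => rfl
  | var x => rfl
  | get a e ih => simp only [WordExpr.value, ih, ev_get]; rfl
  | bin o e f ihe ihf => simp only [WordExpr.value, ihe, ihf]; rfl

theorem holds_cfg (k : List Program) (t : Test) : t.Holds W (s.cfg k) ↔ holds W s t := by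
  cases t with
  | lt e f => simp only [Test.Holds, value_cfg, holds_lt]
  | eq e f => simp only [Test.Holds, value_cfg, holds_eq]
  | distLt a e b f => simp only [Test.Holds, value_cfg, holds_distLt]; rfl

end values

/-- `Exec W d p s s' c`: program `p` transforms `s` into `s'` in exactly `c` steps, without
sampling. -/
inductive Exec (W : ℕ) {n : ℕ} (d : Fin n → Fin n → ℝ) : Program → Mem → Mem → ℕ → Prop
  | skip (s) : Exec W d .skip s s 1
  | assign (x e s) : Exec W d (.assign x e) s (s.setVar x (ev W s e)) 1
  | store (a e f s) : Exec W d (.store a e f) s (s.setWord a (ev W s e) (ev W s f)) 1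
  | query (a e f g s) : Exec W d (.query a e f g) s
      ((s.setDist a (ev W s e) (oracle d (ev W s f) (ev W s g))).addQuery) 1
  | seq {p q s s₁ s₂ c₁ c₂} : Exec W d p s s₁ c₁ → Exec W d q s₁ s₂ c₂ →
      Exec W d (.seq p q) s s₂ (c₁ + c₂ + 1)
  | ite_pos {t p q s s₁ c} : holds W s t → Exec W d p s s₁ c → Exec W d (.ite t p q) s s₁ (c + 1)
  | ite_neg {t p q s s₁ c} : ¬ holds W s t → Exec W d q s s₁ c → Exec W d (.ite t p q) s s₁ (c + 1)
  | loop_done {t p s} : ¬ holds W s t → Exec W d (.loop t p) s s 1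
  | loop_step {t p s s₁ s₂ c₁ c₂} : holds W s t → Exec W d p s s₁ c₁ →
      Exec W d (.loop t p) s₁ s₂ c₂ → Exec W d (.loop t p) s s₂ (c₁ + c₂ + 1)

/-- Distribution of the configuration after `t` steps from `s`. -/
noncomputable def runFrom (W : ℕ) {n : ℕ} (d : Fin n → Fin n → ℝ) : ℕ → Config → PMF Config
  | 0, s => PMF.pure s
  | t + 1, s => (step W d s).bind (runFrom W d t)

section runFrom
variable {W n : ℕ} {d : Fin n → Fin n → ℝ}

theorem runFrom_add (t u : ℕ) (s : Config) :
    runFrom W d (t + u) s = (runFrom W d t s).bind (runFrom W d u) := by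
  induction t generalizing s with
  | zero => simp [runFrom]
  | succ t ih =>
    rw [Nat.succ_add]
    simp only [runFrom, PMF.bind_bind]
    congr 1
    funext x
    exact ih x

theorem run_eq_runFrom (p : Program) (κ t : ℕ) :
    run p κ d t = runFrom (wordBound κ n) d t (initial p n) := by
  induction t with
  | zero => rfl
  | succ t ih =>
    rw [run, ih, runFrom_add]
    congr 1
    funext x
    simp [runFrom]

theorem runFrom_halted (t : ℕ) (s : Config) (h : s.Halted) :
    runFrom W d t s = PMF.pure s := by
  induction t with
  | zero => rfl
  | succ t ih =>
    have : step W d s = PMF.pure s := by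
      unfold step; rw [show s.todo = [] from h]
    simp [runFrom, this, ih]

/-- Connects the big-step relation with the machine: without sampling, the distribution after
exactly `c` steps is a point mass. The arbitrary stack `k` is what makes sequencing and loops
compose. -/
theorem Exec.runFrom_eq {p : Program} {s s' : Mem} {c : ℕ} (h : Exec W d p s s' c)
    (k : List Program) : runFrom W d c (s.cfg (p :: k)) = PMF.pure (s'.cfg k) := by
  induction h generalizing k with
  | skip s => simp [runFrom, step, Mem.cfg]
  | assign x e s => simp [runFrom, step, Mem.cfg, Mem.setVar, ← value_cfg W s (.assign x e :: k)]
  | store a e f s =>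
    simp [runFrom, step, Mem.cfg, Mem.setWord, ← value_cfg W s (.store a e f :: k)]
  | query a e f g s =>
    simp [runFrom, step, Mem.cfg, Mem.setDist, Mem.addQuery, ← value_cfg W s (.query a e f g :: k)]
  | @seq p q s s₁ s₂ c₁ c₂ _ _ ih₁ ih₂ =>
    have h1 : step W d (s.cfg (.seq p q :: k)) = PMF.pure (s.cfg (p :: q :: k)) := by
      simp [step, Mem.cfg]
    rw [runFrom, h1, PMF.pure_bind, runFrom_add, ih₁, PMF.pure_bind, ih₂]
  | @ite_pos t p q s s₁ c ht _ ih =>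
    have h1 : step W d (s.cfg (.ite t p q :: k)) = PMF.pure (s.cfg (p :: k)) := by
      have := (holds_cfg W s (.ite t p q :: k) t).2 ht
      simp only [Mem.cfg] at this
      simp [step, Mem.cfg, this]
    rw [runFrom, h1, PMF.pure_bind, ih]
  | @ite_neg t p q s s₁ c ht _ ih =>
    have h1 : step W d (s.cfg (.ite t p q :: k)) = PMF.pure (s.cfg (q :: k)) := by
      have := (holds_cfg W s (.ite t p q :: k) t).not.2 ht
      simp only [Mem.cfg] at this
      simp [step, Mem.cfg, this]
    rw [runFrom, h1, PMF.pure_bind, ih]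
  | @loop_done t p s ht =>
    have := (holds_cfg W s (.loop t p :: k) t).not.2 ht
    simp only [Mem.cfg] at this
    simp [runFrom, step, Mem.cfg, this]
  | @loop_step t p s s₁ s₂ c₁ c₂ ht _ _ ih₁ ih₂ =>
    have h1 : step W d (s.cfg (.loop t p :: k)) = PMF.pure (s.cfg (p :: .loop t p :: k)) := by
      have := (holds_cfg W s (.loop t p :: k) t).2 ht
      simp only [Mem.cfg] at this
      simp [step, Mem.cfg, this]
    rw [runFrom, h1, PMF.pure_bind, runFrom_add, ih₁, PMF.pure_bind, ih₂]

end runFrom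

/-! ### Frame conditions -/

/-- Whether variable `x` is written by a program. -/
def Program.writesVar (x : ℕ) : Program → Bool
  | .assign y _ => x == y
  | .sample y _ => x == y
  | .seq p q => p.writesVar x || q.writesVar x
  | .ite _ p q => p.writesVar x || q.writesVar x
  | .loop _ p => p.writesVar x
  | _ => false

/-- Whether word array `a` is written by a program. -/
def Program.writesWord (a : ℕ) : Program → Bool
  | .store b _ _ => a == b
  | .seq p q => p.writesWord a || q.writesWord a
  | .ite _ p q => p.writesWord a || q.writesWord a
  | .loop _ p => p.writesWord a
  | _ => false

/-- Whether a program evaluates the distance function or moves distances. -/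
def Program.writesDist : Program → Bool
  | .query _ _ _ _ => true
  | .move _ _ _ _ => true
  | .seq p q => p.writesDist || q.writesDist
  | .ite _ p q => p.writesDist || q.writesDist
  | .loop _ p => p.writesDist
  | _ => false

/-- The part of the memory that `p` does not write is the same in `s` and `s'`. -/
structure Frame (p : Program) (s s' : Mem) : Prop where
  var : ∀ x, p.writesVar x = false → s'.vars x = s.vars x
  word : ∀ a, p.writesWord a = false → s'.words a = s.words a
  dist : p.writesDist = false → s'.dists = s.dists
  queries : p.writesDist = false → s'.queries = s.queries

theorem Frame.refl (p : Program) (s : Mem) : Frame p s s :=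
  ⟨fun _ _ => rfl, fun _ _ => rfl, fun _ => rfl, fun _ => rfl⟩

theorem Frame.trans {p : Program} {s s₁ s₂ : Mem} (h : Frame p s s₁) (h' : Frame p s₁ s₂) :
    Frame p s s₂ :=
  ⟨fun x hx => (h'.var x hx).trans (h.var x hx), fun x hx => (h'.word x hx).trans (h.word x hx),
    fun hx => (h'.dist hx).trans (h.dist hx), fun hx => (h'.queries hx).trans (h.queries hx)⟩

theorem Frame.of_le {p q : Program} {s s' : Mem} (h : Frame p s s')
    (hv : ∀ x, q.writesVar x = false → p.writesVar x = false)
    (hw : ∀ x, q.writesWord x = false → p.writesWord x = false)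
    (hd : q.writesDist = false → p.writesDist = false) : Frame q s s' :=
  ⟨fun x hx => h.var x (hv x hx), fun x hx => h.word x (hw x hx), fun hx => h.dist (hd hx),
    fun hx => h.queries (hd hx)⟩

section wp
variable {W n : ℕ} {d : Fin n → Fin n → ℝ}

theorem Exec.frame {p : Program} {s s' : Mem} {c : ℕ} (h : Exec W d p s s' c) : Frame p s s' := by
  induction h with
  | skip s => exact .refl _ _
  | assign x e s =>
    refine ⟨fun y hy => ?_, fun _ _ => rfl, fun _ => rfl, fun _ => rfl⟩
    have : y ≠ x := by simpa [Program.writesVar] using hy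
    simp [this]
  | store a e f s =>
    refine ⟨fun y hy => rfl, fun b hb => ?_, fun _ => rfl, fun _ => rfl⟩
    have : b ≠ a := by simpa [Program.writesWord] using hb
    funext l
    simp [this]
  | query a e f g s =>
    exact ⟨fun y hy => rfl, fun b hb => rfl, fun h => by simp [Program.writesDist] at h,
      fun h => by simp [Program.writesDist] at h⟩
  | seq _ _ ih₁ ih₂ =>
    refine (ih₁.of_le ?_ ?_ ?_).trans (ih₂.of_le ?_ ?_ ?_) <;>
      simp +contextual [Program.writesVar, Program.writesWord, Program.writesDist]
  | ite_pos _ _ ih =>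
    refine ih.of_le ?_ ?_ ?_ <;>
      simp +contextual [Program.writesVar, Program.writesWord, Program.writesDist]
  | ite_neg _ _ ih =>
    refine ih.of_le ?_ ?_ ?_ <;>
      simp +contextual [Program.writesVar, Program.writesWord, Program.writesDist]
  | loop_done _ => exact .refl _ _
  | loop_step _ _ _ ih₁ ih₂ =>
    refine (ih₁.of_le ?_ ?_ ?_).trans ih₂ <;>
      simp +contextual [Program.writesVar, Program.writesWord, Program.writesDist]

/-! ### A weakest precondition calculus that keeps track of the running time -/

/-- From `s`, program `p` terminates without sampling in a state and after a number of steps that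
satisfy `Q`. -/
def wp (W : ℕ) {n : ℕ} (d : Fin n → Fin n → ℝ) (p : Program) (Q : Mem → ℕ → Prop) (s : Mem) :
    Prop :=
  ∃ s' c, Exec W d p s s' c ∧ Q s' c

theorem wp.mono {p : Program} {Q Q' : Mem → ℕ → Prop} {s : Mem} (h : wp W d p Q s)
    (hQ : ∀ s' c, Frame p s s' → Q s' c → Q' s' c) : wp W d p Q' s := by
  obtain ⟨s', c, he, hq⟩ := h
  exact ⟨s', c, he, hQ s' c he.frame hq⟩

theorem wp_skip {Q : Mem → ℕ → Prop} {s : Mem} : wp W d .skip Q s ↔ Q s 1 :=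
  ⟨by rintro ⟨_, _, ⟨⟩, h⟩; exact h, fun h => ⟨_, _, .skip s, h⟩⟩

theorem wp_assign {x : ℕ} {e : WordExpr} {Q : Mem → ℕ → Prop} {s : Mem} :
    wp W d (.assign x e) Q s ↔ Q (s.setVar x (ev W s e)) 1 :=
  ⟨by rintro ⟨_, _, ⟨⟩, h⟩; exact h, fun h => ⟨_, _, .assign x e s, h⟩⟩

theorem wp_store {a : ℕ} {e f : WordExpr} {Q : Mem → ℕ → Prop} {s : Mem} :
    wp W d (.store a e f) Q s ↔ Q (s.setWord a (ev W s e) (ev W s f)) 1 :=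
  ⟨by rintro ⟨_, _, ⟨⟩, h⟩; exact h, fun h => ⟨_, _, .store a e f s, h⟩⟩

theorem wp_query {a : ℕ} {e f g : WordExpr} {Q : Mem → ℕ → Prop} {s : Mem} :
    wp W d (.query a e f g) Q s ↔
      Q (s.setDist a (ev W s e) (oracle d (ev W s f) (ev W s g))).addQuery 1 :=
  ⟨by rintro ⟨_, _, ⟨⟩, h⟩; exact h, fun h => ⟨_, _, .query a e f g s, h⟩⟩

theorem wp_seq {p q : Program} {Q : Mem → ℕ → Prop} {s : Mem} :
    wp W d (.seq p q) Q s ↔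
      wp W d p (fun s₁ c₁ => wp W d q (fun s₂ c₂ => Q s₂ (c₁ + c₂ + 1)) s₁) s := by
  constructor
  · rintro ⟨_, _, ⟨⟩, h⟩
    exact ⟨_, _, ‹_›, _, _, ‹_›, h⟩
  · rintro ⟨s₁, c₁, h₁, s₂, c₂, h₂, h⟩
    exact ⟨_, _, .seq h₁ h₂, h⟩

theorem wp_ite {t : Test} {p q : Program} {Q : Mem → ℕ → Prop} {s : Mem} :
    wp W d (.ite t p q) Q s ↔
      (holds W s t → wp W d p (fun s₁ c₁ => Q s₁ (c₁ + 1)) s) ∧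
      (¬ holds W s t → wp W d q (fun s₁ c₁ => Q s₁ (c₁ + 1)) s) := by
  constructor
  · rintro ⟨_, _, ⟨⟩, h⟩
    · exact ⟨fun _ => ⟨_, _, ‹_›, h⟩, fun h => absurd ‹holds W s t› h⟩
    · exact ⟨fun h => absurd h ‹¬ holds W s t›, fun _ => ⟨_, _, ‹_›, h⟩⟩
  · rintro ⟨h₁, h₂⟩
    by_cases ht : holds W s t
    · obtain ⟨s₁, c, h, hQ⟩ := h₁ ht
      exact ⟨_, _, .ite_pos ht h, hQ⟩
    · obtain ⟨s₁, c, h, hQ⟩ := h₂ ht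
      exact ⟨_, _, .ite_neg ht h, hQ⟩

/-- The number `N` of rounds is known in advance, and the invariant also sees the steps spent so
far, so time and correctness are proved together. The frame hypotheses spare invariants from listing
the unchanged memory. The extra step in the conclusion is the final failing test. -/
theorem wp_loop {t : Test} {p : Program} {s : Mem} (N : ℕ) (I : ℕ → Mem → ℕ → Prop)
    (h0 : I 0 s 0)
    (hstep : ∀ i < N, ∀ s' c, Frame (.loop t p) s s' → I i s' c →
      holds W s' t ∧ wp W d p (fun s₁ c₁ => I (i + 1) s₁ (c + c₁ + 1)) s')
    (hN : ∀ s' c, Frame (.loop t p) s s' → I N s' c → ¬ holds W s' t) :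
    wp W d (.loop t p) (fun s' c => ∃ c₀, c = c₀ + 1 ∧ I N s' c₀) s := by
  -- Induction on the number `m` of rounds that are still to come.
  have key : ∀ m ≤ N, ∀ s' c, Frame (.loop t p) s s' → I (N - m) s' c →
      wp W d (.loop t p) (fun s₂ c₂ => ∃ c₀, c + c₂ = c₀ + 1 ∧ I N s₂ c₀) s' := by
    intro m
    induction m with
    | zero =>
      intro _ s' c hF hI
      exact ⟨s', 1, .loop_done (hN s' c hF hI), c, rfl, hI⟩
    | succ m ih =>
      intro hm s' c hF hI
      obtain ⟨ht, s₁, c₁, h₁, hI₁⟩ := hstep (N - (m + 1)) (by omega) s' c hF hI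
      rw [show N - (m + 1) + 1 = N - m by omega] at hI₁
      obtain ⟨s₂, c₂, h₂, c₀, hc₀, hQ⟩ := ih (by omega) s₁ _ (hF.trans (h₁.frame.of_le
        (fun _ h => h) (fun _ h => h) (fun h => h))) hI₁
      exact ⟨s₂, _, .loop_step ht h₁ h₂, c₀, by omega, hQ⟩
  obtain ⟨s', c, h, c₀, hc, hI⟩ := key N le_rfl s 0 (.refl _ _) (by simpa using h0)
  exact ⟨s', c, h, c₀, by omega, hI⟩

/-- `for x = 0, …, y - 1 do p`. -/
def Program.forLoop (x y : ℕ) (p : Program) : Program :=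
  .seq (.assign x (.const 0))
    (.loop (.lt (.var x) (.var y)) (.seq p (.assign x (.var x + .const 1))))

/-- A round costs three steps besides its body: test, sequencing and increment. Three more go to the
outer sequencing, the initialization and the failing test. The bound `N < W` keeps the counter from
wrapping around. -/
theorem wp_forLoop {x y : ℕ} {p : Program} {s : Mem} {N : ℕ} (hN : s.vars y = N) (hNW : N < W)
    (hx : p.writesVar x = false) (hy : p.writesVar y = false) (hxy : y ≠ x)
    (I : ℕ → Mem → ℕ → Prop) (h0 : I 0 (s.setVar x 0) 0)
    (hstep : ∀ i < N, ∀ s' c, Frame (.forLoop x y p) s s' → s'.vars x = i → I i s' c →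
      wp W d p (fun s₁ c₁ => I (i + 1) (s₁.setVar x (i + 1)) (c + c₁ + 3)) s') :
    wp W d (.forLoop x y p) (fun s' c => ∃ c₀, c = c₀ + 3 ∧ I N s' c₀ ∧ s'.vars x = N) s := by
  have hle : ∀ {s'}, Frame (.loop (.lt (.var x) (.var y))
      (.seq p (.assign x (.var x + .const 1)))) (s.setVar x 0) s' →
      Frame (.forLoop x y p) s s' ∧ s'.vars y = N := by
    intro s' hF
    have h1 : Frame (.forLoop x y p) (s.setVar x 0) s' := by
      refine hF.of_le ?_ ?_ ?_ <;>
        simp +contextual [Program.forLoop, Program.writesVar, Program.writesWord,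
          Program.writesDist]
    have h2 : Frame (.forLoop x y p) s (s.setVar x 0) := by
      refine ⟨fun z hz => ?_, fun _ _ => rfl, fun _ => rfl, fun _ => rfl⟩
      have : z ≠ x := by
        rintro rfl
        simp [Program.forLoop, Program.writesVar] at hz
      simp [this]
    refine ⟨h2.trans h1, ?_⟩
    rw [hF.var y (by simp [Program.writesVar, hy, hxy])]
    simp [hxy, hN]
  rw [Program.forLoop, wp_seq, wp_assign]
  have hW0 : ev W s (.const 0) = 0 := by simp
  rw [hW0]
  refine (wp_loop N (fun i s' c => I i s' c ∧ s'.vars x = i) ⟨h0, by simp⟩ ?_ ?_).mono ?_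
  · rintro i hi s' c hF ⟨hI, hxi⟩
    obtain ⟨hF', hyN⟩ := hle hF
    refine ⟨by simp [hxi, hyN, hi], ?_⟩
    rw [wp_seq]
    refine (hstep i hi s' c hF' hxi hI).mono ?_
    intro s₁ c₁ hF₁ hI₁
    rw [wp_assign]
    have hx1 : s₁.vars x = i := by rw [hF₁.var x hx, hxi]
    have : ev W s₁ (.var x + .const 1 : WordExpr) = i + 1 := by
      have h1 : (1 : ℕ) % W = 1 := Nat.mod_eq_of_lt (by omega)
      simp only [ev_add, ev_var, ev_const, hx1, h1]
      exact Nat.mod_eq_of_lt (by omega)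
    rw [this]
    exact ⟨by convert hI₁ using 1; omega, by simp⟩
  · rintro s' c hF ⟨_, hxN⟩
    simp [hxN, (hle hF).2]
  · rintro s' c hF ⟨c₀, hc, hI, hxN⟩
    exact ⟨c₀, by omega, hI, hxN⟩

/-- A `for` loop whose `i`-th round takes at most `T i` steps. -/
theorem wp_forLoop_sum {x y : ℕ} {p : Program} {s : Mem} {N : ℕ} (hN : s.vars y = N) (hNW : N < W)
    (hx : p.writesVar x = false) (hy : p.writesVar y = false) (hxy : y ≠ x)
    (T : ℕ → ℕ) (I : ℕ → Mem → Prop) (h0 : I 0 (s.setVar x 0))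
    (hstep : ∀ i < N, ∀ s', Frame (.forLoop x y p) s s' → s'.vars x = i → I i s' →
      wp W d p (fun s₁ c₁ => c₁ ≤ T i ∧ I (i + 1) (s₁.setVar x (i + 1))) s') :
    wp W d (.forLoop x y p)
      (fun s' c => c ≤ ∑ i ∈ Finset.range N, (T i + 3) + 3 ∧ I N s') s := by
  refine (wp_forLoop hN hNW hx hy hxy
    (fun i s' c => c ≤ ∑ i ∈ Finset.range i, (T i + 3) ∧ I i s') ⟨by simp, h0⟩ ?_).mono ?_
  · rintro i hi s' c hF hxi ⟨hc, hI⟩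
    refine (hstep i hi s' hF hxi hI).mono ?_
    rintro s₁ c₁ - ⟨hc₁, hI₁⟩
    rw [Finset.sum_range_succ]
    exact ⟨by omega, hI₁⟩
  · rintro s' c - ⟨c₀, rfl, ⟨hc, hI⟩, -⟩
    exact ⟨by omega, hI⟩

/-- A `for` loop each of whose rounds takes at most `T` steps. -/
theorem wp_forLoop_le {x y : ℕ} {p : Program} {s : Mem} {N : ℕ} (hN : s.vars y = N) (hNW : N < W)
    (hx : p.writesVar x = false) (hy : p.writesVar y = false) (hxy : y ≠ x)
    (T : ℕ) (I : ℕ → Mem → Prop) (h0 : I 0 (s.setVar x 0))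
    (hstep : ∀ i < N, ∀ s', Frame (.forLoop x y p) s s' → s'.vars x = i → I i s' →
      wp W d p (fun s₁ c₁ => c₁ ≤ T ∧ I (i + 1) (s₁.setVar x (i + 1))) s') :
    wp W d (.forLoop x y p) (fun s' c => c ≤ N * (T + 3) + 3 ∧ I N s') s := by
  refine (wp_forLoop_sum hN hNW hx hy hxy (fun _ => T) I h0 hstep).mono ?_
  rintro s' c - ⟨hc, hI⟩
  exact ⟨by simpa using hc, hI⟩

end wp

/-! ### Ranks -/

/-- Number of elements of `S` with a smaller value of `D` than `x`. -/
noncomputable def below (D : ℕ → ℝ) (S : Finset ℕ) (x : ℕ) : ℕ :=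
  (S.filter fun y => D y < D x).card

section below
variable {D : ℕ → ℝ} {S : Finset ℕ}

theorem below_lt_card {x : ℕ} (hx : x ∈ S) : below D S x < S.card := by
  apply Finset.card_lt_card
  refine ⟨Finset.filter_subset _ _, fun h => ?_⟩
  simpa using h hx

theorem below_le_card (x : ℕ) : below D S x ≤ S.card := Finset.card_filter_le _ _

theorem below_le_below {x y : ℕ} (h : D x ≤ D y) : below D S x ≤ below D S y := by
  apply Finset.card_le_card
  intro z hz
  simp only [Finset.mem_filter] at hz ⊢
  exact ⟨hz.1, hz.2.trans_le h⟩

theorem below_lt_below {x y : ℕ} (hx : x ∈ S) (h : D x < D y) : below D S x < below D S y := by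
  apply Finset.card_lt_card
  refine ⟨?_, fun h' => ?_⟩
  · intro z hz
    simp only [Finset.mem_filter] at hz ⊢
    exact ⟨hz.1, hz.2.trans h⟩
  · have := h' (Finset.mem_filter.2 ⟨hx, h⟩)
    simp at this

theorem below_lt_iff {x y : ℕ} (hx : x ∈ S) : below D S x < below D S y ↔ D x < D y :=
  ⟨fun h => by
    by_contra h'
    exact absurd (below_le_below (S := S) (not_lt.1 h')) (not_le.2 h), below_lt_below hx⟩

theorem below_injOn (hD : Set.InjOn D S) : Set.InjOn (below D S) S := by
  intro x hx y hy h
  apply hD hx hy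
  rcases lt_trichotomy (D x) (D y) with h' | h' | h'
  · exact absurd h (below_lt_below hx h').ne
  · exact h'
  · exact absurd h (below_lt_below hy h').ne'

/-- The ranks of the elements are distinct numbers below `S.card`, so every such number occurs. -/
theorem exists_below_eq (hD : Set.InjOn D S) {m : ℕ} (hm : m < S.card) :
    ∃ z ∈ S, below D S z = m := by
  have h1 : S.image (below D S) = Finset.range S.card := by
    apply Finset.eq_of_subset_of_card_le
    · intro m hm
      obtain ⟨x, hx, rfl⟩ := Finset.mem_image.1 hm
      exact Finset.mem_range.2 (below_lt_card hx)
    · rw [Finset.card_image_of_injOn (below_injOn hD), Finset.card_range]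
  have : m ∈ S.image (below D S) := by rw [h1]; exact Finset.mem_range.2 hm
  simpa using this

/-- The correctness of binary search for a rank: one comparison with the element of rank `m - 1`
decides whether at least `m` elements lie below `x`. -/
theorem lt_iff_le_below {x z m : ℕ} (hz : z ∈ S) (hm : below D S z + 1 = m) :
    D z < D x ↔ m ≤ below D S x := by
  rw [← below_lt_iff hz]
  omega

end below

/-! ### Blocks of indices and their merging -/

/-- The `q`-th block of length `w` in `{0, …, n - 1}`. -/
def block (n w q : ℕ) : Finset ℕ := (Finset.range n).filter fun y => y / w = q

/-- The block that is merged with block `q`. -/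
def sibling (q : ℕ) : ℕ := if q % 2 = 0 then q + 1 else q - 1

section block
variable {n w q : ℕ}

theorem mem_block {y : ℕ} : y ∈ block n w q ↔ y < n ∧ y / w = q := by simp [block]

theorem block_subset_Ico (hw : 0 < w) : block n w q ⊆ Finset.Ico (q * w) (min (q * w + w) n) := by
  intro y hy
  obtain ⟨hy, rfl⟩ := mem_block.1 hy
  have := Nat.div_add_mod' y w
  have := Nat.mod_lt y hw
  rw [Finset.mem_Ico, lt_min_iff]
  omega

theorem le_card_block {m : ℕ} (hm : m ≤ w) (hmn : q * w + m ≤ n) : m ≤ (block n w q).card := by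
  rcases Nat.eq_zero_or_pos m with rfl | hm0
  · exact Nat.zero_le _
  have : Finset.Ico (q * w) (q * w + m) ⊆ block n w q := by
    intro y hy
    rw [Finset.mem_Ico] at hy
    refine mem_block.2 ⟨by omega, ?_⟩
    rw [Nat.div_eq_iff (by omega)]
    omega
  simpa using Finset.card_le_card this

/-- With `le_card_block`, this turns the question whether a block, possibly truncated at `n`, has
`m` elements into the two comparisons that the binary search makes. -/
theorem le_of_le_card_block {m : ℕ} (hw : 0 < w) (h0 : 0 < m) (hm : m ≤ (block n w q).card) :
    m ≤ w ∧ q * w + m ≤ n := by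
  have := Finset.card_le_card (block_subset_Ico (n := n) (q := q) hw)
  rw [Nat.card_Ico] at this
  omega

theorem block_two_mul (x : ℕ) (w : ℕ) : block n (w + w) (x / (w + w)) =
    block n w (x / w) ∪ block n w (sibling (x / w)) := by
  ext y
  have h : ∀ z, z / (w + w) = z / w / 2 := fun z => by rw [Nat.div_div_eq_div_mul, mul_two]
  simp only [Finset.mem_union, mem_block, h, sibling]
  generalize y / w = a
  generalize x / w = b
  split_ifs <;> omega

/-- The recurrence behind merging: a rank in the doubled block is the known rank in one half plus a
number that binary search finds in the other half. -/
theorem below_two_mul (D : ℕ → ℝ) (x w : ℕ) : below D (block n (w + w) (x / (w + w))) x =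
    below D (block n w (x / w)) x + below D (block n w (sibling (x / w))) x := by
  rw [below, block_two_mul, Finset.filter_union, Finset.card_union_of_disjoint]
  · rfl
  · rw [Finset.disjoint_left]
    intro y hy hy'
    simp only [Finset.mem_filter, mem_block, sibling] at hy hy'
    split_ifs at hy' <;> omega

theorem block_one (x : ℕ) (D : ℕ → ℝ) : below D (block n 1 x) x = 0 := by
  rw [below, Finset.card_eq_zero, Finset.filter_eq_empty_iff]
  intro y hy
  obtain ⟨-, h⟩ := mem_block.1 hy
  rw [Nat.div_one] at h
  simp [h]

theorem block_eq_range (h : n ≤ w) : block n w 0 = Finset.range n := by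
  rw [block, Finset.filter_true_of_mem]
  intro y hy
  exact Nat.div_eq_of_lt (by have := Finset.mem_range.1 hy; omega)

end block

/-! ### Merge sort

Row `j` of distance array `0` is sorted: entry `j * n + x` of word array `2` becomes the rank of
`x`, and entry `j * n + r` of word array `3` becomes the element of rank `r`. Variables: `0` holds
`n`, `1` the number of bits of `n`, `9` the row `j`, `10` the number `j * n`, `11` the level `t`,
`12` the block length `w = 2 ^ t`. -/

/-- Binary search (variable `15`) for the number of elements of the block that starts at variable
`14` that are closer than element `13`. -/
def searchStep : Program :=
  .assign 18 (.var 15 + .var 16) ;;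
  .ite (.lt (.var 18) (.var 12 + .const 1))
    (.ite (.lt (.var 14 + .var 18) (.var 0 + .const 1))
      (.ite (.distLt 0 (.var 10 + .get 3 (.var 10 + (.var 14 + .var 18 - .const 1)))
          0 (.var 10 + .var 13))
        (.assign 15 (.var 18)) .skip) .skip) .skip ;;
  .assign 16 (.var 16 / .const 2)

/-- Adds to the rank of element `13` the number of closer elements of the sibling block. -/
def mergeStep : Program :=
  .assign 14 (.var 13 / .var 12) ;;
  .ite (.eq (.var 14 % .const 2) (.const 0)) (.assign 14 ((.var 14 + .const 1) * .var 12))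
    (.assign 14 ((.var 14 - .const 1) * .var 12)) ;;
  .assign 15 (.const 0) ;; .assign 16 (.var 12) ;;
  .forLoop 17 19 searchStep ;;
  .store 2 (.var 10 + .var 13) (.get 2 (.var 10 + .var 13) + .var 15)

def sortLevel : Program :=
  .assign 19 (.var 11 + .const 1) ;;
  .forLoop 13 0 mergeStep ;;
  .assign 12 (.var 12 + .var 12) ;;
  .forLoop 13 0 (.store 3
    (.var 10 + (.var 13 / .var 12 * .var 12 + .get 2 (.var 10 + .var 13))) (.var 13))

def sortRow : Program :=
  .assign 10 (.var 9 * .var 0) ;;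
  .forLoop 13 0 (.store 2 (.var 10 + .var 13) (.const 0) ;;
    .store 3 (.var 10 + .var 13) (.var 13)) ;;
  .assign 12 (.const 1) ;;
  .forLoop 11 1 sortLevel

/-- The words are large enough for the index arithmetic on `n × n` arrays. -/
structure WordSize (n L W : ℕ) : Prop where
  pos : 0 < n
  lt : n < 2 ^ L
  le : 2 ^ L ≤ 2 * n
  word : 16 * (2 ^ L * 2 ^ L) ≤ W

theorem WordSize.nn_le {n L W : ℕ} (h : WordSize n L W) : n * n ≤ 2 ^ L * 2 ^ L :=
  Nat.mul_le_mul h.lt.le h.lt.le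

theorem WordSize.le_sq {n L W : ℕ} (_ : WordSize n L W) : 2 ^ L ≤ 2 ^ L * 2 ^ L :=
  Nat.le_mul_of_pos_left _ (by positivity)

theorem idx_le {n i k : ℕ} (hi : i < n) (hk : k ≤ n) : i * n + k ≤ n * n := by
  have : (i + 1) * n ≤ n * n := Nat.mul_le_mul_right _ hi
  rw [add_mul, one_mul] at this
  omega

section sort
variable {n L W : ℕ} {d : Fin n → Fin n → ℝ}

theorem searchStep_spec (hS : WordSize n L W) {s : Mem} {D : ℕ → ℝ} {j w q x T b e c : ℕ}
    (hD : Set.InjOn D (Finset.range n)) (h0 : s.vars 0 = n) (h10 : s.vars 10 = j * n)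
    (hj : j < n) (hd : ∀ x < n, s.dists 0 (j * n + x) = D x)
    (hw : s.vars 12 = w) (hwL : 0 < w ∧ w + w ≤ 2 ^ L)
    (hl : ∀ x < n, s.words 3 (j * n + (x / w * w + below D (block n w (x / w)) x)) = x)
    (h14 : s.vars 14 = q * w) (hq : q * w ≤ n + w) (h13 : s.vars 13 = x) (hx : x < n)
    (hT : T = below D (block n w q) x) (h15 : s.vars 15 = c) (h16 : s.vars 16 = b)
    (hb : b = 2 ^ e) (hbw : b ≤ w) (hc : c ≤ T) (hcT : T < c + 2 * b) :
    wp W d searchStep (fun s' c' => c' ≤ 10 ∧ s'.vars 15 ≤ T ∧ T < s'.vars 15 + b ∧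
      s'.vars 16 = b / 2) s := by
  have := hS.word
  have := hS.lt
  have := hS.nn_le
  have := hS.le_sq
  have hTw : T ≤ w := by
    rcases Nat.eq_zero_or_pos T with h | h
    · omega
    · exact (le_of_le_card_block hwL.1 h (hT ▸ below_le_card x)).1
  have hb0 : 0 < b := hb ▸ by positivity
  have hjn := idx_le hj le_rfl
  have hjx := idx_le hj hx
  have hW1 : 1 % W = 1 := Nat.mod_eq_of_lt (by omega)
  have hW2 : 2 % W = 2 := Nat.mod_eq_of_lt (by omega)
  have hv18 : (c + b) % W = c + b := Nat.mod_eq_of_lt (by omega)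
  have hv12 : (w + 1) % W = w + 1 := Nat.mod_eq_of_lt (by omega)
  have hvn : (n + 1) % W = n + 1 := Nat.mod_eq_of_lt (by omega)
  have hv14 : (q * w + (c + b)) % W = q * w + (c + b) := Nat.mod_eq_of_lt (by omega)
  have hv14' : (q * w + (c + b) - 1) % W = q * w + (c + b) - 1 := Nat.mod_eq_of_lt (by omega)
  have hvx : (j * n + x) % W = j * n + x := Nat.mod_eq_of_lt (by omega)
  have hvj : (j * n + (q * w + (c + b) - 1)) % W = j * n + (q * w + (c + b) - 1) :=
    Nat.mod_eq_of_lt (by omega)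
  have hvb : b / 2 % W = b / 2 := Nat.mod_eq_of_lt (by omega)
  -- The sibling block is sorted, so its position `c + b - 1` holds the element of that rank, and
  -- one comparison decides `c + b ≤ T`.
  have key : c + b ≤ w → q * w + (c + b) ≤ n →
      ∃ z < n, s.words 3 (j * n + (q * w + (c + b) - 1)) = z ∧ (D z < D x ↔ c + b ≤ T) := by
    intro h1 h2
    obtain ⟨z, hz, hzm⟩ := exists_below_eq (D := D) (S := block n w q) (m := c + b - 1)
      (hD.mono fun y hy => by simpa using (mem_block.1 hy).1)
      (by have := le_card_block h1 h2; omega)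
    obtain ⟨hzn, hzq⟩ := mem_block.1 hz
    refine ⟨z, hzn, ?_, ?_⟩
    · rw [← hl z hzn, hzq, hzm]
      congr 2
      omega
    · rw [hT]
      exact lt_iff_le_below hz (by omega)
  -- If one of the guards on the position fails, `c + b` exceeds the size of the truncated block and
  -- hence `T`, so keeping `c` is right.
  have key' : c + b ≤ T → c + b ≤ w ∧ q * w + (c + b) ≤ n := fun h =>
    le_of_le_card_block (q := q) hwL.1 (by omega) (h.trans (hT ▸ below_le_card x))
  simp only [searchStep, ↓reduceIte, Nat.reduceEqDiff, wp_seq, wp_assign, wp_ite, wp_skip, holds_lt, holds_distLt, ev_add, ev_sub,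
    ev_var, ev_get, ev_const, ev_div, Mem.setVar_vars, Mem.setVar_words, Mem.setVar_dists, hW1, hW2,
    h15, h16, hw, h14, h0, h10, h13, hv18, hv12, hvn, hv14, hv14', hvx, hvj, hvb]
  constructor
  · intro h1
    constructor
    · intro h2
      obtain ⟨z, hzn, hz, hiff⟩ := key (by omega) (by omega)
      have hvz : (j * n + z) % W = j * n + z :=
        Nat.mod_eq_of_lt (by have := idx_le hj hzn.le; omega)
      simp only [hz, hvz, hd z hzn, hd x hx, hiff]
      constructor
      · intro h; exact ⟨by norm_num, by omega, by omega, trivial⟩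
      · intro h; exact ⟨by norm_num, by omega, by omega, trivial⟩
    · intro h2
      have : ¬ c + b ≤ T := fun h => by have := key' h; omega
      exact ⟨by norm_num, by omega, by omega, trivial⟩
  · intro h1
    have : ¬ c + b ≤ T := fun h => by have := key' h; omega
    exact ⟨by norm_num, by omega, by omega, trivial⟩

theorem mergeStep_spec (hS : WordSize n L W) {s : Mem} {D : ℕ → ℝ} {j w x t : ℕ}
    (hD : Set.InjOn D (Finset.range n)) (h0 : s.vars 0 = n) (h10 : s.vars 10 = j * n)
    (hj : j < n) (hd : ∀ x < n, s.dists 0 (j * n + x) = D x)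
    (hw : s.vars 12 = w) (h19 : s.vars 19 = t + 1) (hwt : w = 2 ^ t) (hwL : w + w ≤ 2 ^ L)
    (hl : ∀ x < n, s.words 3 (j * n + (x / w * w + below D (block n w (x / w)) x)) = x)
    (h13 : s.vars 13 = x) (hx : x < n)
    (hr : s.words 2 (j * n + x) = below D (block n w (x / w)) x) :
    wp W d mergeStep (fun s' c' => c' ≤ 13 * t + 40 ∧ ∀ p, s'.words 2 p =
      if p = j * n + x then below D (block n (w + w) (x / (w + w))) x else s.words 2 p) s := by
  have := hS.word
  have := hS.lt
  have := hS.le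
  have := hS.nn_le
  have := hS.le_sq
  have hw0 : 0 < w := hwt ▸ by positivity
  have hjx := idx_le hj hx
  have hxw := Nat.div_add_mod' x w
  have ht : t < 2 ^ t := Nat.lt_two_pow_self
  have hdiv : x / w ≤ x := Nat.div_le_self _ _
  have hm2 := Nat.mod_lt (x / w) (show 0 < 2 by norm_num)
  have hW0 : 0 % W = 0 := Nat.zero_mod W
  have hW1 : 1 % W = 1 := Nat.mod_eq_of_lt (by omega)
  have hW2 : 2 % W = 2 := Nat.mod_eq_of_lt (by omega)
  have hvd : x / w % W = x / w := Nat.mod_eq_of_lt (by omega)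
  have hvm : x / w % 2 % W = x / w % 2 := Nat.mod_eq_of_lt (by omega)
  have hvs : (x / w - 1) % W = x / w - 1 := Nat.mod_eq_of_lt (by omega)
  have hva : (x / w + 1) % W = x / w + 1 := Nat.mod_eq_of_lt (by omega)
  have hsub : (x / w - 1) * w ≤ x / w * w := Nat.mul_le_mul_right _ (by omega)
  have hvsm : (x / w - 1) * w % W = (x / w - 1) * w := Nat.mod_eq_of_lt (by omega)
  have hadd : (x / w + 1) * w = x / w * w + w := by ring
  have hvam : (x / w + 1) * w % W = (x / w + 1) * w := Nat.mod_eq_of_lt (by omega)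
  have hvx : (j * n + x) % W = j * n + x := Nat.mod_eq_of_lt (by omega)
  -- Both parities of `x / w` continue identically once variable `14` holds the start of the sibling
  -- block.
  have main : ∀ s₁ : Mem, Frame mergeStep s s₁ → s₁.vars 14 = sibling (x / w) * w →
      s₁.words = s.words → wp W d (.assign 15 (.const 0) ;; .assign 16 (.var 12) ;;
        .forLoop 17 19 searchStep ;;
        .store 2 (.var 10 + .var 13) (.get 2 (.var 10 + .var 13) + .var 15))
        (fun s' c' => c' ≤ 13 * t + 30 ∧ ∀ p, s'.words 2 p =
          if p = j * n + x then below D (block n (w + w) (x / (w + w))) x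
          else s.words 2 p) s₁ := by
    intro s₁ hF h14 hwords
    simp only [wp_seq, wp_assign, ev_const, ev_var, hW0, Mem.setVar_vars, ↓reduceIte,
      Nat.reduceEqDiff, hF.var 12 rfl, hw]
    set T := below D (block n w (sibling (x / w))) x with hT
    have hTw : T ≤ w := by
      rcases Nat.eq_zero_or_pos T with h | h
      · omega
      · exact (le_of_le_card_block hw0 h (below_le_card x)).1
    -- The window for `T` starts with length `2 * w`, because `T = w` is possible, and after `t + 1`
    -- halvings has length `1`, which determines `T`.
    refine (wp_forLoop_le (N := t + 1) (x := 17) (y := 19) ?_ (by omega) rfl rfl (by norm_num) 10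
      (fun i s' => s'.vars 16 = w / 2 ^ i ∧ s'.vars 15 ≤ T ∧ T < s'.vars 15 + 2 ^ (t + 1 - i))
      ?_ ?_).mono ?_
    · simp [hF.var 19 rfl, h19]
    · simp [pow_succ]; omega
    · rintro i hi s' hF' h17 ⟨h16, h15, h15'⟩
      have hpow : w / 2 ^ i = 2 ^ (t - i) := by
        rw [hwt, Nat.pow_div (by omega) (by norm_num)]
      have hsib : sibling (x / w) * w ≤ n + w := by
        unfold sibling
        split_ifs <;> omega
      have e1 := hF'.var 0 rfl
      have e2 := hF'.var 10 rfl
      have e3 := hF'.var 12 rfl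
      have e4 := hF'.var 13 rfl
      have e5 := hF'.var 14 rfl
      have e6 := hF'.dist rfl
      have e7 := hF'.word 3 rfl
      simp only [Mem.setVar_vars, Nat.reduceEqDiff, ↓reduceIte, Mem.setVar_dists,
        Mem.setVar_words, hF.var 0 rfl, hF.var 10 rfl, hF.var 12 rfl, hF.var 13 rfl,
        hF.dist rfl, hwords, h14] at e1 e2 e3 e4 e5 e6 e7
      refine (searchStep_spec (n := n) (L := L) (D := D) (j := j) (w := w) (x := x)
        (q := sibling (x / w)) (T := T) (b := 2 ^ (t - i)) (e := t - i) hS hD (e1.trans h0)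
        (e2.trans h10) hj (by rw [e6]; exact hd) (e3.trans hw) ⟨hw0, hwL⟩ (by rw [e7]; exact hl) e5
        hsib (e4.trans h13) hx hT rfl (h16.trans hpow) rfl
        (hwt ▸ Nat.pow_le_pow_right (by norm_num) (by omega)) h15 ?_).mono ?_
      · rw [← pow_succ', show t - i + 1 = t + 1 - i by omega]; exact h15'
      · rintro s'' c' hF'' ⟨hc, g1, g2, g3⟩
        refine ⟨hc, ?_, by simpa using g1, ?_⟩
        · simp only [Mem.setVar_vars, Nat.reduceEqDiff, ↓reduceIte, g3]
          rw [← hpow, Nat.div_div_eq_div_mul, pow_succ]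
        · simpa using g2
    · rintro s' c' hF' ⟨hc, h16, h15, h15'⟩
      rw [wp_store]
      have e2 := hF'.var 10 rfl
      have e4 := hF'.var 13 rfl
      have e8 := hF'.word 2 rfl
      simp only [Mem.setVar_vars, Nat.reduceEqDiff, ↓reduceIte,
        Mem.setVar_words, hF.var 10 rfl, hF.var 13 rfl, hwords] at e2 e4 e8
      have e15 : s'.vars 15 = T := by simp at h15'; omega
      refine ⟨by omega, fun p => ?_⟩
      have hb : below D (block n (w + w) (x / (w + w))) x = below D (block n w (x / w)) x + T :=
        below_two_mul D x w
      have hlt : below D (block n w (x / w)) x ≤ w := by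
        rcases Nat.eq_zero_or_pos (below D (block n w (x / w)) x) with h | h
        · omega
        · exact (le_of_le_card_block hw0 h (below_le_card x)).1
      simp only [Mem.setWord_words, ev_add, ev_var, ev_get, e2, e4, e8, e15, h10, h13, hvx, hr,
        true_and, hb]
      rw [Nat.mod_eq_of_lt (show below D (block n w (x / w)) x + T < W by omega)]
  simp only [mergeStep, wp_seq (p := .assign 14 _), wp_seq (p := .ite _ _ _), wp_assign, wp_ite,
    ev_var, ev_div, ev_mod, ev_const, ev_mul, ev_add, ev_sub, holds_eq, hw, h13, hvd, hW1, hW2, hW0,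
    Mem.setVar_vars, Nat.reduceEqDiff, ↓reduceIte, hvm, hvs, hva, hvsm, hvam]
  constructor
  · intro h
    refine (main ((s.setVar 14 (x / w)).setVar 14 ((x / w + 1) * w))
      ⟨?_, fun _ _ => rfl, fun _ => rfl, fun _ => rfl⟩ ?_ rfl).mono ?_
    · intro y hy
      have : y ≠ 14 := by rintro rfl; simp [mergeStep, Program.writesVar] at hy
      simp [this]
    · simp [sibling, h]
    · rintro s' c' - ⟨hc, h⟩
      exact ⟨by omega, h⟩
  · intro h
    refine (main ((s.setVar 14 (x / w)).setVar 14 ((x / w - 1) * w))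
      ⟨?_, fun _ _ => rfl, fun _ => rfl, fun _ => rfl⟩ ?_ rfl).mono ?_
    · intro y hy
      have : y ≠ 14 := by rintro rfl; simp [mergeStep, Program.writesVar] at hy
      simp [this]
    · simp [sibling, h]
    · rintro s' c' - ⟨hc, h⟩
      exact ⟨by omega, h⟩

theorem idx_lt {n j k : ℕ} (hj : j < n) (hk : k < n) : j * n + k < n * n :=
  (Nat.lt_succ_self _).trans_le (idx_le hj hk)

theorem sortLevel_spec (hS : WordSize n L W) {s : Mem} {D : ℕ → ℝ} {j w t : ℕ}
    (hD : Set.InjOn D (Finset.range n)) (h0 : s.vars 0 = n) (h10 : s.vars 10 = j * n)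
    (hj : j < n) (hd : ∀ x < n, s.dists 0 (j * n + x) = D x)
    (hw : s.vars 12 = w) (h11 : s.vars 11 = t) (hwt : w = 2 ^ t) (hwL : w + w ≤ 2 ^ L)
    (hl : ∀ x < n, s.words 3 (j * n + (x / w * w + below D (block n w (x / w)) x)) = x)
    (hr : ∀ x < n, s.words 2 (j * n + x) = below D (block n w (x / w)) x) :
    wp W d sortLevel (fun s' c' => c' ≤ n * (13 * t + 50) + 20 ∧ s'.vars 12 = w + w ∧
      (∀ x < n, s'.words 2 (j * n + x) = below D (block n (w + w) (x / (w + w))) x) ∧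
      (∀ x < n, s'.words 3
        (j * n + (x / (w + w) * (w + w) + below D (block n (w + w) (x / (w + w))) x)) = x) ∧
      (∀ p, (p < j * n ∨ j * n + n ≤ p) →
        s'.words 2 p = s.words 2 p ∧ s'.words 3 p = s.words 3 p)) s := by
  have := hS.word
  have := hS.lt
  have := hS.le
  have := hS.nn_le
  have := hS.le_sq
  have hw0 : 0 < w := hwt ▸ by positivity
  have ht : t < 2 ^ t := Nat.lt_two_pow_self
  have hW1 : 1 % W = 1 := Nat.mod_eq_of_lt (by omega)
  have hvt : (t + 1) % W = t + 1 := Nat.mod_eq_of_lt (by omega)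
  have hvw : (w + w) % W = w + w := Nat.mod_eq_of_lt (by omega)
  have hjn := idx_le hj le_rfl
  simp only [sortLevel, wp_seq, wp_assign, ev_add, ev_var, ev_const, hW1, h11, hvt]
  -- This loop changes ranks only. Array `3` keeps the old sorted blocks, in which later elements
  -- still have to search, and is rewritten afterwards.
  refine (wp_forLoop_le (N := n) (x := 13) (y := 0) (by simpa using h0) (by omega) rfl rfl
    (by norm_num) (13 * t + 40)
    (fun i s' => ∀ p, s'.words 2 p = if j * n ≤ p ∧ p < j * n + i then
      below D (block n (w + w) ((p - j * n) / (w + w))) (p - j * n) else s.words 2 p) ?_ ?_).mono ?_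
  · intro p
    rw [if_neg (by omega)]
    simp
  · intro i hi s' hF h13 hI
    have e1 := hF.var 0 rfl
    have e2 := hF.var 10 rfl
    have e3 := hF.var 12 rfl
    have e4 := hF.var 19 rfl
    have e6 := hF.dist rfl
    have e7 := hF.word 3 rfl
    simp only [Mem.setVar_vars, Nat.reduceEqDiff, ↓reduceIte, Mem.setVar_dists,
      Mem.setVar_words] at e1 e2 e3 e4 e6 e7
    refine (mergeStep_spec (x := i) (t := t) hS hD (e1.trans h0) (e2.trans h10) hj
      (by rw [e6]; exact hd) (e3.trans hw) e4 hwt hwL (by rw [e7]; exact hl) h13 hi ?_).mono ?_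
    · rw [hI, if_neg (by omega), hr i hi]
    · rintro s'' c' - ⟨hc, h⟩
      refine ⟨hc, fun p => ?_⟩
      rw [Mem.setVar_words, h, hI]
      by_cases hp : p = j * n + i
      · subst hp
        simp
      · rw [if_neg hp]
        congr 1
        apply propext
        omega
  · rintro s₁ c₁ hF ⟨hc₁, hI⟩
    have e1 := hF.var 0 rfl
    have e2 := hF.var 10 rfl
    have e3 := hF.var 12 rfl
    have e7 := hF.word 3 rfl
    simp only [Mem.setVar_vars, Nat.reduceEqDiff, ↓reduceIte,
      Mem.setVar_words] at e1 e2 e3 e7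
    rw [e3, hw, hvw]
    have hr' : ∀ x < n, s₁.words 2 (j * n + x) = below D (block n (w + w) (x / (w + w))) x := by
      intro x hx
      rw [hI, if_pos (by omega), show j * n + x - j * n = x by omega]
    have hpos : ∀ x < n, x / (w + w) * (w + w) + below D (block n (w + w) (x / (w + w))) x < n := by
      intro x hx
      have h1 := below_lt_card (D := D) (S := block n (w + w) (x / (w + w))) (mem_block.2 ⟨hx, rfl⟩)
      have h2 := le_of_le_card_block (w := w + w) (by omega) (by omega) h1
      omega
    -- A target position determines the block by its quotient and then the element by its rank, so
    -- no entry is overwritten by another element.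
    have hinj : ∀ x < n, ∀ y < n, x / (w + w) * (w + w) + below D (block n (w + w) (x / (w + w))) x =
        y / (w + w) * (w + w) + below D (block n (w + w) (y / (w + w))) y → x = y := by
      intro x hx y hy h
      have hlt : ∀ z < n, below D (block n (w + w) (z / (w + w))) z < w + w := by
        intro z hz
        have h1 := below_lt_card (D := D) (S := block n (w + w) (z / (w + w)))
          (mem_block.2 ⟨hz, rfl⟩)
        have h2 := le_of_le_card_block (w := w + w) (by omega) (by omega) h1
        omega
      have h3 : ∀ z < n, (z / (w + w) * (w + w) + below D (block n (w + w) (z / (w + w))) z)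
          / (w + w) = z / (w + w) := by
        intro z hz
        rw [add_comm, Nat.add_mul_div_right _ _ (by omega), Nat.div_eq_of_lt (hlt z hz), zero_add]
      have h4 : x / (w + w) = y / (w + w) := by rw [← h3 x hx, h, h3 y hy]
      rw [h4] at h
      exact below_injOn (hD.mono fun z hz => by simpa using (mem_block.1 hz).1)
        (mem_block.2 ⟨hx, h4⟩) (mem_block.2 ⟨hy, rfl⟩) (Nat.add_left_cancel h)
    refine (wp_forLoop_le (N := n) (x := 13) (y := 0) (by simpa using e1.trans h0) (by omega)
      rfl rfl (by norm_num) 1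
      (fun i s' => (∀ x < i, s'.words 3
        (j * n + (x / (w + w) * (w + w) + below D (block n (w + w) (x / (w + w))) x)) = x) ∧
        ∀ p, (p < j * n ∨ j * n + n ≤ p) → s'.words 3 p = s.words 3 p) ?_ ?_).mono ?_
    · refine ⟨fun _ h => absurd h (by omega), fun p _ => by simp [e7]⟩
    · rintro i hi s' hF' h13 ⟨hI₁, hI₂⟩
      have g2 := hF'.var 10 rfl
      have g3 := hF'.var 12 rfl
      have g4 := hF'.word 2 rfl
      simp only [Mem.setVar_vars, Nat.reduceEqDiff, ↓reduceIte, Mem.setVar_words, e2, h10]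
        at g2 g3 g4
      have hdm := Nat.div_add_mod' i (w + w)
      have hdl : i / (w + w) ≤ i := Nat.div_le_self _ _
      have hpi := hpos i hi
      have hb1 : (j * n + i) % W = j * n + i := Nat.mod_eq_of_lt (by omega)
      have hb2 : i / (w + w) % W = i / (w + w) := Nat.mod_eq_of_lt (by omega)
      have hb3 : i / (w + w) * (w + w) % W = i / (w + w) * (w + w) := Nat.mod_eq_of_lt (by omega)
      have hb4 : (i / (w + w) * (w + w) + below D (block n (w + w) (i / (w + w))) i) % W =
        i / (w + w) * (w + w) + below D (block n (w + w) (i / (w + w))) i :=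
        Nat.mod_eq_of_lt (by omega)
      have hb5 : (j * n + (i / (w + w) * (w + w) + below D (block n (w + w) (i / (w + w))) i)) % W =
        j * n + (i / (w + w) * (w + w) + below D (block n (w + w) (i / (w + w))) i) :=
        Nat.mod_eq_of_lt (by omega)
      rw [wp_store]
      simp only [ev_add, ev_var, ev_mul, ev_div, ev_get, g2, g3, h13, g4, hb1, hr' i hi, hb2, hb3,
        hb4, hb5, Mem.setVar_words, Mem.setWord_words, true_and, le_refl]
      refine ⟨fun x hx => ?_, fun p hp => ?_⟩
      · split_ifs with h
        · exact (hinj x (by omega) i hi (Nat.add_left_cancel h)).symm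
        · refine hI₁ x ?_
          rcases Nat.lt_succ_iff_lt_or_eq.1 hx with h' | h'
          · exact h'
          · subst h'; exact absurd rfl h
      · rw [if_neg (by omega)]
        exact hI₂ p hp
    · rintro s₂ c₂ hF' ⟨hc₂, hI₁, hI₂⟩
      have g3 := hF'.var 12 rfl
      have g4 := hF'.word 2 rfl
      simp only [Mem.setVar_vars, ↓reduceIte, Mem.setVar_words] at g3 g4
      refine ⟨?_, g3, ?_, hI₁, fun p hp => ⟨?_, hI₂ p hp⟩⟩
      · have : n * (13 * t + 50) = n * (13 * t + 40 + 3) + n * (1 + 3) + n * 3 := by ring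
        omega
      · intro x hx; rw [g4, hr' x hx]
      · rw [g4, hI, if_neg (by omega)]

theorem sortRow_spec (hS : WordSize n L W) {s : Mem} {D : ℕ → ℝ} {j : ℕ}
    (hD : Set.InjOn D (Finset.range n)) (h0 : s.vars 0 = n) (h1 : s.vars 1 = L)
    (h9 : s.vars 9 = j) (hj : j < n) (hd : ∀ x < n, s.dists 0 (j * n + x) = D x) :
    wp W d sortRow (fun s' c' => c' ≤ L * (n * (13 * L + 50) + 20 + 3) + n * 10 + 20 ∧
      (∀ x < n, s'.words 2 (j * n + x) = below D (Finset.range n) x) ∧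
      (∀ x < n, s'.words 3 (j * n + below D (Finset.range n) x) = x) ∧
      (∀ p, (p < j * n ∨ j * n + n ≤ p) →
        s'.words 2 p = s.words 2 p ∧ s'.words 3 p = s.words 3 p)) s := by
  have := hS.word
  have := hS.lt
  have := hS.le
  have := hS.nn_le
  have := hS.le_sq
  have hjn := idx_le hj le_rfl
  have hLX : L < 2 ^ L := Nat.lt_two_pow_self
  have hW0 : 0 % W = 0 := Nat.zero_mod W
  have hW1 : 1 % W = 1 := Nat.mod_eq_of_lt (by omega)
  have hvj : j * n % W = j * n := Nat.mod_eq_of_lt (by omega)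
  simp only [sortRow, wp_seq (p := .assign _ _), wp_seq (p := .forLoop _ _ _), wp_assign, ev_mul,
    ev_var, ev_const, hW1, h9, h0, hvj]
  refine (wp_forLoop_le (N := n) (x := 13) (y := 0) (by simpa using h0) (by omega) rfl rfl
    (by norm_num) 3
    (fun i s' => (∀ x < i, s'.words 2 (j * n + x) = 0 ∧ s'.words 3 (j * n + x) = x) ∧
      ∀ p, (p < j * n ∨ j * n + n ≤ p) →
        s'.words 2 p = s.words 2 p ∧ s'.words 3 p = s.words 3 p) ?_ ?_).mono ?_
  · exact ⟨fun _ h => absurd h (by omega), fun p _ => by simp⟩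
  · rintro i hi s' hF h13 ⟨hI₁, hI₂⟩
    have e2 := hF.var 10 rfl
    simp only [Mem.setVar_vars, ↓reduceIte] at e2
    have hb1 : (j * n + i) % W = j * n + i := Nat.mod_eq_of_lt (by omega)
    simp only [wp_seq, wp_store, ev_add, ev_var, ev_const, e2, h13, hb1, hW0, Mem.setWord_vars,
      Mem.setVar_words, Mem.setWord_words, Nat.reduceEqDiff, false_and, ↓reduceIte, true_and,
      Nat.reduceAdd, le_refl]
    refine ⟨fun x hx => ?_, fun p hp => ?_⟩
    · by_cases h : x = i
      · subst h; simp
      · have h' : ¬ (j * n + x = j * n + i) := by omega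
        simp only [h', ↓reduceIte]
        exact hI₁ x (by omega)
    · have h' : ¬ (p = j * n + i) := by omega
      simp only [h', ↓reduceIte]
      exact hI₂ p hp
  · rintro s₁ c₁ hF ⟨hc₁, hI₁, hI₂⟩
    have e0 := hF.var 0 rfl
    have e1 := hF.var 1 rfl
    have e2 := hF.var 10 rfl
    have e6 := hF.dist rfl
    simp only [Mem.setVar_vars, Nat.reduceEqDiff, ↓reduceIte, Mem.setVar_dists] at e0 e1 e2 e6
    refine (wp_forLoop_le (N := L) (x := 11) (y := 1) (by simpa using e1.trans h1) (by omega)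
      rfl rfl (by norm_num) (n * (13 * L + 50) + 20)
      (fun i s' => s'.vars 12 = 2 ^ i ∧
        (∀ x < n, s'.words 2 (j * n + x) = below D (block n (2 ^ i) (x / 2 ^ i)) x) ∧
        (∀ x < n, s'.words 3
          (j * n + (x / 2 ^ i * 2 ^ i + below D (block n (2 ^ i) (x / 2 ^ i)) x)) = x) ∧
        (∀ p, (p < j * n ∨ j * n + n ≤ p) →
          s'.words 2 p = s.words 2 p ∧ s'.words 3 p = s.words 3 p)) ?_ ?_).mono ?_
    · simp only [Mem.setVar_vars, Nat.reduceEqDiff, ↓reduceIte, pow_zero, Nat.div_one,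
        block_one, Mem.setVar_words, mul_one, add_zero, true_and]
      exact ⟨fun x hx => (hI₁ x hx).1, fun x hx => (hI₁ x hx).2, hI₂⟩
    · rintro i hi s' hF' h11 ⟨g12, g2, g3, g4⟩
      have f0 := hF'.var 0 rfl
      have f2 := hF'.var 10 rfl
      have f6 := hF'.dist rfl
      simp only [Mem.setVar_vars, Nat.reduceEqDiff, ↓reduceIte, Mem.setVar_dists, e0, e2, e6,
        h0] at f0 f2 f6
      have hpow : 2 ^ i + 2 ^ i = 2 ^ (i + 1) := by ring
      have hpL : 2 ^ (i + 1) ≤ 2 ^ L := Nat.pow_le_pow_right (by norm_num) hi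
      refine (sortLevel_spec (t := i) hS hD f0 f2 hj (by rw [f6]; exact hd) g12 h11 rfl
        (by omega) g3 g2).mono ?_
      rintro s'' c' - ⟨hc, k12, k2, k3, k4⟩
      rw [hpow] at k12 k2 k3
      refine ⟨hc.trans ?_, by simpa using k12, by simpa using k2, by simpa using k3, ?_⟩
      · have : n * (13 * i + 50) ≤ n * (13 * L + 50) := Nat.mul_le_mul_left _ (by omega)
        omega
      · intro p hp
        have := k4 p hp
        have := g4 p hp
        simp only [Mem.setVar_words]
        constructor <;> simp_all
    · rintro s₂ c₂ hF' ⟨hc₂, -, g2, g3, g4⟩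
      -- Since `n < 2 ^ L`, a single block is left after `L` levels.
      have hdiv : ∀ x < n, x / 2 ^ L = 0 := fun x hx => Nat.div_eq_of_lt (by omega)
      refine ⟨by omega, fun x hx => ?_, fun x hx => ?_, g4⟩
      · rw [g2 x hx, hdiv x hx, block_eq_range (by omega)]
      · have := g3 x hx
        rwa [hdiv x hx, block_eq_range (by omega), zero_mul, zero_add] at this

end sort

/-! ### One covering round

Instance `i` is a set cover problem: the elements are the points `j ≠ i`, and `k` covers `j` if `k`
is closer to `j` than `i` is, that is, `rk j k < rk j i`. -/

/-- `rk j` is a bijective ranking of `{0, …, n - 1}` that starts with `j`, for every `j < n`. -/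
structure Ranking (n : ℕ) (rk : ℕ → ℕ → ℕ) : Prop where
  self : ∀ j < n, rk j j = 0
  lt : ∀ j < n, ∀ x < n, rk j x < n
  inj : ∀ j < n, ∀ x < n, ∀ y < n, rk j x = rk j y → x = y
  surj : ∀ j < n, ∀ r < n, ∃ x < n, rk j x = r

/-- The memory holds instance `i` with guess `σ`: variable `7` is the sample size `σ * B`, `10` is
`i * n`, `20` is `i`, `30` is `2 * σ`; array `1` is the random tape `y`, arrays `2` and `3` hold the
rankings and their inverses. -/
structure InstData (n B : ℕ) (rk : ℕ → ℕ → ℕ) (y : ℕ → ℕ) (i σ : ℕ) (s : Mem) : Prop where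
  v0 : s.vars 0 = n
  v7 : s.vars 7 = σ * B
  v10 : s.vars 10 = i * n
  v20 : s.vars 20 = i
  v30 : s.vars 30 = σ + σ
  tape : ∀ l < σ * B, s.words 1 l = y l
  rank : ∀ j < n, ∀ x < n, s.words 2 (j * n + x) = rk j x
  list : ∀ j < n, ∀ x < n, s.words 3 (j * n + rk j x) = x

/-- The numbers that occur in a round fit into words. -/
structure RoundSize (n B i σ W : ℕ) : Prop where
  i_lt : i < n
  σ_pos : 0 < σ
  B_pos : 0 < B
  word_sq : 4 * (n * n) < W
  word : 4 * (σ * (σ * B)) < W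

section
variable {n B W i σ : ℕ} {rk : ℕ → ℕ → ℕ} {y : ℕ → ℕ} {d : Fin n → Fin n → ℝ}

theorem InstData.frame {s s' : Mem} {p : Program} (h : InstData n B rk y i σ s)
    (hF : Frame p s s')
    (hv : (p.writesVar 0 || p.writesVar 7 || p.writesVar 10 || p.writesVar 20 ||
      p.writesVar 30 || p.writesWord 1 || p.writesWord 2 || p.writesWord 3) = false) :
    InstData n B rk y i σ s' := by
  simp only [Bool.or_eq_false_iff] at hv
  obtain ⟨⟨⟨⟨⟨⟨⟨h0, h7⟩, h10⟩, h20⟩, h30⟩, w1⟩, w2⟩, w3⟩ := hv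
  constructor
  · rw [hF.var _ h0, h.v0]
  · rw [hF.var _ h7, h.v7]
  · rw [hF.var _ h10, h.v10]
  · rw [hF.var _ h20, h.v20]
  · rw [hF.var _ h30, h.v30]
  · rw [hF.word _ w1]; exact h.tape
  · rw [hF.word _ w2]; exact h.rank
  · rw [hF.word _ w3]; exact h.list

theorem InstData.setVar {s : Mem} (h : InstData n B rk y i σ s) (x v : ℕ)
    (hx : x ∉ ({0, 7, 10, 20, 30} : Finset ℕ)) : InstData n B rk y i σ (s.setVar x v) := by
  simp only [Finset.mem_insert, Finset.mem_singleton, not_or] at hx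
  obtain ⟨h0, h7, h10, h20, h30⟩ := hx
  constructor
  · simpa [Ne.symm h0] using h.v0
  · simpa [Ne.symm h7] using h.v7
  · simpa [Ne.symm h10] using h.v10
  · simpa [Ne.symm h20] using h.v20
  · simpa [Ne.symm h30] using h.v30
  · exact h.tape
  · exact h.rank
  · exact h.list

theorem InstData.setWord {s : Mem} (h : InstData n B rk y i σ s) (a k v : ℕ)
    (ha : a ∉ ({1, 2, 3} : Finset ℕ)) : InstData n B rk y i σ (s.setWord a k v) := by
  simp only [Finset.mem_insert, Finset.mem_singleton, not_or] at ha
  obtain ⟨h1, h2, h3⟩ := ha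
  constructor
  · exact h.v0
  · exact h.v7
  · exact h.v10
  · exact h.v20
  · exact h.v30
  · simpa [Ne.symm h1] using h.tape
  · simpa [Ne.symm h2] using h.rank
  · simpa [Ne.symm h3] using h.list

/-- Applies operation `o` with variable `28` to the counters (array `7`) of all points that cover
element `24`. -/
def bump (o : BinOp) : Program :=
  .assign 25 (.get 2 (.var 24 * .var 0 + .var 20)) ;;
  .forLoop 26 25 (.assign 27 (.get 3 (.var 24 * .var 0 + .var 26)) ;;
    .store 7 (.var 27) (.bin o (.get 7 (.var 27)) (.var 28)))

/-- The points covering `j` are the first `rk j i` entries of the sorted row of `j`, so the cost is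
proportional to their number and not to `n`. -/
theorem bump_spec (o : BinOp) (hS : RoundSize n B i σ W) (hR : Ranking n rk) {s : Mem} {j v : ℕ}
    (h : InstData n B rk y i σ s) (hj : j < n) (h24 : s.vars 24 = j) (h28 : s.vars 28 = v) :
    wp W d (bump o) (fun s' c => c ≤ rk j i * 6 + 5 ∧ ∀ k < n, s'.words 7 k =
      if rk j k < rk j i then o.apply W (s.words 7 k) v else s.words 7 k) s := by
  have hi := hS.i_lt
  have := hS.word_sq
  have hji := idx_lt hj hi
  have hjn := idx_le hj (Nat.zero_le _)
  have hnn : n ≤ n * n := Nat.le_mul_of_pos_left _ (by omega)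
  have hri := hR.lt j hj i hi
  have hb1 : j * n % W = j * n := Nat.mod_eq_of_lt (by omega)
  have hb2 : (j * n + i) % W = j * n + i := Nat.mod_eq_of_lt (by omega)
  simp only [bump, wp_seq (p := .assign 25 _), wp_assign, ev_get, ev_add, ev_mul, ev_var, h24, h.v0,
    h.v20, hb1, hb2, h.rank j hj i hi]
  refine (wp_forLoop_le (N := rk j i) (by simp) (by omega) rfl rfl (by norm_num) 3
    (fun r s' => ∀ k < n, s'.words 7 k =
      if rk j k < r then o.apply W (s.words 7 k) v else s.words 7 k) (by simp) ?_).mono ?_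
  · rintro r hr s' hF h26 hI
    have h' := (h.setVar 25 (rk j i) (by decide)).frame hF rfl
    have e24 := hF.var 24 rfl
    have e28 := hF.var 28 rfl
    simp only [Mem.setVar_vars, Nat.reduceEqDiff, ↓reduceIte, h24, h28] at e24 e28
    obtain ⟨x, hx, hxr⟩ := hR.surj j hj r (by omega)
    have hb3 : (j * n + r) % W = j * n + r := Nat.mod_eq_of_lt (by
      have := idx_lt hj (show r < n by omega); omega)
    have hlist : s'.words 3 (j * n + r) = x := by rw [← hxr]; exact h'.list j hj x hx
    simp only [wp_seq, wp_assign, wp_store, ev_get, ev_add, ev_mul, ev_var, e24, h'.v0, h26, hb1,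
      hb3, hlist, Mem.setVar_vars, Mem.setVar_words, Mem.setWord_words,
      ↓reduceIte, true_and, Nat.reduceAdd, le_refl]
    intro k hk
    by_cases hkx : k = x
    · subst hkx
      rw [if_pos rfl, if_pos (by omega)]
      show o.apply W (ev W _ (.get 7 (.var 27))) (ev W _ (.var 28)) = _
      simp only [ev_get, ev_var, Mem.setVar_vars, Mem.setVar_words, Nat.reduceEqDiff, ↓reduceIte,
        e28, hI k hk]
      rw [if_neg (by omega)]
    · rw [if_neg hkx, hI k hk]
      have : rk j k ≠ r := fun h => hkx (hR.inj j hj k hk x hx (h.trans hxr.symm))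
      congr 1
      apply propext
      omega
  · rintro s' c - ⟨hc, hI⟩
    exact ⟨by omega, hI⟩

/-! ### Listing and sampling the uncovered elements -/

/-- Variable `21` becomes the number of uncovered elements, array `5` their increasing list; arrays
`6` and `7` are cleared. -/
def gather : Program :=
  .assign 21 (.const 0) ;;
  .forLoop 22 0 (.store 7 (.var 22) (.const 0) ;; .store 6 (.var 22) (.const 0) ;;
    .ite (.eq (.get 4 (.var 22)) (.const 0))
      (.store 5 (.var 21) (.var 22) ;; .assign 21 (.var 21 + .const 1)) .skip)

/-- The elements that array `4` marks as uncovered. -/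
def uncovered (n : ℕ) (s : Mem) : Finset ℕ := (Finset.range n).filter fun j => s.words 4 j = 0

/-- The `p`-th smallest element of `C`. -/
noncomputable def nthOf (C : Finset ℕ) (p : ℕ) : ℕ := Nat.nth (· ∈ C) p

theorem count_eq_card {C : Finset ℕ} (hC : C ⊆ Finset.range n) :
    Nat.count (· ∈ C) n = C.card := by
  rw [Nat.count_eq_card_filter_range, Finset.filter_mem_eq_inter, Finset.inter_eq_right.2 hC]

theorem nthOf_mem {C : Finset ℕ} {p : ℕ} (hp : p < C.card) : nthOf C p ∈ C := by
  apply Nat.nth_mem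
  intro hf
  convert hp
  ext x
  simp

theorem nthOf_injOn {C : Finset ℕ} {p q : ℕ} (hp : p < C.card) (hq : q < C.card)
    (h : nthOf C p = nthOf C q) : p = q := by
  have hf : {x | x ∈ C}.Finite := C.finite_toSet
  have hc : hf.toFinset.card = C.card := by
    congr 1
    ext x
    simp
  exact Nat.nth_injOn hf (by simpa [hc] using hp) (by simpa [hc] using hq) h

theorem exists_nthOf_eq {C : Finset ℕ} {x : ℕ} (hx : x ∈ C) : ∃ p < C.card, nthOf C p = x := by
  have h1 : (Finset.range C.card).image (nthOf C) = C := by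
    apply Finset.eq_of_subset_of_card_le
    · intro z hz
      obtain ⟨p, hp, rfl⟩ := Finset.mem_image.1 hz
      exact nthOf_mem (Finset.mem_range.1 hp)
    · rw [Finset.card_image_of_injOn, Finset.card_range]
      intro p hp q hq h
      exact nthOf_injOn (by simpa using hp) (by simpa using hq) h
  rw [← h1] at hx
  simpa using hx

theorem gather_spec (hS : RoundSize n B i σ W) {s : Mem} {C : Finset ℕ}
    (h : InstData n B rk y i σ s) (hC : uncovered n s = C) :
    wp W d gather (fun s' c => c ≤ n * 11 + 5 ∧ s'.vars 21 = C.card ∧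
      (∀ p < C.card, s'.words 5 p = nthOf C p) ∧
      (∀ x < n, s'.words 6 x = 0) ∧ ∀ x < n, s'.words 7 x = 0) s := by
  have hi := hS.i_lt
  have := hS.word_sq
  have hnn : n ≤ n * n := Nat.le_mul_of_pos_left _ (by omega)
  have hW0 : 0 % W = 0 := Nat.zero_mod W
  have hW1 : 1 % W = 1 := Nat.mod_eq_of_lt (by omega)
  have hCn : C ⊆ Finset.range n := hC ▸ Finset.filter_subset _ _
  simp only [gather, wp_seq (p := .assign 21 _), wp_assign, ev_const, hW0]
  -- The fill pointer of the list is `Nat.count` at the current point, which is why the entries are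
  -- the values of `Nat.nth`.
  refine (wp_forLoop_le (N := n) (by simpa using h.v0) (by omega) rfl rfl (by norm_num) 8
    (fun k s' => s'.vars 21 = Nat.count (· ∈ C) k ∧
      (∀ p < Nat.count (· ∈ C) k, s'.words 5 p = nthOf C p) ∧
      (∀ x < k, s'.words 6 x = 0) ∧ ∀ x < k, s'.words 7 x = 0) (by simp) ?_).mono ?_
  · rintro k hk s' hF h22 ⟨g21, g5, g6, g7⟩
    have e4 := hF.word 4 rfl
    simp only [Mem.setVar_words] at e4
    have hcount : Nat.count (· ∈ C) k ≤ k := Nat.count_le _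
    have hb : (Nat.count (· ∈ C) k + 1) % W = Nat.count (· ∈ C) k + 1 :=
      Nat.mod_eq_of_lt (by omega)
    have hmem : s.words 4 k = 0 ↔ k ∈ C := by
      rw [← hC]; simp [uncovered, hk]
    simp only [wp_seq, wp_store, wp_ite, wp_skip, wp_assign, holds_eq, ev_get, ev_var, ev_const,
      ev_add, Mem.setWord_vars, Mem.setWord_words, Mem.setVar_vars, Mem.setVar_words, h22, hW0, hW1,
      e4, g21, hb, Nat.reduceEqDiff, ↓reduceIte, false_and, hmem, Nat.reduceAdd, Nat.reduceLeDiff,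
      true_and, Nat.count_succ]
    have h67 : ∀ a, (∀ x < k, s'.words a x = 0) →
        ∀ x < k + 1, (if x = k then 0 else s'.words a x) = 0 := by
      intro a ha x hx
      split_ifs with hxk
      · rfl
      · exact ha x (by omega)
    constructor
    · intro hkC
      simp only [hkC, ↓reduceIte, true_and]
      refine ⟨?_, h67 6 g6, h67 7 g7⟩
      intro p hp
      split_ifs with hpc
      · rw [hpc, nthOf, Nat.nth_count (p := (· ∈ C)) hkC]
      · exact g5 p (by omega)
    · intro hkC
      simp only [hkC, ↓reduceIte, true_and, add_zero]
      exact ⟨g5, h67 6 g6, h67 7 g7⟩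
  · rintro s' c - ⟨hc, hI⟩
    rw [count_eq_card hCn] at hI
    exact ⟨by omega, hI⟩

/-- The `l`-th sampled element of `C`. -/
noncomputable def sampled (C : Finset ℕ) (y : ℕ → ℕ) (l : ℕ) : ℕ := nthOf C (y l % C.card)

theorem sampled_mem {C : Finset ℕ} (hC : 0 < C.card) (l : ℕ) : sampled C y l ∈ C :=
  nthOf_mem (Nat.mod_lt _ hC)

/-- Number of the first `M` samples from `C₀` that have property `p`. -/
noncomputable def hits (M : ℕ) (C₀ : Finset ℕ) (y : ℕ → ℕ) (p : ℕ → Prop) [DecidablePred p] : ℕ :=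
  ((Finset.range M).filter fun l => p (sampled C₀ y l)).card

theorem hits_succ (M : ℕ) (C₀ : Finset ℕ) (y : ℕ → ℕ) (p : ℕ → Prop) [DecidablePred p] :
    hits (M + 1) C₀ y p = hits M C₀ y p + if p (sampled C₀ y M) then 1 else 0 := by
  unfold hits
  rw [Finset.range_add_one, Finset.filter_insert]
  split_ifs with h
  · rw [Finset.card_insert_of_notMem (by simp)]
  · simp

theorem hits_le (M : ℕ) (C₀ : Finset ℕ) (y : ℕ → ℕ) (p : ℕ → Prop) [DecidablePred p] :
    hits M C₀ y p ≤ M := (Finset.card_filter_le _ _).trans (by simp)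

theorem hits_mono (M : ℕ) (C₀ : Finset ℕ) (y : ℕ → ℕ) {p q : ℕ → Prop} [DecidablePred p]
    [DecidablePred q] (h : ∀ x, p x → q x) : hits M C₀ y p ≤ hits M C₀ y q :=
  Finset.card_le_card fun l hl => by
    simp only [Finset.mem_filter] at hl ⊢
    exact ⟨hl.1, h _ hl.2⟩

theorem hits_congr (M : ℕ) (C₀ : Finset ℕ) (y : ℕ → ℕ) {p q : ℕ → Prop} [DecidablePred p]
    [DecidablePred q] (h : ∀ x, p x ↔ q x) : hits M C₀ y p = hits M C₀ y q :=
  le_antisymm (hits_mono _ _ _ fun x => (h x).1) (hits_mono _ _ _ fun x => (h x).2)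

theorem hits_or (M : ℕ) (C₀ : Finset ℕ) (y : ℕ → ℕ) {p q : ℕ → Prop} [DecidablePred p]
    [DecidablePred q] (h : ∀ x, p x → ¬ q x) :
    hits M C₀ y (fun x => p x ∨ q x) = hits M C₀ y p + hits M C₀ y q := by
  unfold hits
  rw [Finset.filter_or, Finset.card_union_of_disjoint]
  rw [Finset.disjoint_filter]
  exact fun l _ => h _

/-- Draws the samples: array `6` counts how often an element is sampled, array `7` how many samples
a point covers. -/
def drawSamples : Program :=
  .forLoop 23 7 (.assign 24 (.get 5 (.get 1 (.var 23) % .var 21)) ;;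
    .store 6 (.var 24) (.get 6 (.var 24) + .const 1) ;; bump .add)

/-- Elements of `C` have fewer than `R` covering points, so each sample is charged `O(R)` steps.
Elements drawn repeatedly count with multiplicity. -/
theorem drawSamples_spec (hS : RoundSize n B i σ W) (hR : Ranking n rk) {s : Mem} {C : Finset ℕ}
    {R : ℕ} (h : InstData n B rk y i σ s) (hCn : C ⊆ Finset.range n) (hC0 : 0 < C.card)
    (hCR : ∀ j ∈ C, rk j i < R)
    (h21 : s.vars 21 = C.card) (h28 : s.vars 28 = 1) (h5 : ∀ p < C.card, s.words 5 p = nthOf C p)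
    (h6 : ∀ x < n, s.words 6 x = 0) (h7 : ∀ x < n, s.words 7 x = 0) :
    wp W d drawSamples (fun s' c => c ≤ σ * B * (R * 6 + 12) + 3 ∧
      (∀ x < n, s'.words 6 x = hits (σ * B) C y (· = x)) ∧
      ∀ k < n, s'.words 7 k = hits (σ * B) C y (fun j => rk j k < rk j i)) s := by
  have hi := hS.i_lt
  have := hS.word_sq
  have := hS.word
  have : σ * B ≤ σ * (σ * B) := Nat.le_mul_of_pos_left _ hS.σ_pos
  have hnn : n ≤ n * n := Nat.le_mul_of_pos_left _ (by omega)
  have hW1 : 1 % W = 1 := Nat.mod_eq_of_lt (by omega)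
  have hCcard : C.card ≤ n := by simpa using Finset.card_le_card hCn
  refine (wp_forLoop_le (N := σ * B) h.v7 (by omega) rfl rfl (by norm_num) (R * 6 + 9)
    (fun l s' => (∀ x < n, s'.words 6 x = hits l C y (· = x)) ∧
      ∀ k < n, s'.words 7 k = hits l C y (fun j => rk j k < rk j i)) ?_ ?_).mono ?_
  · refine ⟨fun x hx => ?_, fun x hx => ?_⟩
    · simp [h6 x hx, hits]
    · simp [h7 x hx, hits]
  · rintro l hl s' hF h23 ⟨g6, g7⟩
    have h' := h.frame hF rfl
    have e21 := hF.var 21 rfl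
    have e28 := hF.var 28 rfl
    have e5 := hF.word 5 rfl
    have hmod := Nat.mod_lt (y l) hC0
    have hb1 : y l % C.card % W = y l % C.card := Nat.mod_eq_of_lt (by omega)
    have hz := sampled_mem (y := y) hC0 l
    have hzn : sampled C y l < n := by simpa using hCn hz
    have hle := hits_le l C y (· = sampled C y l)
    have hb2 : (hits l C y (· = sampled C y l) + 1) % W = hits l C y (· = sampled C y l) + 1 :=
      Nat.mod_eq_of_lt (by omega)
    have e24 : s'.words 5 (y l % C.card) = sampled C y l := by rw [e5, h5 _ hmod]; rfl
    simp only [wp_seq (p := .assign _ _), wp_seq (p := .store _ _ _), wp_assign, wp_store, ev_get,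
      ev_mod, ev_add, ev_var, ev_const, h23, h'.tape l hl, e21, h21, hb1, e24, Mem.setVar_vars,
      Mem.setVar_words, ↓reduceIte, g6 _ hzn, hW1, hb2]
    refine (bump_spec .add (v := 1) hS hR ((h'.setVar 24 _ (by decide)).setWord 6 _ _ (by decide)) hzn
      (by simp) (by simp [e28, h28])).mono ?_
    rintro s₁ c hF₁ ⟨hc, hk⟩
    have e6 := hF₁.word 6 rfl
    have := hCR _ hz
    refine ⟨by omega, fun x hx => ?_, fun k hkn => ?_⟩
    · simp only [Mem.setVar_words, e6, Mem.setWord_words, true_and, hits_succ]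
      by_cases hxz : x = sampled C y l
      · rw [if_pos hxz, if_pos hxz.symm, ← hxz]
      · rw [if_neg hxz, if_neg (Ne.symm hxz), g6 x hx, add_zero]
    · simp only [Mem.setVar_words, hk k hkn, Mem.setWord_words, Nat.reduceEqDiff, false_and,
        ↓reduceIte, g7 k hkn, hits_succ]
      split_ifs with hcov
      · have := hits_le l C y (fun j => rk j k < rk j i)
        simp only [BinOp.apply]
        exact Nat.mod_eq_of_lt (by omega)
      · rfl
  · rintro s' c - ⟨hc, hI⟩
    exact ⟨hc, hI⟩

/-! ### Removing the elements covered by a picked point -/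

/-- Marks the elements covered by point `22` and takes their samples out of the counters. -/
def markCovered : Program :=
  .forLoop 23 21 (.assign 24 (.get 5 (.var 23)) ;;
    .ite (.eq (.get 4 (.var 24)) (.const 0))
      (.ite (.lt (.get 2 (.var 24 * .var 0 + .var 22)) (.get 2 (.var 24 * .var 0 + .var 20)))
        (.store 4 (.var 24) (.const 1) ;; .assign 28 (.get 6 (.var 24)) ;;
          .ite (.lt (.const 0) (.var 28)) (bump .sub) .skip) .skip) .skip)

/-- Number of samples in `C` that point `k` covers. -/
noncomputable def gain (rk : ℕ → ℕ → ℕ) (i M : ℕ) (C₀ : Finset ℕ) (y : ℕ → ℕ) (C : Finset ℕ)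
    (k : ℕ) : ℕ :=
  hits M C₀ y (fun j => j ∈ C ∧ rk j k < rk j i)

theorem hits_erase {M : ℕ} {C₀ C : Finset ℕ} {j : ℕ} (hj : j ∈ C) :
    hits M C₀ y (· ∈ C) = hits M C₀ y (· ∈ C.erase j) + hits M C₀ y (· = j) := by
  rw [← hits_or]
  · apply hits_congr
    intro x
    by_cases hx : x = j <;> simp [hx, hj]
  · intro x hx h
    simp [h] at hx

theorem gain_erase {M : ℕ} {C₀ C : Finset ℕ} {j : ℕ} (hj : j ∈ C) (k : ℕ) :
    gain rk i M C₀ y (C.erase j) k =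
      if rk j k < rk j i then gain rk i M C₀ y C k - hits M C₀ y (· = j)
      else gain rk i M C₀ y C k := by
  unfold gain
  split_ifs with h
  · have : hits M C₀ y (fun x => x ∈ C ∧ rk x k < rk x i) =
        hits M C₀ y (fun x => x ∈ C.erase j ∧ rk x k < rk x i) + hits M C₀ y (· = j) := by
      rw [← hits_or]
      · apply hits_congr
        intro x
        by_cases hx : x = j
        · subst hx; simp [hj, h]
        · simp [hx]
      · intro x hx h
        simp [h] at hx
    omega
  · apply hits_congr
    intro x
    by_cases hx : x = j
    · subst hx; simp [h]
    · simp [hx]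

/-- An amortized bound: the potential is `R * 6 + 5` times the number of samples still uncovered.
Walking through the list costs `14` steps per entry, and each call of `bump` is paid for by the
samples that leave. Over a whole scan the calls therefore cost at most the initial potential. -/
theorem markCovered_spec (hS : RoundSize n B i σ W) (hR : Ranking n rk) {s : Mem}
    {C₀ C : Finset ℕ} {R k : ℕ} (h : InstData n B rk y i σ s) (hCn : C₀ ⊆ Finset.range n)
    (hCR : ∀ j ∈ C₀, rk j i < R) (h22 : s.vars 22 = k) (hk : k < n)
    (h21 : s.vars 21 = C₀.card) (h5 : ∀ p < C₀.card, s.words 5 p = nthOf C₀ p)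
    (h6 : ∀ x < n, s.words 6 x = hits (σ * B) C₀ y (· = x))
    (hun : uncovered n s = C) (hCC : C ⊆ C₀)
    (h7 : ∀ x < n, s.words 7 x = gain rk i (σ * B) C₀ y C x) :
    wp W d markCovered (fun s' c =>
      uncovered n s' = C.filter (fun j => ¬ rk j k < rk j i) ∧
      c + (R * 6 + 5) * hits (σ * B) C₀ y (· ∈ C.filter (fun j => ¬ rk j k < rk j i)) ≤
        C₀.card * 14 + 3 + (R * 6 + 5) * hits (σ * B) C₀ y (· ∈ C) ∧
      ∀ x < n, s'.words 7 x =
        gain rk i (σ * B) C₀ y (C.filter (fun j => ¬ rk j k < rk j i)) x) s := by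
  have hi := hS.i_lt
  have := hS.word_sq
  have := hS.word
  have : σ * B ≤ σ * (σ * B) := Nat.le_mul_of_pos_left _ hS.σ_pos
  have hnn : n ≤ n * n := Nat.le_mul_of_pos_left _ (by omega)
  have hW0 : 0 % W = 0 := Nat.zero_mod W
  have hW1 : 1 % W = 1 := Nat.mod_eq_of_lt (by omega)
  have hCcard : C₀.card ≤ n := by simpa using Finset.card_le_card hCn
  set M := σ * B with hM
  -- `Cp p` is what remains uncovered after the first `p` entries of the list have been treated.
  let Cp : ℕ → Finset ℕ := fun p =>
    C.filter (fun j => ¬ (rk j k < rk j i ∧ ∃ q < p, nthOf C₀ q = j))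
  have hCp0 : Cp 0 = C := by simp [Cp]
  have hCpe : Cp C₀.card = C.filter (fun j => ¬ rk j k < rk j i) := by
    apply Finset.filter_congr
    intro j hj
    have := exists_nthOf_eq (hCC hj)
    exact ⟨fun h h' => h ⟨h', this⟩, fun h h' => h h'.1⟩
  have hCps : ∀ p, Cp (p + 1) = if nthOf C₀ p ∈ Cp p ∧ rk (nthOf C₀ p) k < rk (nthOf C₀ p) i then
      (Cp p).erase (nthOf C₀ p) else Cp p := by
    intro p
    ext j
    have h1 : (∃ q < p + 1, nthOf C₀ q = j) ↔ (∃ q < p, nthOf C₀ q = j) ∨ nthOf C₀ p = j := by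
      constructor
      · rintro ⟨q, hq, rfl⟩
        rcases Nat.lt_succ_iff_lt_or_eq.1 hq with h | rfl
        · exact .inl ⟨q, h, rfl⟩
        · exact .inr rfl
      · rintro (⟨q, hq, rfl⟩ | rfl)
        · exact ⟨q, by omega, rfl⟩
        · exact ⟨p, by omega, rfl⟩
    split_ifs with hh
    · simp only [Cp, Finset.mem_filter, Finset.mem_erase, h1] at hh ⊢
      constructor
      · rintro ⟨g1, g2⟩
        exact ⟨fun e => g2 ⟨e ▸ hh.2, .inr e.symm⟩, g1, fun g => g2 ⟨g.1, .inl g.2⟩⟩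
      · rintro ⟨g1, g2, g3⟩
        refine ⟨g2, fun g => ?_⟩
        rcases g.2 with g' | g'
        · exact g3 ⟨g.1, g'⟩
        · exact g1 g'.symm
    · simp only [Cp, Finset.mem_filter, h1] at hh ⊢
      constructor
      · rintro ⟨g1, g2⟩
        exact ⟨g1, fun g => g2 ⟨g.1, .inl g.2⟩⟩
      · rintro ⟨g1, g2⟩
        refine ⟨g1, fun g => ?_⟩
        rcases g.2 with g' | g'
        · exact g2 ⟨g.1, g'⟩
        · subst g'
          exact hh ⟨⟨g1, g2⟩, g.1⟩
  have hCpn : ∀ p, Cp p ⊆ Finset.range n := fun p =>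
    (Finset.filter_subset _ _).trans (hCC.trans hCn)
  refine (wp_forLoop (N := C₀.card) h21 (by omega) rfl rfl (by norm_num)
    (fun p s' c => uncovered n s' = Cp p ∧
      c + (R * 6 + 5) * hits M C₀ y (· ∈ Cp p) ≤
        p * 14 + (R * 6 + 5) * hits M C₀ y (· ∈ C) ∧
      ∀ x < n, s'.words 7 x = gain rk i M C₀ y (Cp p) x) ?_ ?_).mono ?_
  · rw [hCp0]
    exact ⟨hun, by omega, h7⟩
  · rintro p hp s' c hF h23 ⟨gun, gc, g7⟩
    have h' := h.frame hF rfl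
    have e21 := hF.var 21 rfl
    have e22 := (hF.var 22 rfl).trans h22
    have e5 : s'.words 5 p = nthOf C₀ p := by rw [hF.word 5 rfl, h5 p hp]
    have e6 := hF.word 6 rfl
    have hz : nthOf C₀ p ∈ C₀ := nthOf_mem hp
    have hpC := hCps p
    generalize nthOf C₀ p = j at e5 hz hpC
    have hjn : j < n := by simpa using hCn hz
    have hb1 : j * n % W = j * n := Nat.mod_eq_of_lt (by
      have := idx_le hjn (Nat.zero_le _); omega)
    have hb2 : (j * n + k) % W = j * n + k := Nat.mod_eq_of_lt (by
      have := idx_lt hjn hk; omega)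
    have hb3 : (j * n + i) % W = j * n + i := Nat.mod_eq_of_lt (by
      have := idx_lt hjn hi; omega)
    have hmem : s'.words 4 j = 0 ↔ j ∈ Cp p := by rw [← gun]; simp [uncovered, hjn]
    simp only [wp_seq (p := .assign _ _), wp_seq (p := .store _ _ _), wp_assign, wp_store, wp_ite,
      wp_skip, holds_eq, holds_lt, ev_get, ev_mul, ev_add, ev_var, ev_const, h23, e5, e22, h'.v0,
      h'.v20, hb1, hb2, hb3, Mem.setVar_vars, Mem.setVar_words, Mem.setWord_vars, Mem.setWord_words,
      Nat.reduceEqDiff, ↓reduceIte, false_and, hW0, hW1, hmem, h'.rank j hjn k hk,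
      h'.rank j hjn i hi, e6, h6 j hjn]
    have hunst : ∀ s₁ : Mem, s₁.words 4 = s'.words 4 → uncovered n s₁ = uncovered n s' := by
      intro s₁ h; simp [uncovered, h]
    refine ⟨fun hjC => ⟨fun hcov => ?_, fun hcov => ?_⟩, fun hjC => ?_⟩
    · rw [if_pos ⟨hjC, hcov⟩] at hpC
      have hund : ∀ s₁ : Mem, (∀ x, s₁.words 4 x = if x = j then 1 else s'.words 4 x) →
          uncovered n s₁ = (Cp p).erase j := by
        intro s₁ h
        rw [← gun]
        ext x
        simp only [uncovered, Finset.mem_filter, h, Finset.mem_erase]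
        by_cases hx : x = j <;> simp [hx]
      rw [hpC]
      have hhe := hits_erase (y := y) (M := M) (C₀ := C₀) hjC
      have hge := gain_erase (rk := rk) (i := i) (y := y) (M := M) (C₀ := C₀) hjC
      constructor
      · intro hpos
        refine (bump_spec .sub (v := hits M C₀ y (· = j)) hS hR (((h'.setVar 24 _ (by decide)).setWord 4 _ _
          (by decide)).setVar 28 _ (by decide)) hjn (by simp) (by simp)).mono ?_
        rintro s₁ c₁ hF₁ ⟨hc₁, hk₁⟩
        refine ⟨hund _ fun x => ?_, ?_, fun x hx => ?_⟩
        · simp [hF₁.word 4 rfl]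
        · have hRj := hCR j hz
          have : (R * 6 + 5) * hits M C₀ y (· ∈ (Cp p).erase j) + (R * 6 + 5) ≤
              (R * 6 + 5) * hits M C₀ y (· ∈ Cp p) := by
            rw [hhe, mul_add]
            have := Nat.mul_le_mul_left (R * 6 + 5) hpos
            omega
          omega
        · simp only [Mem.setVar_words, hk₁ x hx, Mem.setWord_words, Nat.reduceEqDiff, false_and,
            ↓reduceIte, g7 x hx, hge x, BinOp.apply]
          split_ifs with hx'
          · have := hits_le M C₀ y (fun l => l ∈ Cp p ∧ rk l x < rk l i)
            exact Nat.mod_eq_of_lt (by unfold gain; omega)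
          · rfl
      -- An element that was never sampled contributes to no counter, so nothing has to be
      -- subtracted. Without this shortcut the potential could not pay for the call.
      · intro hpos
        refine ⟨hund _ fun x => by simp, ?_, fun x hx => ?_⟩
        · rw [hhe] at gc
          rw [show hits M C₀ y (· = j) = 0 by omega] at gc
          simp only [add_zero] at gc
          omega
        · simp only [
            g7 x hx, hge x]
          split_ifs with hx'
          · omega
          · rfl
    · rw [if_neg (by tauto)] at hpC
      rw [hpC]
      exact ⟨(hunst _ rfl).trans gun, by omega, fun x hx => by simpa using g7 x hx⟩
    · rw [if_neg (by tauto)] at hpC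
      rw [hpC]
      exact ⟨(hunst _ rfl).trans gun, by omega, fun x hx => by simpa using g7 x hx⟩
  · rintro s' c - ⟨c₀, hc, ⟨gun, gc, g7⟩, -⟩
    rw [hCpe] at gun gc g7
    exact ⟨gun, by omega, g7⟩

end

/-! ### Threshold greedy on the samples -/

section
variable {n B W i σ : ℕ} {rk : ℕ → ℕ → ℕ} {y : ℕ → ℕ} {d : Fin n → Fin n → ℝ}

/-- Picks every point that covers more than a `1 / (2 * σ)` fraction of the samples at the time it
is considered. -/
def scan : Program :=
  .forLoop 22 0 (.ite (.lt (.var 7) (.var 30 * .get 7 (.var 22)))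
    (.store 0 (.var 10 + .var 22) (.const 1) ;; markCovered) .skip)

theorem hits_filter_add_gain {M : ℕ} {C₀ C : Finset ℕ} (k : ℕ) :
    hits M C₀ y (· ∈ C.filter (fun j => ¬ rk j k < rk j i)) + gain rk i M C₀ y C k =
      hits M C₀ y (· ∈ C) := by
  rw [gain, ← hits_or]
  · apply hits_congr
    intro x
    simp only [Finset.mem_filter]
    tauto
  · intro x hx h
    simp only [Finset.mem_filter] at hx
    exact hx.2 h.2

theorem gain_mono {M : ℕ} {C₀ C C' : Finset ℕ} (h : C ⊆ C') (k : ℕ) :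
    gain rk i M C₀ y C k ≤ gain rk i M C₀ y C' k :=
  hits_mono _ _ _ fun _ hx => ⟨h hx.1, hx.2⟩

/-- The elements of `C` that no point of `P` covers. -/
def residue (rk : ℕ → ℕ → ℕ) (i : ℕ) (C P : Finset ℕ) : Finset ℕ :=
  C.filter fun j => ∀ k ∈ P, ¬ rk j k < rk j i

theorem residue_subset {C P : Finset ℕ} : residue rk i C P ⊆ C := Finset.filter_subset _ _

theorem residue_insert {C P : Finset ℕ} {k : ℕ} : residue rk i C (insert k P) =
    (residue rk i C P).filter (fun j => ¬ rk j k < rk j i) := by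
  ext j
  simp only [residue, Finset.mem_filter, Finset.mem_insert, forall_eq_or_imp]
  tauto

theorem residue_union {C P Q : Finset ℕ} : residue rk i C (P ∪ Q) =
    residue rk i (residue rk i C P) Q := by
  ext j
  simp only [residue, Finset.mem_filter, Finset.mem_union, or_imp, forall_and]
  tauto

/-- A single pass suffices: gains only decrease as elements get covered, so a point below the
threshold when it is considered stays below it. -/
theorem scan_spec (hS : RoundSize n B i σ W) (hR : Ranking n rk) {s : Mem}
    {C₀ : Finset ℕ} {R : ℕ} (h : InstData n B rk y i σ s) (hCn : C₀ ⊆ Finset.range n)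
    (hCR : ∀ j ∈ C₀, rk j i < R)
    (h21 : s.vars 21 = C₀.card) (h5 : ∀ p < C₀.card, s.words 5 p = nthOf C₀ p)
    (h6 : ∀ x < n, s.words 6 x = hits (σ * B) C₀ y (· = x)) (hun : uncovered n s = C₀)
    (h7 : ∀ x < n, s.words 7 x = gain rk i (σ * B) C₀ y C₀ x) :
    wp W d scan (fun s' c => ∃ P ⊆ Finset.range n, P.card ≤ 2 * σ ∧
      uncovered n s' = residue rk i C₀ P ∧
      (∀ q, s'.words 0 q ≠ 0 ↔ s.words 0 q ≠ 0 ∨ ∃ k ∈ P, q = i * n + k) ∧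
      c ≤ n * 5 + 3 + 2 * σ * (C₀.card * 14 + 6) + (R * 6 + 5) * (σ * B) ∧
      ∀ k < n, 2 * σ * gain rk i (σ * B) C₀ y (residue rk i C₀ P) k ≤ σ * B) s := by
  have hi := hS.i_lt
  have := hS.word_sq
  have hWs := hS.word
  have hMσ : σ * B ≤ σ * (σ * B) := Nat.le_mul_of_pos_left _ hS.σ_pos
  have hM0 : 0 < σ * B := Nat.mul_pos hS.σ_pos hS.B_pos
  have hnn : n ≤ n * n := Nat.le_mul_of_pos_left _ (by omega)
  have hW1 : 1 % W = 1 := Nat.mod_eq_of_lt (by omega)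
  set M := σ * B with hM
  -- The inequality with `M * P.card` says that every picked point has removed at least an `M / (2 *
  -- σ)` share of the `M` samples. It yields `P.card ≤ 2 * σ` at the end.
  refine (wp_forLoop (N := n) h.v0 (by omega) rfl rfl (by norm_num)
    (fun k s' c => ∃ P ⊆ Finset.range k, M * P.card +
        2 * σ * hits M C₀ y (· ∈ residue rk i C₀ P) ≤ 2 * σ * M ∧
      uncovered n s' = residue rk i C₀ P ∧
      (∀ q, s'.words 0 q ≠ 0 ↔ s.words 0 q ≠ 0 ∨ ∃ k ∈ P, q = i * n + k) ∧
      c + (R * 6 + 5) * hits M C₀ y (· ∈ residue rk i C₀ P) ≤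
        k * 5 + P.card * (C₀.card * 14 + 6) + (R * 6 + 5) * M ∧
      (∀ x < n, s'.words 7 x = gain rk i M C₀ y (residue rk i C₀ P) x) ∧
      ∀ x < k, 2 * σ * gain rk i M C₀ y (residue rk i C₀ P) x ≤ M) ?_ ?_).mono ?_
  · have hle := hits_le M C₀ y (· ∈ C₀)
    have hres : residue rk i C₀ ∅ = C₀ := by simp [residue]
    refine ⟨∅, by simp, ?_, ?_, by simp, ?_, ?_, fun x hx => absurd hx (by omega)⟩
    · rw [hres]
      have := Nat.mul_le_mul_left (2 * σ) hle
      simpa using this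
    · rw [hres]; exact hun
    · rw [hres]
      have := Nat.mul_le_mul_left (R * 6 + 5) hle
      simpa using this
    · rw [hres]; exact h7
  · rintro k hk s' c hF h22 ⟨P, hP, gM, gun, g0, gc, g7, gk⟩
    have h' := h.frame hF rfl
    have hge := hits_le M C₀ y (fun j => j ∈ residue rk i C₀ P ∧ rk j k < rk j i)
    have hg : gain rk i M C₀ y (residue rk i C₀ P) k ≤ M := hge
    have hmul := Nat.mul_le_mul_left (σ + σ) hg
    rw [add_mul σ σ M] at hmul
    have hb : (σ + σ) * gain rk i M C₀ y (residue rk i C₀ P) k % W =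
      (σ + σ) * gain rk i M C₀ y (residue rk i C₀ P) k := Nat.mod_eq_of_lt (by omega)
    have hb1 : (i * n + k) % W = i * n + k :=
      Nat.mod_eq_of_lt (by have := idx_lt hi hk; omega)
    have hfg := hits_filter_add_gain (rk := rk) (i := i) (y := y) (M := M) (C₀ := C₀)
      (C := residue rk i C₀ P) k
    have hkP : k ∉ P := fun hkP => by simpa using hP hkP
    simp only [wp_ite, wp_seq, wp_store, wp_skip, holds_lt, ev_var, ev_mul, ev_get, ev_add,
      ev_const, h'.v7, h'.v30, h'.v10, h22, g7 k hk, hb, hb1, hW1]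
    constructor
    · intro hlt
      have e21 := hF.var 21 rfl
      have e5 := hF.word 5 rfl
      have e6 := hF.word 6 rfl
      refine (markCovered_spec (C₀ := C₀) (C := residue rk i C₀ P) (k := k) (R := R) hS hR
        (h'.setWord 0 _ _ (by decide)) hCn hCR h22 hk (e21.trans h21) ?_ ?_ ?_ residue_subset
        ?_).mono ?_
      · simpa [e5] using h5
      · simpa [e6] using h6
      · rw [← gun]
        simp [uncovered]
      · simpa using g7
      · rintro s₁ c₁ hF₁ ⟨k1, k2, k3⟩
        rw [← residue_insert] at k1 k2 k3 hfg
        rw [← hM] at k2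
        have hcard : (insert k P).card = P.card + 1 := Finset.card_insert_of_notMem hkP
        refine ⟨insert k P, ?_, ?_, ?_, ?_, ?_, ?_, ?_⟩
        · intro x hx
          rcases Finset.mem_insert.1 hx with rfl | hx
          · simp
          · have := Finset.mem_range.1 (hP hx)
            exact Finset.mem_range.2 (by omega)
        · rw [hcard]
          have : 2 * σ * hits M C₀ y (· ∈ residue rk i C₀ P) =
            2 * σ * hits M C₀ y (· ∈ residue rk i C₀ (insert k P)) +
              (σ + σ) * gain rk i M C₀ y (residue rk i C₀ P) k := by rw [← hfg]; ring
          rw [mul_add M]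
          omega
        · rw [← k1]; rfl
        · intro q
          simp only [Mem.setVar_words, hF₁.word 0 rfl, Mem.setWord_words, true_and,
            Finset.mem_insert, exists_eq_or_imp]
          have := g0 q
          by_cases hq : q = i * n + k
          · simp [hq]
          · simp [hq]; simpa using this
        · rw [hcard]
          rw [add_mul P.card 1]
          omega
        · exact k3
        -- Earlier points keep the bound by monotonicity, and the point just picked covers nothing
        -- that remains.
        · intro x hx
          rcases Nat.lt_succ_iff_lt_or_eq.1 hx with hx | rfl
          · exact (Nat.mul_le_mul_left _ (gain_mono
              (by rw [residue_insert]; exact Finset.filter_subset _ _) x)).trans (gk x hx)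
          · have : gain rk i M C₀ y (residue rk i C₀ (insert x P)) x = 0 := by
              rw [residue_insert, gain, hits, Finset.card_eq_zero, Finset.filter_eq_empty_iff]
              intro l _ hl
              simp only [Finset.mem_filter] at hl
              exact hl.1.2 hl.2
            rw [this]
            omega
    · intro hlt
      refine ⟨P, hP.trans (Finset.range_mono (Nat.le_succ k)), gM, gun, g0, by omega, g7, ?_⟩
      intro x hx
      rcases Nat.lt_succ_iff_lt_or_eq.1 hx with hx | rfl
      · exact gk x hx
      · have : 2 * σ = σ + σ := by ring
        rw [this]
        omega
  · rintro s' c - ⟨c₀, rfl, ⟨P, hP, gM, gun, g0, gc, g7, gk⟩, -⟩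
    have hPc : P.card ≤ 2 * σ := by
      apply Nat.le_of_mul_le_mul_left _ hM0
      rw [mul_comm M (2 * σ)]
      omega
    refine ⟨P, hP, hPc, gun, g0, ?_, gk⟩
    have := Nat.mul_le_mul_right (C₀.card * 14 + 6) hPc
    omega

/-- A round: samples the uncovered elements and covers at least half of the samples if the guess
is right. -/
def round : Program :=
  gather ;; .ite (.lt (.const 0) (.var 21)) (.assign 28 (.const 1) ;; drawSamples ;; scan) .skip

/-- After the scan no point covers more than `M / (2 * σ)` of the remaining samples, where `M = σ *
B`. Hence `σ` points that cover everything see at most `M / 2` of them, and that is all of them. -/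
theorem round_spec (hS : RoundSize n B i σ W) (hR : Ranking n rk) {s : Mem}
    {C₀ : Finset ℕ} {R U : ℕ} (h : InstData n B rk y i σ s)
    (hCR : ∀ j ∈ C₀, rk j i < R) (hun : uncovered n s = C₀) (hU : C₀.card ≤ U) :
    wp W d round (fun s' c => ∃ P ⊆ Finset.range n, P.card ≤ 2 * σ ∧
      uncovered n s' = residue rk i C₀ P ∧
      (∀ q, s'.words 0 q ≠ 0 ↔ s.words 0 q ≠ 0 ∨ ∃ k ∈ P, q = i * n + k) ∧
      c ≤ n * 16 + 20 + 2 * σ * (U * 14 + 6) + (R * 12 + 17) * (σ * B) ∧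
      (0 < C₀.card → ∀ A ⊆ Finset.range n, A.card ≤ σ → (∀ j ∈ C₀, ∃ k ∈ A, rk j k < rk j i) →
        2 * hits (σ * B) C₀ y (· ∈ residue rk i C₀ P) ≤ σ * B)) s := by
  have hi := hS.i_lt
  have := hS.word_sq
  have hnn : n ≤ n * n := Nat.le_mul_of_pos_left _ (by omega)
  have hW0 : 0 % W = 0 := Nat.zero_mod W
  have hW1 : 1 % W = 1 := Nat.mod_eq_of_lt (by omega)
  have hCn : C₀ ⊆ Finset.range n := hun ▸ Finset.filter_subset _ _
  rw [round, wp_seq]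
  refine (gather_spec hS h hun).mono ?_
  rintro s₁ c₁ hF₁ ⟨hc₁, g21, g5, g6, g7⟩
  have h₁ := h.frame hF₁ rfl
  simp only [wp_ite, wp_skip, holds_lt, ev_const, ev_var, g21, hW0, hW1,
    wp_seq (p := .assign _ _), wp_assign]
  constructor
  · intro hpos
    rw [wp_seq]
    refine (drawSamples_spec hS hR (h₁.setVar 28 1 (by decide)) hCn hpos hCR (by simp [g21])
      (by simp) g5 g6 g7).mono ?_
    rintro s₂ c₂ hF₂ ⟨hc₂, k6, k7⟩
    have h₂ := (h₁.setVar 28 1 (by decide)).frame hF₂ rfl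
    refine (scan_spec (R := R) hS hR h₂ hCn hCR ?_ ?_ k6 ?_ ?_).mono ?_
    · rw [hF₂.var 21 rfl]; simp [g21]
    · rw [hF₂.word 5 rfl]; exact g5
    · rw [← hun]
      simp [uncovered, hF₂.word 4 rfl, hF₁.word 4 rfl]
    · intro x hx
      rw [k7 x hx]
      unfold gain
      unfold hits
      congr 1
      apply Finset.filter_congr
      intro l _
      simp [sampled_mem hpos l]
    · rintro s₃ c₃ hF₃ ⟨P, hP, hPc, m1, m2, m3, m4⟩
      refine ⟨P, hP, hPc, m1, ?_, ?_, ?_⟩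
      · intro q
        rw [m2 q, hF₂.word 0 rfl, Mem.setVar_words, hF₁.word 0 rfl]
      · have e1 : σ * B * (R * 6 + 12) + (R * 6 + 5) * (σ * B) = (R * 12 + 17) * (σ * B) := by ring
        have e2 : 2 * σ * (C₀.card * 14 + 6) ≤ 2 * σ * (U * 14 + 6) :=
          Nat.mul_le_mul_left _ (by omega)
        omega
      · intro _ A hA hAσ hcov
        -- Every remaining sample is covered by a member of `A`, so it is counted in at least one
        -- gain.
        have h1 : hits (σ * B) C₀ y (· ∈ residue rk i C₀ P) ≤
            ∑ k ∈ A, gain rk i (σ * B) C₀ y (residue rk i C₀ P) k := by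
          unfold gain hits
          refine (Finset.card_le_card ?_).trans Finset.card_biUnion_le
          intro l hl
          simp only [Finset.mem_filter, Finset.mem_biUnion] at hl ⊢
          obtain ⟨k, hk, hlt⟩ := hcov _ (residue_subset hl.2)
          exact ⟨k, hk, hl.1, hl.2, hlt⟩
        have h2 : 2 * σ * ∑ k ∈ A, gain rk i (σ * B) C₀ y (residue rk i C₀ P) k ≤
            σ * (σ * B) := by
          rw [Finset.mul_sum]
          refine (Finset.sum_le_card_nsmul A _ (σ * B) fun k hk =>
            m4 k (by simpa using hA hk)).trans ?_
          rw [smul_eq_mul]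
          exact Nat.mul_le_mul_right _ hAσ
        have h3 := Nat.mul_le_mul_left (2 * σ) h1
        apply Nat.le_of_mul_le_mul_left _ hS.σ_pos
        calc σ * (2 * hits (σ * B) C₀ y (· ∈ residue rk i C₀ P)) =
          2 * σ * hits (σ * B) C₀ y (· ∈ residue rk i C₀ P) := by ring
          _ ≤ σ * (σ * B) := h3.trans h2
  · intro hpos
    have hC : C₀ = ∅ := Finset.card_eq_zero.1 (by omega)
    subst hC
    refine ⟨∅, by simp, by simp, ?_, ?_, by omega, fun h => absurd h (by simp)⟩
    · simp only [uncovered, hF₁.word 4 rfl]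
      rw [← uncovered, hun]
      simp [residue]
    · intro q
      simp [hF₁.word 0 rfl]

/-! ### One instance -/

/-- The elements of instance `i` that fewer than `R` points cover. -/
def rareElements (n : ℕ) (rk : ℕ → ℕ → ℕ) (i R : ℕ) : Finset ℕ :=
  (Finset.range n).filter fun j => 0 < rk j i ∧ rk j i < R

/-- Tries to solve instance `20` with guess `σ`; entry `20` of array `8` tells whether this
succeeded. Variable `3` holds the number of rounds, `8` the bound `R`, and `31` the number of
points that are taken from the tape. -/
def solveInstance : Program :=
  .forLoop 22 0 (.store 0 (.var 10 + .var 22) (.const 0) ;;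
    .assign 24 (.get 2 (.var 22 * .var 0 + .var 20)) ;; .store 4 (.var 22) (.const 1) ;;
    .ite (.lt (.const 0) (.var 24)) (.ite (.lt (.var 24) (.var 8))
      (.store 4 (.var 22) (.const 0)) .skip) .skip) ;;
  .forLoop 23 31 (.store 0 (.var 10 + .get 1 (.var 23)) (.const 1)) ;;
  .forLoop 29 3 round ;;
  .assign 27 (.const 1) ;;
  .forLoop 22 0 (.ite (.eq (.get 4 (.var 22)) (.const 0)) (.assign 27 (.const 0)) .skip) ;;
  .store 8 (.var 20) (.var 27)

/-- The points `A` cover all elements of instance `i`. -/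
def Covers (n : ℕ) (rk : ℕ → ℕ → ℕ) (i : ℕ) (A : Finset ℕ) : Prop :=
  ∀ j < n, j ≠ i → ∃ k ∈ A, rk j k < rk j i

/-- Samples from what a small set `D` leaves uncovered are representative: if a larger small set
`D'` covers half of them, it covers a constant fraction of these elements. -/
def Representative (n B : ℕ) (rk : ℕ → ℕ → ℕ) (y : ℕ → ℕ) (i σ R q : ℕ) : Prop :=
  ∀ D D' : Finset ℕ, D ⊆ Finset.range n → D' ⊆ Finset.range n → D ⊆ D' →
    D.card ≤ q → D'.card ≤ q →
    0 < (residue rk i (rareElements n rk i R) D).card →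
    2 * hits (σ * B) (residue rk i (rareElements n rk i R) D) y
      (· ∈ residue rk i (rareElements n rk i R) D') ≤ σ * B →
    16 * (residue rk i (rareElements n rk i R) D').card ≤
      15 * (residue rk i (rareElements n rk i R) D).card

theorem idx_inj {i i' k k' : ℕ} (hk : k < n) (hk' : k' < n) (h : i * n + k = i' * n + k') :
    i = i' ∧ k = k' := by
  have h1 : (i * n + k) / n = i := by
    rw [add_comm, Nat.add_mul_div_right _ _ (by omega), Nat.div_eq_of_lt hk, zero_add]
  have h2 : (i' * n + k') / n = i' := by
    rw [add_comm, Nat.add_mul_div_right _ _ (by omega), Nat.div_eq_of_lt hk', zero_add]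
  rw [h, h2] at h1
  subst h1
  exact ⟨rfl, Nat.add_left_cancel h⟩

/-- The points picked in all rounds accumulate in `D`. Representativeness applies to `D` and `D ∪
P`, however these sets depend on the tape, so the same samples can be reused in every round. The
time bound and the reported outcome hold for every tape; only the claim of success needs a good one
and a correct guess. -/
theorem solveInstance_spec (hS : RoundSize n B i σ W) (hR : Ranking n rk) {s : Mem} {K E R : ℕ}
    (h : InstData n B rk y i σ s) (h3 : s.vars 3 = K) (h8 : s.vars 8 = R)
    (h31 : s.vars 31 = σ * E) (hEB : E ≤ B) (hKW : K < W) (hy : ∀ l < σ * B, y l < n) :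
    wp W d solveInstance (fun s' c =>
      c ≤ n * 30 + σ * E * 4 + 30 + K * (n * 16 + 23 +
        2 * σ * ((rareElements n rk i R).card * 14 + 6) + (R * 12 + 17) * (σ * B)) ∧
      ∃ D ⊆ Finset.range n, D.card ≤ K * (2 * σ) ∧
        (∀ k < n, s'.words 0 (i * n + k) ≠ 0 ↔ (∃ l < σ * E, y l = k) ∨ k ∈ D) ∧
        (∀ i' < n, i' ≠ i → ∀ k < n,
          s'.words 0 (i' * n + k) ≠ 0 ↔ s.words 0 (i' * n + k) ≠ 0) ∧
        (∀ x, s'.words 8 x = if x = i then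
          (if residue rk i (rareElements n rk i R) D = ∅ then 1 else 0) else s.words 8 x) ∧
        (Representative n B rk y i σ R (K * (2 * σ)) → 15 ^ K * n < 16 ^ K →
          (∃ A ⊆ Finset.range n, A.card ≤ σ ∧ Covers n rk i A) →
          residue rk i (rareElements n rk i R) D = ∅)) s := by
  have hi := hS.i_lt
  have := hS.word_sq
  have hWs := hS.word
  have hMσ : σ * B ≤ σ * (σ * B) := Nat.le_mul_of_pos_left _ hS.σ_pos
  have hEM : σ * E ≤ σ * B := Nat.mul_le_mul_left _ hEB
  have hnn : n ≤ n * n := Nat.le_mul_of_pos_left _ (by omega)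
  have hW0 : 0 % W = 0 := Nat.zero_mod W
  have hW1 : 1 % W = 1 := Nat.mod_eq_of_lt (by omega)
  set C := rareElements n rk i R with hC
  rw [solveInstance, wp_seq]
  refine (wp_forLoop_le (N := n) (by simpa using h.v0) (by omega) rfl rfl (by norm_num) 9
    (fun k s' => (∀ x < k, s'.words 0 (i * n + x) = 0) ∧
      (∀ i' < n, i' ≠ i → ∀ x < n, s'.words 0 (i' * n + x) = s.words 0 (i' * n + x)) ∧
      ∀ x < k, s'.words 4 x = 0 ↔ x ∈ C) ?_ ?_).mono ?_
  · exact ⟨fun _ h => absurd h (by omega), fun _ _ _ _ _ => rfl, fun _ h => absurd h (by omega)⟩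
  · rintro k hk s' hF h22 ⟨g0, g0', g4⟩
    have h' := h.frame hF rfl
    have e8 := (hF.var 8 rfl).trans h8
    have hb1 : (i * n + k) % W = i * n + k :=
      Nat.mod_eq_of_lt (by have := idx_lt hi hk; omega)
    have hb2 : (k * n + i) % W = k * n + i :=
      Nat.mod_eq_of_lt (by have := idx_lt hk hi; omega)
    have hb3 : k * n % W = k * n :=
      Nat.mod_eq_of_lt (by have := idx_lt hk hi; omega)
    have hkC : k ∈ C ↔ 0 < rk k i ∧ rk k i < R := by simp [hC, rareElements, hk]
    have q0 : ∀ x < k + 1, (if x = k then 0 else s'.words 0 (i * n + x)) = 0 := by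
      intro x hx
      split_ifs with hxk
      · rfl
      · exact g0 x (by omega)
    have q0' : ∀ i' < n, i' ≠ i → ∀ x < n,
        (if i' * n + x = i * n + k then 0 else s'.words 0 (i' * n + x)) =
          s.words 0 (i' * n + x) := by
      intro i' hi' hne x hx
      rw [if_neg fun h => hne (idx_inj hx hk h).1]
      exact g0' i' hi' hne x hx
    simp only [wp_seq, wp_store, wp_assign, wp_ite, wp_skip, holds_lt, ev_add, ev_mul, ev_get,
      ev_var, ev_const, h'.v0, h'.v10, h'.v20, h22, e8, hb1, hb2, hb3, hW0, hW1, Mem.setWord_vars,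
      Mem.setVar_vars, Mem.setWord_words, Mem.setVar_words, Nat.reduceEqDiff, false_and, true_and,
      ↓reduceIte, h'.rank k hk i hi, add_right_inj, Nat.reduceAdd, Nat.reduceLeDiff,
      OfNat.ofNat_ne_zero, OfNat.zero_ne_ofNat]
    refine ⟨fun hpos => ⟨fun hlt => ⟨q0, q0', ?_⟩, fun hlt => ⟨q0, q0', ?_⟩⟩,
      fun hpos => ⟨q0, q0', ?_⟩⟩
    · intro x hx
      by_cases hxk : x = k
      · subst hxk; simp [hkC, hpos, hlt]
      · simp only [hxk, ↓reduceIte]; exact g4 x (by omega)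
    · intro x hx
      by_cases hxk : x = k
      · subst hxk; simp [hkC]; omega
      · simp only [hxk, ↓reduceIte]; exact g4 x (by omega)
    · intro x hx
      by_cases hxk : x = k
      · subst hxk; simp [hkC]; omega
      · simp only [hxk, ↓reduceIte]; exact g4 x (by omega)
  rintro s₁ c₁ hF₁ ⟨hc₁, a0, a0', a4⟩
  have h₁ := h.frame hF₁ rfl
  have hun₁ : uncovered n s₁ = C := by
    ext x
    simp only [uncovered, Finset.mem_filter, Finset.mem_range]
    constructor
    · rintro ⟨hx, h4⟩; exact (a4 x hx).1 h4
    · intro hx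
      have hxn : x < n := by simpa using (Finset.filter_subset _ _ hx)
      exact ⟨hxn, (a4 x hxn).2 hx⟩
  rw [wp_seq]
  refine (wp_forLoop_le (N := σ * E) ((hF₁.var 31 rfl).trans h31) (by omega) rfl rfl
    (by norm_num) 1
    (fun l s' => (∀ k < n, s'.words 0 (i * n + k) ≠ 0 ↔ ∃ l' < l, y l' = k) ∧
      (∀ i' < n, i' ≠ i → ∀ x < n, s'.words 0 (i' * n + x) = s.words 0 (i' * n + x))) ?_ ?_).mono ?_
  · exact ⟨fun k hk => by simp [a0 k hk], a0'⟩
  · rintro l hl s' hF h23 ⟨g0, g0'⟩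
    have h' := h₁.frame hF rfl
    have hyl := hy l (by omega)
    have hb1 : (i * n + y l) % W = i * n + y l :=
      Nat.mod_eq_of_lt (by have := idx_lt hi hyl; omega)
    simp only [wp_store, ev_add, ev_get, ev_var, ev_const, h'.v10, h23, h'.tape l (by omega), hb1,
      hW1, Mem.setVar_words, Mem.setWord_words, true_and, le_refl, add_right_inj]
    refine ⟨fun k hk => ?_, fun i' hi' hne x hx => ?_⟩
    · by_cases hky : k = y l
      · simp only [hky, ↓reduceIte, ne_eq, one_ne_zero, not_false_eq_true, true_iff]
        exact ⟨l, by omega, rfl⟩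
      · simp only [hky, ↓reduceIte]
        rw [g0 k hk]
        constructor
        · rintro ⟨l', hl', rfl⟩; exact ⟨l', by omega, rfl⟩
        · rintro ⟨l', hl', rfl⟩
          rcases Nat.lt_succ_iff_lt_or_eq.1 hl' with h | rfl
          · exact ⟨l', h, rfl⟩
          · exact absurd rfl hky
    · rw [if_neg fun h => hne (idx_inj hx hyl h).1]
      exact g0' i' hi' hne x hx
  rintro s₂ c₂ hF₂ ⟨hc₂, b0, b0'⟩
  have h₂ := h₁.frame hF₂ rfl
  have hun₂ : uncovered n s₂ = C := by
    rw [← hun₁]; simp [uncovered, hF₂.word 4 rfl]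
  rw [wp_seq]
  -- The last clause is the geometric decrease: the uncovered elements number at most `(15/16) ^ r *
  -- n` after `r` rounds.
  refine (wp_forLoop_le (N := K) (((hF₂.var 3 rfl).trans (hF₁.var 3 rfl)).trans h3) hKW rfl rfl
    (by norm_num) (n * 16 + 20 + 2 * σ * (C.card * 14 + 6) + (R * 12 + 17) * (σ * B))
    (fun r s' => ∃ D ⊆ Finset.range n, D.card ≤ r * (2 * σ) ∧ uncovered n s' = residue rk i C D ∧
      (∀ k < n, s'.words 0 (i * n + k) ≠ 0 ↔ (∃ l < σ * E, y l = k) ∨ k ∈ D) ∧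
      (∀ i' < n, i' ≠ i → ∀ x < n,
        s'.words 0 (i' * n + x) ≠ 0 ↔ s.words 0 (i' * n + x) ≠ 0) ∧
      (Representative n B rk y i σ R (K * (2 * σ)) →
        (∃ A ⊆ Finset.range n, A.card ≤ σ ∧ Covers n rk i A) →
        16 ^ r * (residue rk i C D).card ≤ 15 ^ r * n)) ?_ ?_).mono ?_
  · refine ⟨∅, by simp, by simp, ?_, ?_,
      fun i' hi' hne x hx => by rw [Mem.setVar_words, b0' i' hi' hne x hx], ?_⟩
    · rw [← hun₂]; simp [uncovered, residue]; rfl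
    · intro k hk
      rw [Mem.setVar_words, b0 k hk]
      simp
    · intro _ _
      have : (residue rk i C ∅).card ≤ (Finset.range n).card :=
        Finset.card_le_card (residue_subset.trans (Finset.filter_subset _ _))
      simpa using this
  · rintro r hr s' hF h29 ⟨D, hD, hDc, gun, g0, g0', gs⟩
    have h' := h₂.frame hF rfl
    have hsub : residue rk i C D ⊆ C := residue_subset
    refine (round_spec (R := R) (U := C.card) hS hR h' ?_ gun (Finset.card_le_card hsub)).mono ?_
    · intro j hj
      have := hsub hj
      simp only [hC, rareElements, Finset.mem_filter] at this
      exact this.2.2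
    · rintro s'' c hF' ⟨P, hP, hPc, k1, k2, k3, k4⟩
      have hDP : (D ∪ P).card ≤ (r + 1) * (2 * σ) := by
        rw [add_mul, one_mul]
        exact (Finset.card_union_le _ _).trans (by omega)
      refine ⟨k3, D ∪ P, Finset.union_subset hD hP, hDP, ?_, ?_, ?_, ?_⟩
      · rw [residue_union, ← k1]; rfl
      · intro k hk
        rw [Mem.setVar_words, k2, g0 k hk, Finset.mem_union, or_assoc]
        refine or_congr_right (or_congr_right ?_)
        constructor
        · rintro ⟨k', hk', he⟩
          rw [Nat.add_left_cancel he]; exact hk'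
        · intro hk'
          exact ⟨k, hk', rfl⟩
      · intro i' hi' hne x hx
        rw [← g0' i' hi' hne x hx, Mem.setVar_words]
        rw [k2 (i' * n + x), or_iff_left]
        rintro ⟨k, hk, h⟩
        exact hne (idx_inj hx (by simpa using hP hk) h).1
      · intro hrep hopt
        have gs' := gs hrep hopt
        rw [residue_union] at *
        have hstep : 16 * (residue rk i (residue rk i C D) P).card ≤
            15 * (residue rk i C D).card := by
          rcases Nat.eq_zero_or_pos (residue rk i C D).card with h0 | hpos
          · have := Finset.card_le_card
              (residue_subset (rk := rk) (i := i) (C := residue rk i C D) (P := P))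
            omega
          · obtain ⟨A, hA, hAσ, hcov⟩ := hopt
            have := k4 hpos A hA hAσ fun j hj => by
              have hjC := hsub hj
              simp only [hC, rareElements, Finset.mem_filter, Finset.mem_range] at hjC
              refine hcov j hjC.1 ?_
              rintro rfl
              exact hjC.2.1.ne' (hR.self j hjC.1)
            rw [← residue_union] at this ⊢
            refine hrep D (D ∪ P) hD (Finset.union_subset hD hP) Finset.subset_union_left ?_ ?_ hpos this
            · exact hDc.trans (Nat.mul_le_mul_right _ hr.le)
            · exact hDP.trans (Nat.mul_le_mul_right _ hr)
        calc 16 ^ (r + 1) * (residue rk i (residue rk i C D) P).card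
            = 16 ^ r * (16 * (residue rk i (residue rk i C D) P).card) := by ring
          _ ≤ 16 ^ r * (15 * (residue rk i C D).card) := Nat.mul_le_mul_left _ hstep
          _ = 15 * (16 ^ r * (residue rk i C D).card) := by ring
          _ ≤ 15 * (15 ^ r * n) := Nat.mul_le_mul_left _ gs'
          _ = 15 ^ (r + 1) * n := by ring
  rintro s₃ c₃ hF₃ ⟨hc₃, D, hD, hDc, gun, g0, g0', gs⟩
  have h₃ := h₂.frame hF₃ rfl
  simp only [wp_seq, wp_assign, ev_const, hW1]
  refine (wp_forLoop_le (N := n) (by simpa using h₃.v0) (by omega) rfl rfl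
    (by norm_num) 2
    (fun k s' => s'.vars 27 = if ∀ x < k, s'.words 4 x ≠ 0 then 1 else 0) (by simp) ?_).mono ?_
  · intro k hk s' hF h22 g27
    simp only [wp_ite, wp_assign, wp_skip, holds_eq, ev_get, ev_var, ev_const, h22, hW0,
      Mem.setVar_vars, Mem.setVar_words, Nat.reduceEqDiff, ↓reduceIte]
    constructor
    · intro h4
      refine ⟨by norm_num, ?_⟩
      rw [if_neg]
      intro hall
      exact hall k (by omega) h4
    · intro h4
      refine ⟨by norm_num, ?_⟩
      rw [g27]
      congr 1
      apply propext
      constructor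
      · intro hall x hx
        rcases Nat.lt_succ_iff_lt_or_eq.1 hx with h | rfl
        · exact hall x h
        · exact h4
      · intro hall x hx
        exact hall x (by omega)
  rintro s₄ c₄ hF₄ ⟨hc₄, g27⟩
  have e4 := hF₄.word 4 rfl
  have h₄ := (h₃.setVar 27 1 (by decide)).frame hF₄ rfl
  rw [wp_store]
  -- The flag reports whether all rare elements are in fact covered, so a wrong guess is detected
  -- and never trusted.
  have hdone : (∀ x < n, s₄.words 4 x ≠ 0) ↔ residue rk i C D = ∅ := by
    rw [← gun, uncovered, Finset.filter_eq_empty_iff]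
    simp [e4]
  refine ⟨?_, D, hD, hDc, ?_, ?_, ?_, ?_⟩
  · have hassoc : K * (n * 16 + 20 + 2 * σ * (C.card * 14 + 6) + (R * 12 + 17) * (σ * B) + 3) =
      K * (n * 16 + 23 + 2 * σ * (C.card * 14 + 6) + (R * 12 + 17) * (σ * B)) := by ring
    omega
  · intro k hk
    rw [← g0 k hk]
    simp [hF₄.word 0 rfl]
  · intro i' hi' hne k hk
    rw [← g0' i' hi' hne k hk]
    simp [hF₄.word 0 rfl]
  · intro x
    simp only [Mem.setWord_words, true_and, ev_var, h₄.v20, g27, hdone]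
    split_ifs <;> simp [hF₄.word 8 rfl, hF₃.word 8 rfl, hF₂.word 8 rfl, hF₁.word 8 rfl]
  -- A surviving element would give `16 ^ K ≤ 15 ^ K * n`.
  · intro hrep hK hopt
    have := gs hrep hopt
    by_contra hne
    have hpos : 1 ≤ (residue rk i C D).card :=
      Finset.card_pos.2 (Finset.nonempty_iff_ne_empty.2 hne)
    have := Nat.mul_le_mul_left (16 ^ K) hpos
    omega

end

/-! ### All instances and all guesses -/

/-- Solves every instance with the smallest guess `2 ^ t` that succeeds. Variable `4` holds the
number `E` of points per unit of the guess that are taken from the tape, `5` the number `B` of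
samples per unit of the guess. -/
def solveAll : Program :=
  .assign 2 (.const 1) ;; .assign 19 (.var 1 + .const 1) ;;
  .forLoop 9 19 (
    .assign 8 (.var 0 / .var 2 + .const 1) ;; .assign 7 (.var 2 * .var 5) ;;
    .assign 31 (.var 2 * .var 4) ;; .assign 30 (.var 2 + .var 2) ;;
    .forLoop 20 0 (.ite (.eq (.get 8 (.var 20)) (.const 0))
      (.assign 10 (.var 20 * .var 0) ;; solveInstance) .skip) ;;
    .assign 2 (.var 2 + .var 2))

section
variable {n L K E B W : ℕ} {rk : ℕ → ℕ → ℕ} {y : ℕ → ℕ} {d : Fin n → Fin n → ℝ}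

/-- Double counting: for fixed `j`, at most `R` points `i` have `rk j i < R`. Single instances may
have many rare elements, but their total stays small. -/
theorem sum_card_rareElements_le (hR : Ranking n rk) (R : ℕ) :
    ∑ i ∈ Finset.range n, (rareElements n rk i R).card ≤ n * R := by
  simp only [rareElements, Finset.card_filter]
  rw [Finset.sum_comm]
  refine (Finset.sum_le_card_nsmul _ _ R fun j hj => ?_).trans (by simp)
  rw [← Finset.card_filter]
  have hj := Finset.mem_range.1 hj
  rw [← Finset.card_range R]
  apply Finset.card_le_card_of_injOn (rk j)
  · intro i hi
    simp only [Finset.coe_filter, Finset.mem_range, Set.mem_ofPred_eq] at hi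
    simpa using hi.2.2
  · intro i hi i' hi' h
    simp only [Finset.coe_filter, Finset.mem_range, Set.mem_ofPred_eq] at hi hi'
    exact hR.inj j hj i hi.1 i' hi'.1 h

/-- At most `σ` points cover all elements of instance `i`. -/
def HasCover (n : ℕ) (rk : ℕ → ℕ → ℕ) (i σ : ℕ) : Prop :=
  ∃ A ⊆ Finset.range n, A.card ≤ σ ∧ Covers n rk i A

/-- The samples are representative for instance `i` with guess `σ`. -/
def GoodSamples (n K B : ℕ) (rk : ℕ → ℕ → ℕ) (y : ℕ → ℕ) (i σ : ℕ) : Prop :=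
  Representative n B rk y i σ (n / σ + 1) (K * (2 * σ))

/-- Row `i` of the output consists of the first `σ * E` points of the tape and of a set of at most
`2 * K * σ` points that covers all rare elements. -/
def SolvedAt (n K E : ℕ) (rk : ℕ → ℕ → ℕ) (y : ℕ → ℕ) (out : ℕ → ℕ) (i σ : ℕ) : Prop :=
  ∃ D ⊆ Finset.range n, D.card ≤ K * (2 * σ) ∧
    (∀ k < n, out (i * n + k) ≠ 0 ↔ (∃ l < σ * E, y l = k) ∨ k ∈ D) ∧
    residue rk i (rareElements n rk i (n / σ + 1)) D = ∅

/-- State of instance `i` after the guesses `2 ^ 0, …, 2 ^ (t - 1)`. -/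
def Status (n K E B : ℕ) (rk : ℕ → ℕ → ℕ) (y : ℕ → ℕ) (t i : ℕ) (s : Mem) : Prop :=
  (s.words 8 i = 0 ∧ ∀ t' < t, GoodSamples n K B rk y i (2 ^ t') → ¬ HasCover n rk i (2 ^ t')) ∨
  (s.words 8 i ≠ 0 ∧ ∃ t' < t, SolvedAt n K E rk y (s.words 0) i (2 ^ t') ∧
    ∀ t'' < t', GoodSamples n K B rk y i (2 ^ t'') → ¬ HasCover n rk i (2 ^ t''))

/-- Used when another instance is being solved, which leaves row `i` of the output and the flag of
`i` alone. -/
theorem Status.congr {t i : ℕ} {s s' : Mem} (h : Status n K E B rk y t i s)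
    (h8 : s'.words 8 i = s.words 8 i)
    (h0 : ∀ k < n, s'.words 0 (i * n + k) ≠ 0 ↔ s.words 0 (i * n + k) ≠ 0) :
    Status n K E B rk y t i s' := by
  rcases h with ⟨h, h'⟩ | ⟨h, t', ht, ⟨D, hD, hDc, hout, hres⟩, h'⟩
  · exact .inl ⟨h8.trans h, h'⟩
  · exact .inr ⟨by rwa [h8], t', ht, ⟨D, hD, hDc, fun k hk => (h0 k hk).trans (hout k hk), hres⟩, h'⟩

theorem solveAll_spec (hS : WordSize n L W) (hR : Ranking n rk) {s : Mem}
    (h0 : s.vars 0 = n) (h1 : s.vars 1 = L) (h3 : s.vars 3 = K) (h4 : s.vars 4 = E)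
    (h5 : s.vars 5 = B) (hB : 0 < B) (hEB : E ≤ B) (hKW : K < W)
    (hBW : 16 * (2 ^ L * (2 ^ L * B)) ≤ W) (hK : 15 ^ K * n < 16 ^ K)
    (htape : ∀ l < 2 ^ L * B, s.words 1 l = y l ∧ y l < n)
    (hrank : ∀ j < n, ∀ x < n, s.words 2 (j * n + x) = rk j x)
    (hlist : ∀ j < n, ∀ x < n, s.words 3 (j * n + rk j x) = x)
    (hdone : ∀ x < n, s.words 8 x = 0) :
    wp W d solveAll (fun s' c =>
      c ≤ (L + 1) * (n * n * (80 + 8 * E + K * (150 + 70 * B)) + 30) + 30 ∧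
      ∀ i < n, Status n K E B rk y (L + 1) i s') s := by
  have hn := hS.pos
  have := hS.word
  have := hS.lt
  have hX2 := hS.le
  have := hS.nn_le
  have := hS.le_sq
  have hLX : L < 2 ^ L := Nat.lt_two_pow_self
  have hXB : 2 ^ L * B ≤ 2 ^ L * (2 ^ L * B) := Nat.le_mul_of_pos_left _ (by positivity)
  have hBX : B ≤ 2 ^ L * B := Nat.le_mul_of_pos_left _ (by positivity)
  have hW0 : 0 % W = 0 := Nat.zero_mod W
  have hW1 : 1 % W = 1 := Nat.mod_eq_of_lt (by omega)
  have hL1 : (L + 1) % W = L + 1 := Nat.mod_eq_of_lt (by omega)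
  simp only [solveAll, wp_seq (p := .assign 2 (.const 1)), wp_seq (p := .assign 19 _), wp_assign,
    ev_const, ev_add, ev_var, Mem.setVar_vars, OfNat.one_ne_ofNat, ↓reduceIte, hW1,
    h1, hL1]
  refine (wp_forLoop_le (N := L + 1) (by simp) (by omega) rfl rfl (by norm_num)
    (n * n * (80 + 8 * E + K * (150 + 70 * B)) + 27)
    (fun t s' => s'.vars 2 = 2 ^ t ∧ ∀ i < n, Status n K E B rk y t i s') ?_ ?_).mono ?_
  · refine ⟨by simp, fun i hi => .inl ⟨by simpa using hdone i hi, fun t' h => absurd h (by omega)⟩⟩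
  · rintro t ht s₁ hF₁ h9 ⟨g2, gst⟩
    have hσL : 2 ^ t ≤ 2 ^ L := Nat.pow_le_pow_right (by norm_num) (by omega)
    have hσ0 : 0 < 2 ^ t := by positivity
    have e0 := hF₁.var 0 rfl
    have e3 := hF₁.var 3 rfl
    have e4 := hF₁.var 4 rfl
    have e5 := hF₁.var 5 rfl
    have w1 := hF₁.word 1 rfl
    have w2 := hF₁.word 2 rfl
    have w3 := hF₁.word 3 rfl
    simp only [Mem.setVar_vars, Nat.reduceEqDiff, OfNat.zero_ne_ofNat, ↓reduceIte,
      Mem.setVar_words, h0, h3, h4, h5] at e0 e3 e4 e5 w1 w2 w3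
    generalize hσ : 2 ^ t = σ at g2 hσL hσ0
    have hσB : σ * B ≤ 2 ^ L * B := Nat.mul_le_mul_right _ hσL
    have hσE : σ * E ≤ σ * B := Nat.mul_le_mul_left _ hEB
    have hσσB : σ * (σ * B) ≤ 2 ^ L * (2 ^ L * B) := Nat.mul_le_mul hσL hσB
    have hdl : n / σ ≤ n := Nat.div_le_self _ _
    have hb1 : n / σ % W = n / σ := Nat.mod_eq_of_lt (by omega)
    have hb2 : (n / σ + 1) % W = n / σ + 1 := Nat.mod_eq_of_lt (by omega)
    have hb3 : σ * B % W = σ * B := Nat.mod_eq_of_lt (by omega)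
    have hb4 : σ * E % W = σ * E := Nat.mod_eq_of_lt (by omega)
    have hb5 : (σ + σ) % W = σ + σ := Nat.mod_eq_of_lt (by omega)
    simp only [wp_seq, wp_assign, ev_add, ev_div, ev_mul, ev_var, ev_const, Mem.setVar_vars,
      Nat.reduceEqDiff, ↓reduceIte, hW1, g2, e0, e4, e5, hb1, hb2, hb3, hb4,
      hb5]
    -- The bound of a round depends on the number of rare elements of instance `i`; only the sum
    -- over all instances is under control. In the invariant, the instances before `i` have already
    -- been tried with the current guess.
    refine (wp_forLoop_sum (N := n) (by simpa using e0) (by omega) rfl rfl (by norm_num)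
      (fun i => n * 30 + σ * E * 4 + 40 + K * (n * 16 + 23 +
        2 * σ * ((rareElements n rk i (n / σ + 1)).card * 14 + 6) +
          ((n / σ + 1) * 12 + 17) * (σ * B)))
      (fun i s' => (∀ i' < i, Status n K E B rk y (t + 1) i' s') ∧
        ∀ i' < n, i ≤ i' → Status n K E B rk y t i' s') ?_ ?_).mono ?_
    · refine ⟨fun i h => absurd h (by omega), fun i hi _ => (gst i hi).congr rfl fun k _ => Iff.rfl⟩
    · rintro i hi s₂ hF₂ h20 ⟨gl, gr⟩
      have f0 := hF₂.var 0 rfl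
      have f3 := hF₂.var 3 rfl
      have f7 := hF₂.var 7 rfl
      have f8 := hF₂.var 8 rfl
      have f30 := hF₂.var 30 rfl
      have f31 := hF₂.var 31 rfl
      have x1 := hF₂.word 1 rfl
      have x2 := hF₂.word 2 rfl
      have x3 := hF₂.word 3 rfl
      simp only [Mem.setVar_vars, Nat.reduceEqDiff, OfNat.zero_ne_ofNat, ↓reduceIte,
        Mem.setVar_words, e0, e3, w1, w2, w3] at f0 f3 f7 f8 f30 f31 x1 x2 x3
      have hin : i * n % W = i * n :=
        Nat.mod_eq_of_lt (by have := idx_lt hi hi; omega)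
      simp only [wp_ite, wp_seq, wp_assign, wp_skip, holds_eq, ev_get, ev_mul, ev_var, ev_const,
        h20, f0, hin, hW0]
      constructor
      · intro hd0
        have hRS : RoundSize n B i σ W := ⟨hi, hσ0, hB, by omega, by omega⟩
        have hI : InstData n B rk y i σ (s₂.setVar 10 (i * n)) := by
          constructor
          · simpa using f0
          · simpa using f7
          · simp
          · simpa using h20
          · simpa using f30
          · intro l hl
            rw [Mem.setVar_words, x1]
            exact (htape l (by omega)).1
          · rw [Mem.setVar_words, x2]; exact hrank
          · rw [Mem.setVar_words, x3]; exact hlist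
        refine (solveInstance_spec (K := K) (E := E) (R := n / σ + 1) hRS hR hI (by simpa using f3)
          (by simpa using f8) (by simpa using f31) hEB hKW
          fun l hl => (htape l (by omega)).2).mono ?_
        rintro s₃ c₃ hF₃ ⟨hc₃, D, hD, hDc, k1, k2, k3, k4⟩
        refine ⟨by omega, fun i' hi' => ?_, fun i' hi' hle => ?_⟩
        · rcases Nat.lt_succ_iff_lt_or_eq.1 hi' with hlt | rfl
          · exact (gl i' hlt).congr (by simp [k3, hlt.ne])
              fun k hk => k2 i' (by omega) hlt.ne k hk
          · rcases gr i' hi le_rfl with ⟨-, hno⟩ | ⟨h, -⟩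
            · by_cases hres : residue rk i' (rareElements n rk i' (n / σ + 1)) D = ∅
              · refine .inr ⟨by simp [k3, hres], t, by omega, ?_, hno⟩
                rw [hσ]
                exact ⟨D, hD, hDc, k1, hres⟩
              · refine .inl ⟨by simp [k3, hres], fun t' ht' => ?_⟩
                rcases Nat.lt_succ_iff_lt_or_eq.1 ht' with h | rfl
                · exact hno t' h
                · rw [hσ]
                  intro hg hc
                  exact hres (k4 hg hK hc)
            · exact absurd hd0 h
        · exact (gr i' hi' (by omega)).congr (by simp [k3, show i' ≠ i by omega])
            fun k hk => k2 i' hi' (by omega) k hk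
      · intro hd0
        refine ⟨by omega, fun i' hi' => ?_, fun i' hi' hle => ?_⟩
        · rcases Nat.lt_succ_iff_lt_or_eq.1 hi' with hlt | rfl
          · exact (gl i' hlt).congr rfl fun k _ => Iff.rfl
          · rcases gr i' hi le_rfl with ⟨h, -⟩ | ⟨h, t', ht', h'⟩
            · exact absurd h hd0
            · exact Status.congr (.inr ⟨h, t', by omega, h'⟩) rfl fun k _ => Iff.rfl
        · exact (gr i' hi' (by omega)).congr rfl fun k _ => Iff.rfl
    · rintro s₂ c₂ hF₂ ⟨hc₂, gl, -⟩
      have f2 := hF₂.var 2 rfl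
      simp only [Mem.setVar_vars, Nat.reduceEqDiff, ↓reduceIte, g2] at f2
      have hpow : (σ + σ) = 2 ^ (t + 1) := by rw [← hσ]; ring
      refine ⟨?_, ?_, fun i hi => (gl i hi).congr rfl fun k _ => Iff.rfl⟩
      -- Here `σ ≤ 2 ^ L ≤ 2 * n` bounds the second summand. This balance between guess and rank
      -- threshold makes every term quadratic up to the parameters.
      · have hσR : σ * (n / σ + 1) ≤ 3 * n := by
          rw [mul_add, mul_one]
          have := Nat.mul_div_le n σ
          omega
        have hsum := sum_card_rareElements_le hR (n / σ + 1)
        have hsplit : ∑ i ∈ Finset.range n, (n * 30 + σ * E * 4 + 40 + K * (n * 16 + 23 +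
            2 * σ * ((rareElements n rk i (n / σ + 1)).card * 14 + 6) +
            ((n / σ + 1) * 12 + 17) * (σ * B)) + 3) =
            n * (n * 30 + σ * E * 4 + 43 + K * (n * 16 + 23 + 12 * σ +
              ((n / σ + 1) * 12 + 17) * (σ * B))) +
            K * (28 * (σ * ∑ i ∈ Finset.range n, (rareElements n rk i (n / σ + 1)).card)) := by
          rw [Finset.mul_sum, Finset.mul_sum, Finset.mul_sum]
          have hconst : ∀ c : ℕ, n * c = ∑ _i ∈ Finset.range n, c := by intro c; simp
          rw [hconst (n * 30 + σ * E * 4 + 43 + K * (n * 16 + 23 + 12 * σ +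
            ((n / σ + 1) * 12 + 17) * (σ * B))), ← Finset.sum_add_distrib]
          refine Finset.sum_congr rfl fun i _ => ?_
          ring
        have hσ2 : σ ≤ 2 * n := by omega
        have hA : σ * ∑ i ∈ Finset.range n, (rareElements n rk i (n / σ + 1)).card ≤
            3 * (n * n) := by
          calc _ ≤ σ * (n * (n / σ + 1)) := Nat.mul_le_mul_left _ hsum
            _ = n * (σ * (n / σ + 1)) := by ring
            _ ≤ n * (3 * n) := Nat.mul_le_mul_left _ hσR
            _ = 3 * (n * n) := by ring
        have hBd : ((n / σ + 1) * 12 + 17) * (σ * B) ≤ n * (70 * B) := by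
          calc _ = (12 * (σ * (n / σ + 1)) + 17 * σ) * B := by ring
            _ ≤ (12 * (3 * n) + 17 * (2 * n)) * B :=
              Nat.mul_le_mul_right _ (by omega)
            _ = n * (70 * B) := by ring
        have hE' : σ * E * 4 ≤ n * (8 * E) := by
          calc _ = σ * (4 * E) := by ring
            _ ≤ 2 * n * (4 * E) := Nat.mul_le_mul_right _ hσ2
            _ = n * (8 * E) := by ring
        have hfinal : n * (n * 30 + σ * E * 4 + 43 + K * (n * 16 + 23 + 12 * σ +
              ((n / σ + 1) * 12 + 17) * (σ * B))) +
            K * (28 * (σ * ∑ i ∈ Finset.range n, (rareElements n rk i (n / σ + 1)).card)) ≤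
            n * n * (80 + 8 * E + K * (150 + 70 * B)) := by
          calc _ ≤ n * (n * 30 + n * (8 * E) + n * 43 + K * (n * 16 + n * 23 + n * 24 +
                n * (70 * B))) + K * (28 * (3 * (n * n))) := by
                refine add_le_add (Nat.mul_le_mul_left _ ?_)
                  (Nat.mul_le_mul_left _ (Nat.mul_le_mul_left _ hA))
                refine add_le_add (by omega) (Nat.mul_le_mul_left _ (by omega))
            _ = n * n * (73 + 8 * E + K * (147 + 70 * B)) := by ring
            _ ≤ _ := by gcongr <;> omega
        rw [hsplit] at hc₂
        omega
      · simp only [f2, hb5]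
        exact hpow
  · rintro s' c - ⟨hc, -, h⟩
    rw [show ∀ x, x + 27 + 3 = x + 30 from fun _ => rfl] at hc
    exact ⟨by omega, h⟩

end

/-! ### Querying and sorting -/

/-- Stores `d(p_j, p_x)` in entry `j * n + x` of distance array `0`. -/
def queryAll : Program :=
  .forLoop 9 0 (.assign 10 (.var 9 * .var 0) ;;
    .forLoop 13 0 (.query 0 (.var 10 + .var 13) (.var 9) (.var 13)))

/-- Evaluates all distances and sorts every row. -/
def prepare : Program := queryAll ;; .forLoop 9 0 sortRow

/-- Rank of `x` by the distance from `j`. -/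
noncomputable def distRank {n : ℕ} (d : Fin n → Fin n → ℝ) (j x : ℕ) : ℕ :=
  below (oracle d j) (Finset.range n) x

section
variable {n L W : ℕ} {d : Fin n → Fin n → ℝ}

theorem oracle_injOn (hG : GeneralPosition d) {j : ℕ} (hj : j < n) :
    Set.InjOn (oracle d j) (Finset.range n) := by
  intro x hx x' hx' h
  have hx : x < n := by simpa using hx
  have hx' : x' < n := by simpa using hx'
  by_contra hne
  refine hG ⟨j, hj⟩ ⟨x, hx⟩ ⟨x', hx'⟩ (by simpa using hne) ?_
  simpa [oracle, hj, hx, hx'] using h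

theorem distRank_lt_iff {j x x' : ℕ} (hx : x < n) :
    distRank d j x < distRank d j x' ↔ oracle d j x < oracle d j x' :=
  below_lt_iff (by simpa using hx)

/-- General position makes the ranks injective, and `j` comes first in its own row because all other
distances are positive. -/
theorem ranking_distRank (hd : IsDistance d) (hG : GeneralPosition d) :
    Ranking n (distRank d) := by
  refine ⟨fun j hj => ?_, fun j hj x hx => ?_, fun j hj x hx x' hx' h => ?_, fun j hj r hr => ?_⟩
  · rw [distRank, below, Finset.card_eq_zero, Finset.filter_eq_empty_iff]
    intro x hx
    have hx : x < n := by simpa using hx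
    simp only [oracle, hj, hx, and_self, ↓reduceDIte, hd.self, not_lt]
    by_cases h : j = x
    · subst h; simp [hd.self]
    · exact (hd.pos _ _ (by simpa using h)).le
  · simpa [distRank] using
      below_lt_card (D := oracle d j) (S := Finset.range n) (by simpa using hx)
  · exact below_injOn (oracle_injOn hG hj) (by simpa using hx) (by simpa using hx') h
  · obtain ⟨z, hz, h⟩ := exists_below_eq (oracle_injOn hG hj) (m := r) (by simpa using hr)
    exact ⟨z, by simpa using hz, h⟩

theorem queryAll_spec (hS : WordSize n L W) {s : Mem} (h0 : s.vars 0 = n) :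
    wp W d queryAll (fun s' c => c ≤ n * (n * 4 + 8) + 3 ∧ s'.queries = s.queries + n * n ∧
      ∀ j < n, ∀ x < n, s'.dists 0 (j * n + x) = oracle d j x) s := by
  have := hS.word
  have := hS.lt
  have := hS.nn_le
  have := hS.le_sq
  refine (wp_forLoop_le (N := n) h0 (by omega) rfl rfl (by norm_num) (n * 4 + 5)
    (fun i s' => s'.queries = s.queries + i * n ∧
      ∀ j < i, ∀ x < n, s'.dists 0 (j * n + x) = oracle d j x) ?_ ?_).mono ?_
  · exact ⟨by simp, fun _ h => absurd h (by omega)⟩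
  · rintro i hi s₁ hF h9 ⟨gq, gd⟩
    have e0 := (hF.var 0 rfl).trans h0
    have hb : i * n % W = i * n := Nat.mod_eq_of_lt (by have := idx_lt hi hi; omega)
    simp only [wp_seq, wp_assign, ev_mul, ev_var, h9, e0, hb]
    refine (wp_forLoop_le (N := n) (by simpa using e0) (by omega) rfl rfl (by norm_num) 1
      (fun k s' => s'.queries = s.queries + i * n + k ∧
        (∀ j < i, ∀ x < n, s'.dists 0 (j * n + x) = oracle d j x) ∧
        ∀ x < k, s'.dists 0 (i * n + x) = oracle d i x) ?_ ?_).mono ?_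
    · exact ⟨gq, gd, fun _ h => absurd h (by omega)⟩
    · rintro k hk s₂ hF₂ h13 ⟨kq, kd, kk⟩
      have f9 := hF₂.var 9 rfl
      have f10 := hF₂.var 10 rfl
      simp only [Mem.setVar_vars, Nat.reduceEqDiff, ↓reduceIte, h9] at f9 f10
      have hb2 : (i * n + k) % W = i * n + k :=
        Nat.mod_eq_of_lt (by have := idx_lt hi hk; omega)
      simp only [wp_query, ev_add, ev_var, f9, f10, h13, hb2, Mem.setVar_queries,
        Mem.addQuery_queries, Mem.setDist_queries, Mem.setVar_dists, Mem.addQuery_dists,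
        Mem.setDist_dists, true_and, le_refl, add_right_inj]
      refine ⟨by omega, fun j hj x hx => ?_, fun x hx => ?_⟩
      · rw [if_neg fun h => hj.ne (idx_inj hx hk h).1]
        exact kd j hj x hx
      · split_ifs with h
        · rw [h]
        · exact kk x (by omega)
    · rintro s₂ c₂ - ⟨hc₂, kq, kd, kk⟩
      refine ⟨by omega, ?_, fun j hj x hx => ?_⟩
      · rw [Mem.setVar_queries, kq]; ring
      · rcases Nat.lt_succ_iff_lt_or_eq.1 hj with h | rfl
        · exact kd j h x hx
        · exact kk x hx
  · rintro s' c - ⟨hc, h⟩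
    rw [show ∀ x, x + 5 + 3 = x + 8 from fun _ => rfl] at hc
    exact ⟨hc, h⟩

theorem prepare_spec (hS : WordSize n L W) (hG : GeneralPosition d) {s : Mem} (h0 : s.vars 0 = n)
    (h1 : s.vars 1 = L) :
    wp W d prepare (fun s' c =>
      c ≤ n * (n * 14 + L * (n * (13 * L + 50) + 23) + 31) + 10 ∧
      s'.queries = s.queries + n * n ∧
      (∀ j < n, ∀ x < n, s'.words 2 (j * n + x) = distRank d j x) ∧
      ∀ j < n, ∀ x < n, s'.words 3 (j * n + distRank d j x) = x) s := by
  have := hS.word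
  have := hS.lt
  have := hS.le_sq
  rw [prepare, wp_seq]
  refine (queryAll_spec hS h0).mono ?_
  rintro s₁ c₁ hF₁ ⟨hc₁, gq, gd⟩
  refine (wp_forLoop_le (N := n) ((hF₁.var 0 rfl).trans h0) (by omega) rfl rfl (by norm_num)
    (L * (n * (13 * L + 50) + 20 + 3) + n * 10 + 20)
    (fun i s' => (∀ j < i, ∀ x < n, s'.words 2 (j * n + x) = distRank d j x) ∧
      ∀ j < i, ∀ x < n, s'.words 3 (j * n + distRank d j x) = x) ?_ ?_).mono ?_
  · exact ⟨fun _ h => absurd h (by omega), fun _ h => absurd h (by omega)⟩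
  · rintro i hi s₂ hF₂ h9 ⟨g2, g3⟩
    have e0 := ((hF₂.var 0 rfl).trans (hF₁.var 0 rfl)).trans h0
    have e1 := ((hF₂.var 1 rfl).trans (hF₁.var 1 rfl)).trans h1
    have ed := hF₂.dist rfl
    refine (sortRow_spec hS (oracle_injOn hG hi) e0 e1 h9 hi (by rw [ed]; exact gd i hi)).mono ?_
    rintro s₃ c₃ - ⟨hc₃, k2, k3, k⟩
    have hrow : ∀ j < i, ∀ r < n, j * n + r < i * n := by
      intro j hj r hr
      have := Nat.mul_le_mul_right n (show j + 1 ≤ i from hj)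
      rw [add_mul, one_mul] at this
      omega
    refine ⟨hc₃, fun j hj x hx => ?_, fun j hj x hx => ?_⟩
    · rcases Nat.lt_succ_iff_lt_or_eq.1 hj with h | rfl
      · rw [Mem.setVar_words, (k _ (.inl (hrow j h x hx))).1, g2 j h x hx]
      · exact k2 x hx
    · rcases Nat.lt_succ_iff_lt_or_eq.1 hj with h | rfl
      · have hlt : distRank d j x < n := by
          simpa [distRank] using
            below_lt_card (D := oracle d j) (S := Finset.range n) (by simpa using hx)
        rw [Mem.setVar_words, (k _ (.inl (hrow j h _ hlt))).2, g3 j h x hx]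
      · exact k3 x hx
  · rintro s₂ c₂ hF₂ ⟨hc₂, g2, g3⟩
    refine ⟨?_, (hF₂.queries rfl).trans gq, g2, g3⟩
    have : n * (n * 14 + L * (n * (13 * L + 50) + 23) + 31) = n * (n * 4 + 8) +
      n * (L * (n * (13 * L + 50) + 20 + 3) + n * 10 + 20 + 3) := by ring
    omega

/-! ### Parameters -/

/-- Computes the number of bits `L` of `n` (variable `1`), the number of rounds (variable `3`), the
parameters `E` and `B` (variables `4` and `5`) and the tape length (variable `6`) for the failure
probability `1 / n ^ a`. -/
def setup (a : ℕ) : Program :=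
  .assign 1 (.const 0) ;; .assign 2 (.const 1) ;;
  .loop (.lt (.var 2) (.var 0 + .const 1))
    (.assign 2 (.var 2 + .var 2) ;; .assign 1 (.var 1 + .const 1)) ;;
  .assign 3 (.const 11 * .var 1) ;; .assign 4 (.const (a + 3) * .var 1) ;;
  .assign 5 (.const 2 * ((.const 4 * .var 3 + .const (a + 5)) * .var 1)) ;;
  .assign 6 (.var 2 * .var 5)

/-- Half the number of samples per unit of the guess. -/
def halfSamples (a L : ℕ) : ℕ := (4 * (11 * L) + (a + 5)) * L

/-- Doubling from `1` exceeds `n` after exactly `n.size` rounds. The assumption `hBW` bounds every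
intermediate parameter, so nothing wraps around. -/
theorem setup_spec {a : ℕ} (hS : WordSize n L W) (hL : L = n.size) (ha : a + 11 < W)
    (hBW : 16 * (2 ^ L * (2 ^ L * (2 * halfSamples a L))) ≤ W) {s : Mem} (h0 : s.vars 0 = n) :
    wp W d (setup a) (fun s' c => c ≤ L * 5 + 20 ∧ s'.vars 1 = L ∧ s'.vars 3 = 11 * L ∧
      s'.vars 4 = (a + 3) * L ∧ s'.vars 5 = 2 * halfSamples a L ∧
      s'.vars 6 = 2 ^ L * (2 * halfSamples a L)) s := by
  have := hS.word
  have := hS.lt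
  have := hS.le_sq
  have hL0 : 0 < L := by rw [hL]; exact Nat.size_pos.2 hS.pos
  have hLX : L < 2 ^ L := Nat.lt_two_pow_self
  have hW0 : 0 % W = 0 := Nat.zero_mod W
  have hW1 : 1 % W = 1 := Nat.mod_eq_of_lt (by omega)
  have hW2 : 2 % W = 2 := Nat.mod_eq_of_lt (by omega)
  have hW4 : 4 % W = 4 := Nat.mod_eq_of_lt (by omega)
  have hW11 : 11 % W = 11 := Nat.mod_eq_of_lt (by omega)
  have ha3 : (a + 3) % W = a + 3 := Nat.mod_eq_of_lt (by omega)
  have ha5 : (a + 5) % W = a + 5 := Nat.mod_eq_of_lt (by omega)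
  have hn1 : (n + 1) % W = n + 1 := Nat.mod_eq_of_lt (by omega)
  set X := 2 ^ L * (2 * halfSamples a L) with hX
  have hX' : X ≤ 2 ^ L * X := Nat.le_mul_of_pos_left _ (by positivity)
  have hH : 2 * halfSamples a L ≤ X := Nat.le_mul_of_pos_left _ (by positivity)
  have hH1 : 4 * (11 * L) + (a + 5) ≤ halfSamples a L := Nat.le_mul_of_pos_right _ hL0
  have hH2 : (a + 3) * L ≤ halfSamples a L := Nat.mul_le_mul_right _ (by omega)
  have hb1 : 11 * L % W = 11 * L := Nat.mod_eq_of_lt (by omega)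
  have hb2 : (a + 3) * L % W = (a + 3) * L := Nat.mod_eq_of_lt (by omega)
  have hb3 : 4 * (11 * L) % W = 4 * (11 * L) := Nat.mod_eq_of_lt (by omega)
  have hb4 : (4 * (11 * L) + (a + 5)) % W = 4 * (11 * L) + (a + 5) := Nat.mod_eq_of_lt (by omega)
  have hb5 : halfSamples a L % W = halfSamples a L := Nat.mod_eq_of_lt (by omega)
  have hb6 : 2 * halfSamples a L % W = 2 * halfSamples a L := Nat.mod_eq_of_lt (by omega)
  have hb7 : X % W = X := Nat.mod_eq_of_lt (by omega)
  simp only [setup, wp_seq, wp_assign, ev_const, hW0, hW1]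
  refine (wp_loop L (fun t s' c => c = t * 4 ∧ s'.vars 1 = t ∧ s'.vars 2 = 2 ^ t) ?_ ?_ ?_).mono ?_
  · simp
  · rintro t ht s₁ c hF ⟨hc, g1, g2⟩
    have e0 := hF.var 0 rfl
    simp only [Mem.setVar_vars, OfNat.zero_ne_ofNat, zero_ne_one, ↓reduceIte,
      h0] at e0
    have hle : 2 ^ t ≤ n := Nat.lt_size.1 (hL ▸ ht)
    have hb : (2 ^ t + 2 ^ t) % W = 2 ^ t + 2 ^ t := Nat.mod_eq_of_lt (by omega)
    have hb' : (t + 1) % W = t + 1 := Nat.mod_eq_of_lt (by omega)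
    simp only [holds_lt, ev_var, ev_add, ev_const, wp_seq, wp_assign, g1, g2, e0, hW1, hn1, hb, hb',
      Mem.setVar_vars, OfNat.one_ne_ofNat, OfNat.ofNat_ne_one, ↓reduceIte, hc]
    exact ⟨by omega, by ring, trivial, by ring⟩
  · rintro s₁ c hF ⟨-, g1, g2⟩
    have e0 := hF.var 0 rfl
    simp only [Mem.setVar_vars, OfNat.zero_ne_ofNat, zero_ne_one, ↓reduceIte,
      h0] at e0
    simp only [holds_lt, ev_var, ev_add, ev_const, g2, e0, hW1, hn1]
    omega
  · rintro s₁ c hF ⟨c₀, rfl, hc, g1, g2⟩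
    have hhalf : (4 * (11 * L) + (a + 5)) * L = halfSamples a L := rfl
    simp only [ev_var, ev_add, ev_mul, ev_const, g1, g2, hW2, hW4, hW11, ha3, ha5,
      Mem.setVar_vars, Nat.reduceEqDiff, OfNat.one_ne_ofNat, ↓reduceIte,
      hb1, hb2, hb3, hb4, hhalf, hb5, hb6, hb7, and_true, ← hX]
    omega

/-! ### The random tape -/

/-- Writes variable `6` many uniformly random points to array `1`. -/
def drawTape : Program := .forLoop 23 6 (.sample 24 (.var 0) ;; .store 1 (.var 23) (.var 24))

/-- The loop of `drawTape`. -/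
def drawTapeLoop : Program :=
  .loop (.lt (.var 23) (.var 6)) ((.sample 24 (.var 0) ;; .store 1 (.var 23) (.var 24)) ;;
    .assign 23 (.var 23 + .const 1))

/-- Effect of one round of `drawTapeLoop` in which `v` is drawn. -/
def tapeStep (s : Mem) (v : ℕ) : Mem :=
  ((s.setVar 24 v).setWord 1 (s.vars 23) v).setVar 23 (s.vars 23 + 1)

/-- Memory after `m` rounds of `drawTapeLoop` in which `y` is drawn. -/
def tapeMem (s : Mem) : (m : ℕ) → (Fin m → Fin n) → Mem
  | 0, _ => s.setVar 23 0
  | m + 1, y => tapeStep (tapeMem s m (Fin.init y)) (y (Fin.last m))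

theorem tapeMem_spec (s : Mem) (m : ℕ) (y : Fin m → Fin n) :
    (tapeMem s m y).vars 23 = m ∧
    (∀ x, x ≠ 23 → x ≠ 24 → (tapeMem s m y).vars x = s.vars x) ∧
    (∀ l (h : l < m), (tapeMem s m y).words 1 l = y ⟨l, h⟩) ∧
    (∀ b, b ≠ 1 → (tapeMem s m y).words b = s.words b) ∧
    (tapeMem s m y).dists = s.dists ∧ (tapeMem s m y).queries = s.queries := by
  induction m with
  | zero =>
    refine ⟨by simp [tapeMem], fun x h _ => by simp [tapeMem, h], fun l h => absurd h (by omega),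
      fun b _ => rfl, rfl, rfl⟩
  | succ m ih =>
    obtain ⟨h1, h2, h3, h4, h5, h6⟩ := ih (Fin.init y)
    refine ⟨by simp [tapeMem, tapeStep, h1], fun x hx hx' => ?_, fun l hl => ?_, fun b hb => ?_,
      h5, h6⟩
    · simp [tapeMem, tapeStep, h2 x hx hx', hx, hx']
    · simp only [tapeMem, tapeStep, Mem.setVar_words, Mem.setWord_words, true_and, h1]
      split_ifs with h
      · subst h; rfl
      · rw [h3 l (by omega)]; rfl
    · funext l
      simp [tapeMem, tapeStep, hb, h4 b hb]

theorem uniformBelow_eq_map [NeZero n] :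
    uniformBelow n = (PMF.uniformOfFintype (Fin n)).map Fin.val := by
  have hn : n ≠ 0 := NeZero.ne n
  have hne : (Finset.range n).Nonempty := by simpa using hn
  rw [uniformBelow, dif_pos hne]
  ext v
  rw [PMF.uniformOfFinset_apply, PMF.map_apply]
  simp only [Finset.mem_range, Finset.card_range, PMF.uniformOfFintype_apply, Fintype.card_fin]
  split_ifs with h
  · rw [tsum_eq_single (⟨v, h⟩ : Fin n)]
    · simp
    · intro b hb
      rw [if_neg]
      rintro rfl
      exact hb rfl
  · rw [tsum_fintype, Finset.sum_eq_zero]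
    intro b _
    rw [if_neg]
    rintro rfl
    exact h b.2

/-- Matches one round of the sampling loop: a uniform tape is a uniform shorter tape followed by an
independent uniform entry. -/
theorem uniform_fin_succ [NeZero n] (m : ℕ) :
    PMF.uniformOfFintype (Fin (m + 1) → Fin n) =
      (PMF.uniformOfFintype (Fin m → Fin n)).bind fun y =>
        (PMF.uniformOfFintype (Fin n)).map fun v => (Fin.snoc y v : Fin (m + 1) → Fin n) := by
  ext z
  rw [PMF.bind_apply, tsum_fintype, Finset.sum_eq_single (Fin.init z)]
  · rw [PMF.map_apply, tsum_fintype, Finset.sum_eq_single (z (Fin.last m))]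
    · simp only [PMF.uniformOfFintype_apply, Fintype.card_pi, Finset.prod_const, Finset.card_univ,
        Fintype.card_fin, Fin.snoc_init_self, if_true]
      rw [pow_succ]
      push_cast
      rw [ENNReal.mul_inv]
      · exact .inr (ENNReal.natCast_ne_top _)
      · exact .inl (by simp)
    · intro v _ hv
      rw [if_neg]
      intro h
      apply hv
      rw [h]
      simp
    · simp
  · intro y _ hy
    rw [PMF.map_apply, tsum_fintype, Finset.sum_eq_zero, mul_zero]
    intro v _
    rw [if_neg]
    intro h
    apply hy
    rw [h]
    simp
  · simp

/-- The six steps are the test, two sequencings, the draw, the store and the increment. -/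
theorem runFrom_drawTape_round [NeZero n] {s : Mem} (k : List Program) (h0 : s.vars 0 = n)
    (hlt : s.vars 23 < s.vars 6) (hW : s.vars 23 + 1 < W) :
    runFrom W d 6 (s.cfg (drawTapeLoop :: k)) =
      (PMF.uniformOfFintype (Fin n)).map fun v : Fin n => (tapeStep s v).cfg (drawTapeLoop :: k) := by
  have hW1 : 1 % W = 1 := Nat.mod_eq_of_lt (by omega)
  have hb : (s.vars 23 + 1) % W = s.vars 23 + 1 := Nat.mod_eq_of_lt hW
  have h1 : step W d (s.cfg (drawTapeLoop :: k)) = PMF.pure (s.cfg (((.sample 24 (.var 0) ;;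
      .store 1 (.var 23) (.var 24)) ;; .assign 23 (.var 23 + .const 1)) :: drawTapeLoop :: k)) := by
    simp [step, drawTapeLoop, Mem.cfg, Test.Holds, WordExpr.value, hlt]
  have h2 : ∀ (p q : Program) k', step W d (s.cfg ((p ;; q) :: k')) =
      PMF.pure (s.cfg (p :: q :: k')) := by
    intro p q k'
    simp [step, Mem.cfg]
  have h3 : ∀ k', step W d (s.cfg (.sample 24 (.var 0) :: k')) =
      (PMF.uniformOfFintype (Fin n)).map fun v : Fin n => (s.setVar 24 v).cfg k' := by
    intro k'
    simp only [step, Mem.cfg, WordExpr.value, h0, uniformBelow_eq_map, PMF.map_comp]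
    rfl
  rw [show (6 : ℕ) = 3 + 1 + 1 + 1 from rfl, runFrom, h1, PMF.pure_bind, runFrom, h2, PMF.pure_bind,
    runFrom, h2, PMF.pure_bind, runFrom, h3, PMF.bind_map]
  rw [← PMF.bind_pure_comp]
  congr 1
  funext v
  simp only [Function.comp]
  have e : Exec W d (.store 1 (.var 23) (.var 24)) (s.setVar 24 v)
      ((s.setVar 24 v).setWord 1 (s.vars 23) v) 1 := by
    have := Exec.store (W := W) (d := d) 1 (.var 23) (.var 24) (s.setVar 24 v)
    simpa using this
  have e' : Exec W d (.assign 23 (.var 23 + .const 1)) ((s.setVar 24 v).setWord 1 (s.vars 23) v)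
      (tapeStep s v) 1 := by
    have := Exec.assign (W := W) (d := d) 23 (.var 23 + .const 1)
      ((s.setVar 24 v).setWord 1 (s.vars 23) v)
    simpa [hW1, hb, tapeStep] using this
  rw [show (2 : ℕ) = 1 + 1 from rfl, runFrom_add, e.runFrom_eq, PMF.pure_bind, e'.runFrom_eq]

/-- The only place where randomness enters. The duration is the same for all outcomes, so the whole
phase is a map of the uniform distribution on tapes. -/
theorem runFrom_drawTapeLoop [NeZero n] {s : Mem} (k : List Program) (h0 : s.vars 0 = n)
    (hW : s.vars 6 < W) (m : ℕ) (hm : m ≤ s.vars 6) :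
    runFrom W d (6 * m) ((s.setVar 23 0).cfg (drawTapeLoop :: k)) =
      (PMF.uniformOfFintype (Fin m → Fin n)).map fun y =>
        (tapeMem s m y).cfg (drawTapeLoop :: k) := by
  induction m with
  | zero =>
    have : (PMF.uniformOfFintype (Fin 0 → Fin n)).map (fun y =>
        (tapeMem s 0 y).cfg (drawTapeLoop :: k)) =
        (PMF.uniformOfFintype (Fin 0 → Fin n)).map
          (Function.const _ ((s.setVar 23 0).cfg (drawTapeLoop :: k))) := rfl
    rw [this, PMF.map_const]
    rfl
  | succ m ih =>
    rw [mul_add, mul_one, runFrom_add, ih (by omega), PMF.bind_map, uniform_fin_succ, PMF.map_bind]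
    congr 1
    funext y
    obtain ⟨g1, g2, -⟩ := tapeMem_spec s m y
    rw [Function.comp, runFrom_drawTape_round k ((g2 0 (by norm_num) (by norm_num)).trans h0)
      (by rw [g1, g2 6 (by norm_num) (by norm_num)]; omega) (by rw [g1]; omega), PMF.map_comp]
    congr 1
    funext v
    simp [tapeMem]

end

/-! ### Counting bad tapes -/

/-- The union bound with denominators cleared: read `b / c` as a bound on the size of each bad
event. All probability estimates below have this form. -/
theorem card_biUnion_mul_le {ι α : Type*} [DecidableEq α] (s : Finset ι) (f : ι → Finset α)
    (c b : ℕ) (h : ∀ i ∈ s, (f i).card * c ≤ b) : (s.biUnion f).card * c ≤ s.card * b := by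
  calc (s.biUnion f).card * c ≤ (∑ i ∈ s, (f i).card) * c :=
        Nat.mul_le_mul_right _ Finset.card_biUnion_le
    _ = ∑ i ∈ s, (f i).card * c := Finset.sum_mul _ _ _
    _ ≤ s.card * b := by simpa using Finset.sum_le_card_nsmul s _ b h

/-- Independence of the tape entries as a count: the event has probability `(S.card / n) ^ A.card`.
-/
theorem card_forall_mem {N n : ℕ} (A : Finset (Fin N)) (S : Finset (Fin n)) :
    (Finset.univ.filter fun y : Fin N → Fin n => ∀ l ∈ A, y l ∈ S).card * n ^ A.card =
      S.card ^ A.card * n ^ N := by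
  have h1 : (Finset.univ.filter fun y : Fin N → Fin n => ∀ l ∈ A, y l ∈ S) =
      Fintype.piFinset fun l => if l ∈ A then S else Finset.univ := by
    ext y
    simp only [Finset.mem_filter, Finset.mem_univ, true_and, Fintype.mem_piFinset]
    refine forall_congr' fun l => ?_
    split_ifs with h <;> simp [h]
  have h2 : ∀ l : Fin N, (if l ∈ A then S else Finset.univ).card = if l ∈ A then S.card else n := by
    intro l; split_ifs <;> simp
  rw [h1, Fintype.card_piFinset]
  simp only [h2]
  rw [Finset.prod_ite]
  simp only [Finset.prod_const, Finset.filter_mem_eq_inter, Finset.univ_inter]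
  have h3 : (Finset.univ.filter fun l => l ∉ A).card + A.card = N := by
    have := Finset.card_filter_add_card_filter_not (s := (Finset.univ : Finset (Fin N))) (· ∈ A)
    simp only [Finset.filter_mem_eq_inter, Finset.univ_inter, Finset.card_univ,
      Fintype.card_fin] at this
    omega
  rw [mul_assoc, ← pow_add, h3]

/-- A finite tape as a function on the natural numbers. -/
def tapeFn {N n : ℕ} (y : Fin N → Fin n) (l : ℕ) : ℕ := if h : l < N then y ⟨l, h⟩ else 0

theorem tapeFn_of_lt {N n : ℕ} (y : Fin N → Fin n) {l : ℕ} (h : l < N) :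
    tapeFn y l = y ⟨l, h⟩ := dif_pos h

theorem tapeFn_lt {N n : ℕ} (y : Fin N → Fin n) {l : ℕ} (h : l < N) : tapeFn y l < n := by
  rw [tapeFn_of_lt y h]; exact (y _).2

/-- Number of tapes whose entries at `m` given places lie in `S`. -/
theorem card_tapes_mul {N n m : ℕ} (A : Finset ℕ) (hA : A ⊆ Finset.range N) (hm : A.card = m)
    (p : ℕ → Prop) [DecidablePred p] :
    (Finset.univ.filter fun y : Fin N → Fin n => ∀ l ∈ A, p (tapeFn y l)).card * n ^ m =
      ((Finset.range n).filter p).card ^ m * n ^ N := by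
  have h := card_forall_mem (Finset.univ.filter fun l : Fin N => (l : ℕ) ∈ A)
    (Finset.univ.filter fun v : Fin n => p v)
  have h1 : (Finset.univ.filter fun l : Fin N => (l : ℕ) ∈ A).card = m := by
    rw [← hm, ← Finset.card_map Fin.valEmbedding]
    congr 1
    ext l
    simp only [Finset.mem_map, Finset.mem_filter, Finset.mem_univ, true_and, Fin.valEmbedding_apply]
    constructor
    · rintro ⟨l', h, rfl⟩; exact h
    · intro h
      exact ⟨⟨l, by simpa using hA h⟩, h, rfl⟩
  have h2 : (Finset.univ.filter fun v : Fin n => p v).card = ((Finset.range n).filter p).card := by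
    rw [← Finset.card_map Fin.valEmbedding]
    congr 1
    ext v
    simp only [Finset.mem_map, Finset.mem_filter, Finset.mem_univ, true_and, Fin.valEmbedding_apply,
      Finset.mem_range]
    constructor
    · rintro ⟨v', h, rfl⟩; exact ⟨v'.2, h⟩
    · rintro ⟨hv, h⟩
      exact ⟨⟨v, hv⟩, h, rfl⟩
  rw [h1, h2] at h
  rw [← h]
  congr 2
  ext y
  simp only [Finset.mem_filter, Finset.mem_univ, true_and]
  constructor
  · intro h l hl
    have := h l hl
    rwa [tapeFn_of_lt y l.2] at this
  · intro h l hl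
    have hlN : l < N := by simpa using hA hl
    rw [tapeFn_of_lt y hlN]
    exact h ⟨l, hlN⟩ hl

/-- Bernoulli's inequality: the first two terms of the binomial expansion. -/
theorem pow_add_mul_le (b R k : ℕ) :
    b ^ (k + 1) + (k + 1) * R * b ^ k ≤ (b + R) ^ (k + 1) := by
  induction k with
  | zero => simp
  | succ k ih =>
    calc b ^ (k + 1 + 1) + (k + 1 + 1) * R * b ^ (k + 1)
        ≤ (b ^ (k + 1) + (k + 1) * R * b ^ k) * (b + R) := by
          have : 0 ≤ (k + 1) * R * b ^ k * R := Nat.zero_le _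
          calc _ ≤ b ^ (k + 1 + 1) + (k + 1 + 1) * R * b ^ (k + 1) +
                (k + 1) * R * b ^ k * R := Nat.le_add_right _ _
            _ = _ := by ring
      _ ≤ (b + R) ^ (k + 1) * (b + R) := Nat.mul_le_mul_right _ ih
      _ = (b + R) ^ (k + 1 + 1) := by ring

/-- In other words `(1 - R / n) ^ σ ≤ 1 / 2` if `σ * R ≥ n`: the second Bernoulli term `σ * R * b ^
(σ - 1)` is already at least `b ^ σ`. -/
theorem pow_mul_two_le {b R n σ : ℕ} (hσ : 0 < σ) (hb : b + R ≤ n) (hR : n ≤ σ * R) :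
    b ^ σ * 2 ≤ n ^ σ := by
  obtain ⟨k, rfl⟩ : ∃ k, σ = k + 1 := ⟨σ - 1, by omega⟩
  calc b ^ (k + 1) * 2 = b ^ (k + 1) + b * b ^ k := by ring
    _ ≤ b ^ (k + 1) + (k + 1) * R * b ^ k := by
        gcongr
        omega
    _ ≤ (b + R) ^ (k + 1) := pow_add_mul_le b R k
    _ ≤ n ^ (k + 1) := Nat.pow_le_pow_left hb _

/-! ### Failure probabilities of the two uses of the tape -/

section
variable {n N L K E B : ℕ} {rk : ℕ → ℕ → ℕ}

/-- The tape contains, for every `j`, one of the `n / σ + 1` points closest to `j`. -/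
def HitsTops (n E : ℕ) (rk : ℕ → ℕ → ℕ) (y : ℕ → ℕ) (σ : ℕ) : Prop :=
  ∀ j < n, ∀ i < n, n / σ + 1 ≤ rk j i → ∃ l < σ * E, rk j (y l) < rk j i

theorem card_rank_ge (hR : Ranking n rk) {j R : ℕ} (hj : j < n) :
    ((Finset.range n).filter fun v => R ≤ rk j v).card ≤ n - R := by
  rw [← Nat.card_Ico]
  apply Finset.card_le_card_of_injOn (rk j)
  · intro v hv
    simp only [Finset.coe_filter, Finset.mem_range, Set.mem_ofPred_eq] at hv
    simpa using ⟨hv.2, hR.lt j hj v hv.1⟩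
  · intro v hv v' hv' h
    simp only [Finset.coe_filter, Finset.mem_range, Set.mem_ofPred_eq] at hv hv'
    exact hR.inj j hj v hv.1 v' hv'.1 h

/-- Each group of `σ` entries misses the `n / σ + 1` points nearest to `j` with probability at most
`1/2`, and there are `E` groups. -/
theorem card_missing_top (hR : Ranking n rk) {j σ : ℕ} (hj : j < n) (hσ : 0 < σ)
    (hN : σ * E ≤ N) :
    (Finset.univ.filter fun y : Fin N → Fin n =>
      ∀ l ∈ Finset.range (σ * E), n / σ + 1 ≤ rk j (tapeFn y l)).card * 2 ^ E ≤ n ^ N := by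
  have hn : 0 < n := by omega
  rcases Nat.eq_zero_or_pos E with rfl | hE
  · simp only [pow_zero, mul_one]
    refine (Finset.card_filter_le _ _).trans ?_
    simp
  have h := card_tapes_mul (N := N) (n := n) (Finset.range (σ * E)) (Finset.range_mono hN)
    (Finset.card_range _) (fun v => n / σ + 1 ≤ rk j v)
  have hS := card_rank_ge hR hj (R := n / σ + 1)
  set b := ((Finset.range n).filter fun v => n / σ + 1 ≤ rk j v).card
  have hb : b ^ σ * 2 ≤ n ^ σ := by
    rcases Nat.eq_zero_or_pos b with h0 | h0
    · rw [h0, zero_pow hσ.ne']; simp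
    · refine pow_mul_two_le (R := n / σ + 1) hσ (by omega) ?_
      have h1 := Nat.div_add_mod n σ
      have h2 := Nat.mod_lt n hσ
      rw [mul_add, mul_one]
      omega
  have hpow : b ^ (σ * E) * 2 ^ E ≤ n ^ (σ * E) := by
    rw [pow_mul, pow_mul, ← mul_pow]
    exact Nat.pow_le_pow_left hb _
  apply Nat.le_of_mul_le_mul_right (c := n ^ (σ * E)) _ (by positivity)
  calc _ = _ * n ^ (σ * E) * 2 ^ E := by ring
    _ = b ^ (σ * E) * n ^ N * 2 ^ E := by rw [h]
    _ = b ^ (σ * E) * 2 ^ E * n ^ N := by ring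
    _ ≤ n ^ (σ * E) * n ^ N := Nat.mul_le_mul_right _ hpow
    _ = _ := by ring

/-- At most `1/16` of `C` lies outside `C'`. Reducing a uniform number below `n` modulo `C.card` is
not uniform, but no residue gets more than twice its fair share, whence `1/8`. -/
theorem card_bad_residues {C C' : Finset ℕ} (hC : C ⊆ Finset.range n) (hCC : C' ⊆ C)
    (hcard : 15 * C.card < 16 * C'.card) :
    8 * ((Finset.range n).filter fun v => nthOf C (v % C.card) ∉ C').card ≤ n := by
  set u := C.card with hu
  have hun : u ≤ n := by simpa using Finset.card_le_card hC
  have hu0 : 0 < u := by have := Finset.card_le_card hCC; omega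
  set P := (Finset.range u).filter fun p => nthOf C p ∉ C'
  have hP : 16 * P.card ≤ u := by
    have h1 : P.card ≤ (C \ C').card := by
      apply Finset.card_le_card_of_injOn (nthOf C)
      · intro p hp
        simp only [P, Finset.coe_filter, Finset.mem_range, Set.mem_ofPred_eq] at hp
        simpa using ⟨nthOf_mem hp.1, hp.2⟩
      · intro p hp q hq h
        simp only [P, Finset.coe_filter, Finset.mem_range, Set.mem_ofPred_eq] at hp hq
        exact nthOf_injOn hp.1 hq.1 h
    have h2 := Finset.card_sdiff_add_card_eq_card hCC
    omega
  -- Quotient and remainder determine `v`, so every residue is taken at most `n / u + 1` times.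
  have hS : ((Finset.range n).filter fun v => nthOf C (v % u) ∉ C').card ≤
      P.card * (n / u + 1) := by
    rw [← Finset.card_range (n / u + 1), ← Finset.card_product]
    apply Finset.card_le_card_of_injOn fun v => (v % u, v / u)
    · intro v hv
      simp only [Finset.coe_filter, Finset.mem_range, Set.mem_ofPred_eq] at hv
      simp only [P, Finset.coe_product, Set.mem_prod, Finset.mem_coe, Finset.mem_filter,
        Finset.mem_range]
      exact ⟨⟨Nat.mod_lt _ hu0, hv.2⟩, Nat.lt_succ_of_le (Nat.div_le_div_right hv.1.le)⟩
    · intro v _ v' _ h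
      simp only [Prod.mk.injEq] at h
      rw [← Nat.div_add_mod v u, ← Nat.div_add_mod v' u, h.1, h.2]
  have h3 : 16 * (P.card * (n / u + 1)) ≤ 2 * n := by
    calc _ = 16 * P.card * (n / u + 1) := by ring
      _ ≤ u * (n / u + 1) := Nat.mul_le_mul_right _ hP
      _ = u * (n / u) + u := by ring
      _ ≤ 2 * n := by have := Nat.mul_div_le n u; omega
  omega

/-- If at most `m` of `2 * m` samples fall into `C'`, then some `m` places all miss it. There are at
most `4 ^ m` choices of places, each with probability at most `8 ^ (-m)`, which leaves `2 ^ (-m)`.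
-/
theorem card_unrepresentative {C C' : Finset ℕ} (hC : C ⊆ Finset.range n) (hCC : C' ⊆ C)
    (hcard : 15 * C.card < 16 * C'.card) {m : ℕ} (hm : 2 * m ≤ N) :
    (Finset.univ.filter fun y : Fin N → Fin n => hits (2 * m) C (tapeFn y) (· ∈ C') ≤ m).card *
      2 ^ m ≤ n ^ N := by
  have hC0 : 0 < C.card := by have := Finset.card_le_card hCC; omega
  have hn : 0 < n := by have := Finset.card_le_card hC; simp at this; omega
  set S := (Finset.range n).filter fun v => nthOf C (v % C.card) ∉ C' with hS
  have hS8 : 8 * S.card ≤ n := card_bad_residues hC hCC hcard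
  set F : Finset ℕ → Finset (Fin N → Fin n) := fun A =>
    Finset.univ.filter fun y => ∀ l ∈ A, nthOf C (tapeFn y l % C.card) ∉ C' with hF
  have hsub : (Finset.univ.filter fun y : Fin N → Fin n =>
      hits (2 * m) C (tapeFn y) (· ∈ C') ≤ m) ⊆
      ((Finset.range (2 * m)).powersetCard m).biUnion F := by
    intro y hy
    simp only [Finset.mem_filter, Finset.mem_univ, true_and] at hy
    have h1 := Finset.card_filter_add_card_filter_not (s := Finset.range (2 * m))
      (fun l => sampled C (tapeFn y) l ∈ C')
    rw [Finset.card_range] at h1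
    replace hy : ((Finset.range (2 * m)).filter fun l => sampled C (tapeFn y) l ∈ C').card ≤ m := hy
    obtain ⟨A, hA, hAm⟩ := Finset.exists_subset_card_eq
      (s := (Finset.range (2 * m)).filter fun l => ¬ sampled C (tapeFn y) l ∈ C') (n := m) (by omega)
    simp only [Finset.mem_biUnion, Finset.mem_powersetCard, hF, Finset.mem_filter, Finset.mem_univ,
      true_and]
    exact ⟨A, ⟨hA.trans (Finset.filter_subset _ _), hAm⟩, fun l hl =>
      (Finset.mem_filter.1 (hA hl)).2⟩
  have hFc : ∀ A ∈ (Finset.range (2 * m)).powersetCard m, (F A).card * 8 ^ m ≤ n ^ N := by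
    intro A hA
    rw [Finset.mem_powersetCard] at hA
    have h := card_tapes_mul (N := N) (n := n) A (hA.1.trans (Finset.range_mono hm)) hA.2
      (fun v => nthOf C (v % C.card) ∉ C')
    apply Nat.le_of_mul_le_mul_right (c := n ^ m) _ (by positivity)
    calc (F A).card * 8 ^ m * n ^ m = (F A).card * n ^ m * 8 ^ m := by ring
      _ = S.card ^ m * n ^ N * 8 ^ m := by rw [h]
      _ = (8 * S.card) ^ m * n ^ N := by rw [mul_pow]; ring
      _ ≤ n ^ m * n ^ N := Nat.mul_le_mul_right _ (Nat.pow_le_pow_left hS8 _)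
      _ = n ^ N * n ^ m := by ring
  have hun := card_biUnion_mul_le _ F (8 ^ m) (n ^ N) hFc
  have hps : ((Finset.range (2 * m)).powersetCard m).card ≤ 4 ^ m := by
    rw [Finset.card_powersetCard, Finset.card_range]
    calc _ ≤ 2 ^ (2 * m) := Nat.choose_le_two_pow _ _
      _ = 4 ^ m := by rw [pow_mul]; norm_num
  apply Nat.le_of_mul_le_mul_right (c := 4 ^ m) _ (by positivity)
  calc _ = (Finset.univ.filter fun y : Fin N → Fin n =>
        hits (2 * m) C (tapeFn y) (· ∈ C') ≤ m).card * 8 ^ m := by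
        rw [show (8 : ℕ) = 2 * 4 by norm_num, mul_pow]; ring
    _ ≤ _ := Nat.mul_le_mul_right _ (Finset.card_le_card hsub)
    _ ≤ _ := hun
    _ ≤ 4 ^ m * n ^ N := Nat.mul_le_mul_right _ hps
    _ = _ := by ring

/-- The point `i` covers nothing in its own instance, so it can serve as padding. -/
theorem residue_eq_empty_or {i : ℕ} {C P : Finset ℕ} :
    residue rk i C (insert i P) = residue rk i C P := by
  rw [residue_insert, Finset.filter_true_of_mem]
  intro j _
  exact lt_irrefl _

/-- Enumerates the sets of size at most `q` by functions on `Fin (q + 1)`, which gives the bound `n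
^ (q + 1)` for the union bound. Unused places, at least one, hold the harmless point `i`. -/
theorem exists_image_eq_insert {i q : ℕ} (hi : i < n) {D : Finset ℕ} (hD : D ⊆ Finset.range n)
    (hDq : D.card ≤ q) :
    ∃ f : Fin (q + 1) → Fin n, Finset.univ.image (fun l => (f l : ℕ)) = insert i D := by
  have hmem : ∀ l, D.toList.getD l i ∈ insert i D := by
    intro l
    rcases lt_or_ge l D.toList.length with h | h
    · rw [List.getD_eq_getElem _ _ h]
      exact Finset.mem_insert_of_mem (Finset.mem_toList.1 (List.getElem_mem h))
    · rw [List.getD_eq_default _ _ h]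
      exact Finset.mem_insert_self _ _
  have hlt : ∀ l, D.toList.getD l i < n := by
    intro l
    rcases Finset.mem_insert.1 (hmem l) with h | h
    · omega
    · simpa using hD h
  refine ⟨fun l => ⟨D.toList.getD l i, hlt l⟩, ?_⟩
  ext x
  simp only [Finset.mem_image, Finset.mem_univ, true_and]
  constructor
  · rintro ⟨l, rfl⟩; exact hmem l
  · intro hx
    rcases Finset.mem_insert.1 hx with rfl | hx
    · refine ⟨⟨D.card, by omega⟩, ?_⟩
      rw [List.getD_eq_default]
      simp
    · obtain ⟨l, hl, rfl⟩ := List.getElem_of_mem (Finset.mem_toList.2 hx)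
      have hlD : l < D.card := by simpa using hl
      refine ⟨⟨l, by omega⟩, ?_⟩
      simp only [List.getD_eq_getElem _ _ hl]

/-- The event that the tape works for all guesses. -/
def GoodTape (n L K E B : ℕ) (rk : ℕ → ℕ → ℕ) (y : ℕ → ℕ) : Prop :=
  ∀ t < L + 1, HitsTops n E rk y (2 ^ t) ∧ ∀ i < n, GoodSamples n K B rk y i (2 ^ t)

open Classical in
-- A union bound over the `n ^ (2 * (q + 1))` pairs of padded sets, with `q = K * (2 * σ)`. Pairs
-- that cannot violate representativeness get the empty event, so the estimate for one pair applies
-- to all.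
theorem card_not_goodSamples {i σ H : ℕ} (hi : i < n) (hN : σ * (2 * H) ≤ N) :
    (Finset.univ.filter fun y : Fin N → Fin n =>
      ¬ GoodSamples n K (2 * H) rk (tapeFn y) i σ).card * 2 ^ (σ * H) ≤
      n ^ (2 * (K * (2 * σ) + 1)) * n ^ N := by
  set q := K * (2 * σ) with hq
  set C := rareElements n rk i (n / σ + 1)
  let im : (Fin (q + 1) → Fin n) → Finset ℕ := fun f => Finset.univ.image fun l => (f l : ℕ)
  let F : (Fin (q + 1) → Fin n) × (Fin (q + 1) → Fin n) → Finset (Fin N → Fin n) := fun fg =>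
    if residue rk i C (im fg.2) ⊆ residue rk i C (im fg.1) ∧
        15 * (residue rk i C (im fg.1)).card < 16 * (residue rk i C (im fg.2)).card then
      Finset.univ.filter fun y => hits (2 * (σ * H)) (residue rk i C (im fg.1)) (tapeFn y)
        (· ∈ residue rk i C (im fg.2)) ≤ σ * H
    else ∅
  have hsub : (Finset.univ.filter fun y : Fin N → Fin n =>
      ¬ GoodSamples n K (2 * H) rk (tapeFn y) i σ) ⊆ Finset.univ.biUnion F := by
    intro y hy
    replace hy := (Finset.mem_filter.1 hy).2
    rw [GoodSamples, Representative] at hy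
    push Not at hy
    obtain ⟨D, D', hD, hD', hDD, hDq, hDq', hpos, hhits, hlt⟩ := hy
    obtain ⟨f, hf⟩ := exists_image_eq_insert hi hD hDq
    obtain ⟨g, hg⟩ := exists_image_eq_insert hi hD' hDq'
    have h1 : residue rk i C (im f) = residue rk i C D := by
      show residue rk i C (Finset.univ.image fun l => (f l : ℕ)) = _
      rw [hf, residue_eq_empty_or]
    have h2 : residue rk i C (im g) = residue rk i C D' := by
      show residue rk i C (Finset.univ.image fun l => (g l : ℕ)) = _
      rw [hg, residue_eq_empty_or]
    simp only [Finset.mem_biUnion, Finset.mem_univ, true_and]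
    refine ⟨(f, g), ?_⟩
    simp only [F, h1, h2]
    have hss : residue rk i C D' ⊆ residue rk i C D := by
      intro j hj
      simp only [residue, Finset.mem_filter] at hj ⊢
      exact ⟨hj.1, fun k hk => hj.2 k (hDD hk)⟩
    rw [if_pos ⟨hss, hlt⟩]
    simp only [Finset.mem_filter, Finset.mem_univ, true_and]
    rw [show 2 * (σ * H) = σ * (2 * H) by ring]
    have : σ * (2 * H) = 2 * (σ * H) := by ring
    change 2 * hits (σ * (2 * H)) (residue rk i C D) (tapeFn y) (· ∈ residue rk i C D') ≤ _
      at hhits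
    convert (show hits (σ * (2 * H)) (residue rk i C D) (tapeFn y) (· ∈ residue rk i C D') ≤ σ * H
      by omega) using 1
  have hFc : ∀ fg ∈ (Finset.univ : Finset ((Fin (q + 1) → Fin n) × (Fin (q + 1) → Fin n))),
      (F fg).card * 2 ^ (σ * H) ≤ n ^ N := by
    intro fg _
    simp only [F]
    split_ifs with h
    · refine card_unrepresentative ?_ h.1 h.2 ?_
      · exact residue_subset.trans (Finset.filter_subset _ _)
      · calc 2 * (σ * H) = σ * (2 * H) := by ring
          _ ≤ N := hN
    · simp
  have := card_biUnion_mul_le _ F _ _ hFc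
  rw [Finset.card_univ, Fintype.card_prod, Fintype.card_fun, Fintype.card_fin, Fintype.card_fin,
    ← pow_add, ← two_mul] at this
  exact (Nat.mul_le_mul_right _ (Finset.card_le_card hsub)).trans this

open Classical in
-- With `X = 2 ^ L`, for every guess each of the two kinds of failure has probability at most `1 / X
-- ^ (a + 2)`. The `2 * (L + 1)` such events cost a factor of at most `X ^ 2`.
theorem card_not_goodTape (hR : Ranking n rk) {a : ℕ} (hnL : n < 2 ^ L) (hL : 2 ≤ L)
    (hN : N = 2 ^ L * (2 * halfSamples a L)) :
    (Finset.univ.filter fun y : Fin N → Fin n =>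
      ¬ GoodTape n L (11 * L) ((a + 3) * L) (2 * halfSamples a L) rk (tapeFn y)).card * n ^ a ≤
      n ^ N := by
  obtain ⟨X, hX⟩ : ∃ X, X = 2 ^ L := ⟨_, rfl⟩
  obtain ⟨H, hH⟩ : ∃ H, H = halfSamples a L := ⟨_, rfl⟩
  obtain ⟨E, hE⟩ : ∃ E, E = (a + 3) * L := ⟨_, rfl⟩
  rw [← hX] at hnL hN
  rw [← hH] at hN ⊢
  rw [← hE]
  have hX4 : 4 ≤ X := by
    calc 4 = 2 ^ 2 := by norm_num
      _ ≤ X := hX ▸ Nat.pow_le_pow_right (by norm_num) hL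
  have hLX : L < X := hX ▸ Nat.lt_two_pow_self
  have hEH : E ≤ 2 * H := by
    have : E ≤ H := by
      rw [hE, hH]
      exact Nat.mul_le_mul_right _ (by omega)
    omega
  have h2E : 2 ^ E = X ^ (a + 3) := by rw [hX, ← pow_mul, hE, mul_comm L]
  let F₁ : ℕ → Finset (Fin N → Fin n) := fun t => (Finset.range n).biUnion fun j =>
    Finset.univ.filter fun y =>
      ∀ l ∈ Finset.range (2 ^ t * E), n / 2 ^ t + 1 ≤ rk j (tapeFn y l)
  let F₂ : ℕ → Finset (Fin N → Fin n) := fun t => (Finset.range n).biUnion fun i =>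
    Finset.univ.filter fun y => ¬ GoodSamples n (11 * L) (2 * H) rk (tapeFn y) i (2 ^ t)
  have hsub : (Finset.univ.filter fun y : Fin N → Fin n =>
      ¬ GoodTape n L (11 * L) E (2 * H) rk (tapeFn y)) ⊆
      (Finset.range (L + 1)).biUnion fun t => F₁ t ∪ F₂ t := by
    intro y hy
    replace hy := (Finset.mem_filter.1 hy).2
    rw [GoodTape] at hy
    push Not at hy
    obtain ⟨t, ht, h⟩ := hy
    simp only [Finset.mem_biUnion, Finset.mem_range, Finset.mem_union, F₁, F₂, Finset.mem_filter,
      Finset.mem_univ, true_and]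
    refine ⟨t, ht, ?_⟩
    by_cases h1 : HitsTops n E rk (tapeFn y) (2 ^ t)
    · exact .inr (h h1)
    · left
      simp only [HitsTops] at h1
      push Not at h1
      obtain ⟨j, hj, i, hi, hle, hall⟩ := h1
      -- Weakening `rk j i` to the threshold makes the event independent of `i`, so the union runs
      -- over `j` only.
      exact ⟨j, hj, fun l hl => hle.trans (hall l hl)⟩
  have hF₁ : ∀ t ∈ Finset.range (L + 1), (F₁ t).card * X ^ (a + 2) ≤ n ^ N := by
    intro t ht
    have hσX : 2 ^ t ≤ X := hX ▸ Nat.pow_le_pow_right (by norm_num) (by simpa [Nat.lt_succ_iff] using ht)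
    have hσ0 : 0 < 2 ^ t := Nat.one_le_two_pow
    generalize hσ : 2 ^ t = σ at hσX hσ0
    have hσN : σ * E ≤ N := by rw [hN]; exact Nat.mul_le_mul hσX hEH
    have := card_biUnion_mul_le (Finset.range n) (fun j =>
      Finset.univ.filter fun y : Fin N → Fin n =>
        ∀ l ∈ Finset.range (σ * E), n / σ + 1 ≤ rk j (tapeFn y l)) (2 ^ E) (n ^ N)
      fun j hj => card_missing_top hR (Finset.mem_range.1 hj) hσ0 hσN
    rw [Finset.card_range, h2E] at this
    have hF1 : F₁ t = (Finset.range n).biUnion (fun j =>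
      Finset.univ.filter fun y : Fin N → Fin n =>
        ∀ l ∈ Finset.range (σ * E), n / σ + 1 ≤ rk j (tapeFn y l)) := by
      simp only [F₁, hσ]
    apply Nat.le_of_mul_le_mul_right (c := X) _ (by omega)
    calc (F₁ t).card * X ^ (a + 2) * X = (F₁ t).card * X ^ (a + 3) := by ring
      _ ≤ n * n ^ N := by rw [hF1]; exact this
      _ ≤ n ^ N * X := by rw [mul_comm]; exact Nat.mul_le_mul_left _ hnL.le
  have hF₂ : ∀ t ∈ Finset.range (L + 1), (F₂ t).card * X ^ (a + 2) ≤ n ^ N := by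
    intro t ht
    have hσX : 2 ^ t ≤ X := hX ▸ Nat.pow_le_pow_right (by norm_num) (by simpa [Nat.lt_succ_iff] using ht)
    have hσ0 : 1 ≤ 2 ^ t := Nat.one_le_two_pow
    generalize hσ : 2 ^ t = σ at hσX hσ0
    have hσN : σ * (2 * H) ≤ N := by rw [hN]; exact Nat.mul_le_mul_right _ hσX
    have := card_biUnion_mul_le (Finset.range n) (fun i =>
      Finset.univ.filter fun y : Fin N → Fin n =>
        ¬ GoodSamples n (11 * L) (2 * H) rk (tapeFn y) i σ) (2 ^ (σ * H))
      (n ^ (2 * (11 * L * (2 * σ) + 1)) * n ^ N)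
      fun i hi => card_not_goodSamples (Finset.mem_range.1 hi) hσN
    rw [Finset.card_range] at this
    -- The origin of `halfSamples`: the pairs for `K = 11 * L` and the `n` instances amount to `n ^
    -- (44 * L * σ + 3)` events, and the further exponent `a + 2` is the failure probability that is
    -- left.
    have hexp : L * (44 * L * σ + (a + 5)) ≤ σ * H := by
      rw [hH, halfSamples]
      calc L * (44 * L * σ + (a + 5)) ≤ L * (44 * L * σ + σ * (a + 5)) := by
            gcongr
            exact Nat.le_mul_of_pos_left _ hσ0
        _ = σ * ((4 * (11 * L) + (a + 5)) * L) := by ring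
    have h2H : X ^ (44 * L * σ + (a + 5)) ≤ 2 ^ (σ * H) := by
      rw [hX, ← pow_mul]
      exact Nat.pow_le_pow_right (by norm_num) hexp
    have hF2 : F₂ t = (Finset.range n).biUnion (fun i =>
      Finset.univ.filter fun y : Fin N → Fin n =>
        ¬ GoodSamples n (11 * L) (2 * H) rk (tapeFn y) i σ) := by
      simp only [F₂, hσ]
    apply Nat.le_of_mul_le_mul_right (c := X ^ (44 * L * σ + 3)) _ (by positivity)
    calc (F₂ t).card * X ^ (a + 2) * X ^ (44 * L * σ + 3)
        = (F₂ t).card * X ^ (44 * L * σ + (a + 5)) := by ring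
      _ ≤ (F₂ t).card * 2 ^ (σ * H) := Nat.mul_le_mul_left _ h2H
      _ ≤ n * (n ^ (2 * (11 * L * (2 * σ) + 1)) * n ^ N) := by rw [hF2]; exact this
      _ = n ^ N * n ^ (44 * L * σ + 3) := by ring
      _ ≤ n ^ N * X ^ (44 * L * σ + 3) :=
        Nat.mul_le_mul_left _ (Nat.pow_le_pow_left hnL.le _)
  have htot := card_biUnion_mul_le (Finset.range (L + 1)) (fun t => F₁ t ∪ F₂ t) (X ^ (a + 2))
    (2 * n ^ N) fun t ht => by
      have := Finset.card_union_le (F₁ t) (F₂ t)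
      have h1 := hF₁ t ht
      have h2 := hF₂ t ht
      calc _ ≤ ((F₁ t).card + (F₂ t).card) * X ^ (a + 2) := Nat.mul_le_mul_right _ this
        _ = (F₁ t).card * X ^ (a + 2) + (F₂ t).card * X ^ (a + 2) := by ring
        _ ≤ 2 * n ^ N := by omega
  rw [Finset.card_range] at htot
  have hbad := Finset.card_le_card hsub
  apply Nat.le_of_mul_le_mul_right (c := X * X) _ (by positivity)
  calc _ = (Finset.univ.filter fun y : Fin N → Fin n =>
        ¬ GoodTape n L (11 * L) E (2 * H) rk (tapeFn y)).card * (n ^ a * (X * X)) := by ring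
    _ ≤ (Finset.univ.filter fun y : Fin N → Fin n =>
        ¬ GoodTape n L (11 * L) E (2 * H) rk (tapeFn y)).card * (X ^ a * (X * X)) :=
      Nat.mul_le_mul_left _ (Nat.mul_le_mul_right _ (Nat.pow_le_pow_left hnL.le _))
    _ = (Finset.univ.filter fun y : Fin N → Fin n =>
        ¬ GoodTape n L (11 * L) E (2 * H) rk (tapeFn y)).card * X ^ (a + 2) := by ring
    _ ≤ _ := Nat.mul_le_mul_right _ hbad
    _ ≤ (L + 1) * (2 * n ^ N) := htot
    _ = n ^ N * ((L + 1) * 2) := by ring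
    _ ≤ n ^ N * (X * X) := Nat.mul_le_mul_left _ (Nat.mul_le_mul (by omega) (by omega))

end

/-! ### The output graph for a good tape -/

section
variable {n L K E B σ i : ℕ} {rk : ℕ → ℕ → ℕ} {y : ℕ → ℕ} {d : Fin n → Fin n → ℝ}

/-- The two parts of the row complement each other: rare elements are covered by `D`, the others by
the points from the tape. -/
theorem SolvedAt.exists_lt {out : ℕ → ℕ} (hR : Ranking n rk) (h : SolvedAt n K E rk y out i σ)
    (hi : i < n) (hT : HitsTops n E rk y σ) (hy : ∀ l < σ * E, y l < n) {j : ℕ} (hj : j < n)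
    (hji : j ≠ i) : ∃ k < n, out (i * n + k) ≠ 0 ∧ rk j k < rk j i := by
  obtain ⟨D, hD, -, hout, hres⟩ := h
  have hpos : 0 < rk j i := by
    rw [pos_iff_ne_zero, ← hR.self j hj]
    exact fun h => hji (hR.inj j hj i hi j hj h).symm
  rcases lt_or_ge (rk j i) (n / σ + 1) with hlt | hge
  · have hmem : j ∉ residue rk i (rareElements n rk i (n / σ + 1)) D := by simp [hres]
    simp only [residue, rareElements, Finset.mem_filter, Finset.mem_range, hj, hpos, hlt,
      true_and, not_forall, not_not, exists_prop] at hmem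
    obtain ⟨k, hk, hlt⟩ := hmem
    have hkn : k < n := by simpa using hD hk
    exact ⟨k, hkn, (hout k hkn).2 (.inr hk), hlt⟩
  · obtain ⟨l, hl, hlt⟩ := hT j hj i hi hge
    exact ⟨y l, hy l hl, (hout _ (hy l hl)).2 (.inl ⟨l, hl, rfl⟩), hlt⟩

theorem SolvedAt.card_le {out : ℕ → ℕ} (h : SolvedAt n K E rk y out i σ) :
    ((Finset.range n).filter fun k => out (i * n + k) ≠ 0).card ≤ σ * (E + 2 * K) := by
  obtain ⟨D, -, hDc, hout, -⟩ := h
  have hsub : ((Finset.range n).filter fun k => out (i * n + k) ≠ 0) ⊆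
      (Finset.range (σ * E)).image y ∪ D := by
    intro k hk
    obtain ⟨hk, hne⟩ := Finset.mem_filter.1 hk
    simpa using (hout k (by simpa using hk)).1 hne
  calc _ ≤ ((Finset.range (σ * E)).image y).card + D.card :=
        (Finset.card_le_card hsub).trans (Finset.card_union_le _ _)
    _ ≤ σ * E + K * (2 * σ) := add_le_add (Finset.card_image_le.trans_eq (Finset.card_range _)) hDc
    _ = σ * (E + 2 * K) := by ring

theorem HasCover.mono {σ' : ℕ} (h : HasCover n rk i σ) (hσ : σ ≤ σ') : HasCover n rk i σ' := by
  obtain ⟨A, hA, hc, hcov⟩ := h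
  exact ⟨A, hA, hc.trans hσ, hcov⟩

/-- The least power of two that is at least `m` is at most `2 * m`. On good samples this guess
succeeds unless a smaller one already has. -/
theorem Status.exists_solvedAt {s : Mem} (h : Status n K E B rk y (L + 1) i s)
    (hG : ∀ t < L + 1, GoodSamples n K B rk y i (2 ^ t)) {m : ℕ} (hm : 0 < m) (hmL : m ≤ 2 ^ L)
    (hc : HasCover n rk i m) :
    ∃ t < L + 1, 2 ^ t ≤ 2 * m ∧ SolvedAt n K E rk y (s.words 0) i (2 ^ t) := by
  have hex : ∃ t, m ≤ 2 ^ t := ⟨L, hmL⟩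
  have hle := Nat.find_spec hex
  have htL : Nat.find hex ≤ L := Nat.find_min' hex hmL
  have h2m : 2 ^ Nat.find hex ≤ 2 * m := by
    rcases Nat.eq_zero_or_eq_succ_pred (Nat.find hex) with h0 | h0
    · rw [h0]; omega
    · have := Nat.find_min hex (show (Nat.find hex).pred < Nat.find hex by omega)
      rw [h0, pow_succ]
      omega
  have hyes := hc.mono hle
  rcases h with ⟨-, h⟩ | ⟨-, t, ht, hsol, h⟩
  · exact absurd hyes (h _ (by omega) (hG _ (by omega)))
  · refine ⟨t, ht, le_trans (Nat.pow_le_pow_right (by norm_num) ?_) h2m, hsol⟩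
    by_contra! hlt
    exact h _ hlt (hG _ (by omega)) hyes

/-- The lower bound for any competitor: each of its out-neighborhoods covers the corresponding
instance. Symmetry of `d` passes from distances to `j` to distances from `j`. -/
theorem Navigable.hasCover (hd : IsDistance d) {H : Digraph (Fin n)} (hH : Navigable d H)
    (i : Fin n) : HasCover n (distRank d) i ({j | H.Adj i j} : Set (Fin n)).ncard := by
  classical
  refine ⟨(Finset.univ.filter (H.Adj i)).image Fin.val, ?_, ?_, fun j hj hji => ?_⟩
  · intro x hx
    obtain ⟨k, -, rfl⟩ := Finset.mem_image.1 hx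
    simp
  · refine Finset.card_image_le.trans ?_
    rw [← Set.ncard_coe_finset]
    simp
  · obtain ⟨k, hk, hlt⟩ := hH i ⟨j, hj⟩ (by simpa [Fin.ext_iff] using hji.symm)
    refine ⟨k, Finset.mem_image_of_mem _ (by simpa using hk), ?_⟩
    rw [distRank_lt_iff k.2]
    simpa [oracle, hj, hd.symm ⟨j, hj⟩] using hlt

theorem Navigable.ncard_pos {H : Digraph (Fin n)} (hH : Navigable d H) (hn : 2 ≤ n) (i : Fin n) :
    0 < ({j | H.Adj i j} : Set (Fin n)).ncard := by
  have : Nontrivial (Fin n) := Fin.nontrivial_iff_two_le.2 hn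
  obtain ⟨j, hj⟩ := exists_ne i
  obtain ⟨k, hk, -⟩ := hH i j hj.symm
  exact (Set.ncard_pos).2 ⟨k, hk⟩

theorem navigable_top (hd : IsDistance d) : Navigable d ⊤ := by
  intro i j hij
  refine ⟨j, ?_, by rw [hd.self]; exact hd.pos i j hij⟩
  simp

theorem exists_solvedAt_of_navigable (hd : IsDistance d) (hn : 2 ≤ n) (hnL : n < 2 ^ L) {s : Mem}
    (hG : GoodTape n L K E B (distRank d) y)
    (hs : ∀ i < n, Status n K E B (distRank d) y (L + 1) i s) {H : Digraph (Fin n)}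
    (hH : Navigable d H) (i : Fin n) :
    ∃ t < L + 1, 2 ^ t ≤ 2 * ({j | H.Adj i j} : Set (Fin n)).ncard ∧
      SolvedAt n K E (distRank d) y (s.words 0) i (2 ^ t) := by
  refine (hs i i.2).exists_solvedAt (fun t ht => (hG t ht).2 i i.2) (hH.ncard_pos hn i) ?_
    (hH.hasCover hd i)
  have := Set.ncard_le_card ({j | H.Adj i j} : Set (Fin n))
  rw [Nat.card_eq_fintype_card, Fintype.card_fin] at this
  omega

theorem navigable_outputGraph (hd : IsDistance d) (hgen : GeneralPosition d) (hn : 2 ≤ n)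
    (hnL : n < 2 ^ L) (hG : GoodTape n L K E B (distRank d) y) (hy : ∀ l < 2 ^ L * E, y l < n)
    {s : Mem} (hs : ∀ i < n, Status n K E B (distRank d) y (L + 1) i s) :
    Navigable d (outputGraph n (s.cfg [])) := by
  intro i j hij
  -- The complete graph only serves to show that some guess has succeeded.
  obtain ⟨t, ht, -, hsol⟩ := exists_solvedAt_of_navigable hd hn hnL hG hs (navigable_top hd) i
  have ht' : 2 ^ t * E ≤ 2 ^ L * E :=
    Nat.mul_le_mul_right _ (Nat.pow_le_pow_right (by norm_num) (by omega))
  obtain ⟨k, hk, hadj, hlt⟩ := hsol.exists_lt (ranking_distRank hd hgen) i.2 (hG t ht).1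
    (fun l hl => hy l (hl.trans_le ht')) j.2 (by simpa [Fin.ext_iff] using hij.symm)
  refine ⟨⟨k, hk⟩, hadj, ?_⟩
  rw [distRank_lt_iff hk] at hlt
  simpa [oracle, hk, hd.symm j] using hlt

/-- The comparison holds vertex by vertex, with a guess of at most twice the degree in `H` and `E +
2 * K` output points per unit of the guess. -/
theorem avgOutDegree_outputGraph_le (hd : IsDistance d) (hn : 2 ≤ n) (hnL : n < 2 ^ L)
    (hG : GoodTape n L K E B (distRank d) y) {s : Mem}
    (hs : ∀ i < n, Status n K E B (distRank d) y (L + 1) i s) {H : Digraph (Fin n)}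
    (hH : Navigable d H) :
    avgOutDegree (outputGraph n (s.cfg [])) ≤ 2 * (E + 2 * K) * avgOutDegree H := by
  have key : ∀ i : Fin n, (({j | (outputGraph n (s.cfg [])).Adj i j} : Set (Fin n)).ncard : ℝ) ≤
      2 * (E + 2 * K) * (({j | H.Adj i j} : Set (Fin n)).ncard : ℝ) := by
    intro i
    obtain ⟨t, -, hle, hsol⟩ := exists_solvedAt_of_navigable hd hn hnL hG hs hH i
    have h1 : ({j | (outputGraph n (s.cfg [])).Adj i j} : Set (Fin n)).ncard ≤
        ((Finset.range n).filter fun k => s.words 0 (i * n + k) ≠ 0).card := by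
      rw [← Set.ncard_coe_finset]
      refine Set.ncard_le_ncard_of_injOn Fin.val ?_ Fin.val_injective.injOn
      intro j hj
      simpa [outputGraph, Mem.cfg] using hj
    have h2 := h1.trans (hsol.card_le.trans (Nat.mul_le_mul_right _ hle))
    calc _ ≤ ((2 * ({j | H.Adj i j} : Set (Fin n)).ncard * (E + 2 * K) : ℕ) : ℝ) :=
          Nat.cast_le.2 h2
      _ = _ := by push_cast; ring
  rw [avgOutDegree, avgOutDegree, ← mul_div_assoc, Finset.mul_sum]
  gcongr with i
  exact key i

end

/-! ### The algorithm -/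

/-- The algorithm with failure probability `1 / n ^ a`. -/
def algorithm (a : ℕ) : Program := setup a ;; drawTape ;; prepare ;; solveAll

section
variable {n : ℕ} {d : Fin n → Fin n → ℝ}

/-- With `X = 2 ^ n.size ≥ 4`, the tape parameters are at most `X ^ (a + 6)`; two factors for the
index arithmetic and two for the constant `16` give the word length factor `a + 10`. -/
theorem wordBound_ge {a : ℕ} (hn : 2 ≤ n) :
    16 * (2 ^ n.size * (2 ^ n.size * (2 * halfSamples a n.size))) ≤ wordBound (a + 10) n := by
  obtain ⟨X, hX⟩ : ∃ X, X = 2 ^ n.size := ⟨_, rfl⟩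
  have hLX : n.size ≤ X := hX ▸ Nat.lt_two_pow_self.le
  have hL : 2 ≤ n.size := Nat.lt_size.2 (by simpa using hn)
  have hX4 : 4 ≤ X := by
    calc 4 = 2 ^ 2 := by norm_num
      _ ≤ X := hX ▸ Nat.pow_le_pow_right (by norm_num) hL
  have haX : 2 * a + 98 ≤ X ^ (a + 4) := by
    calc 2 * a + 98 ≤ 4 ^ (a + 4) := by
          rw [pow_add]
          have : a < 4 ^ a := Nat.lt_pow_self (by norm_num)
          omega
      _ ≤ X ^ (a + 4) := Nat.pow_le_pow_left hX4 _
  have hB : 2 * halfSamples a n.size ≤ X ^ (a + 6) := by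
    calc 2 * halfSamples a n.size = (88 * n.size + (2 * a + 10)) * n.size := by
          rw [halfSamples]; ring
      _ ≤ (88 * X + (2 * a + 10) * X) * X := by
          gcongr
          exact Nat.le_mul_of_pos_right _ (by omega)
      _ = (2 * a + 98) * X ^ 2 := by ring
      _ ≤ X ^ (a + 4) * X ^ 2 := Nat.mul_le_mul_right _ haX
      _ = X ^ (a + 6) := by ring
  rw [wordBound, mul_comm (a + 10), pow_mul, ← hX]
  calc 16 * (X * (X * (2 * halfSamples a n.size))) ≤ (4 * 4) * (X * (X * X ^ (a + 6))) := by
        gcongr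
    _ ≤ (X * X) * (X * (X * X ^ (a + 6))) := by gcongr
    _ = X ^ (a + 10) := by ring

/-- The five extra steps are three sequencings, the initialization of the tape counter and the
failing test of its loop. -/
theorem run_algorithm_of_wp [NeZero n] {a κ c₀ N T : ℕ} {s₀ : Mem} {Q : (Fin N → Fin n) → Mem → Prop}
    (h₀ : Exec (wordBound κ n) d (setup a) ⟨(initial .skip n).vars, fun _ _ => 0, fun _ _ => 0, 0⟩
      s₀ c₀)
    (hs0 : s₀.vars 0 = n) (hs6 : s₀.vars 6 = N) (hNW : N < wordBound κ n)
    (h : ∀ y, wp (wordBound κ n) d (prepare ;; solveAll) (fun s c => c ≤ T ∧ Q y s)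
      (tapeMem s₀ N y)) :
    ∃ fin : (Fin N → Fin n) → Mem, (∀ y, Q y (fin y)) ∧
      run (algorithm a) κ d (c₀ + 6 * N + T + 5) =
        (PMF.uniformOfFintype (Fin N → Fin n)).map fun y => (fin y).cfg [] := by
  choose fin c hex hc hQ using h
  refine ⟨fin, hQ, ?_⟩
  have hseq : ∀ (s : Mem) (p q : Program) k, runFrom (wordBound κ n) d 1 (s.cfg ((p ;; q) :: k)) =
      PMF.pure (s.cfg (p :: q :: k)) := by
    intro s p q k
    simp [runFrom, step, Mem.cfg]
  have hassign : ∀ k, runFrom (wordBound κ n) d 1 (s₀.cfg (.assign 23 (.const 0) :: k)) =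
      PMF.pure ((s₀.setVar 23 0).cfg k) := by
    intro k
    have := (Exec.assign (W := wordBound κ n) (d := d) 23 (.const 0) s₀).runFrom_eq k
    simpa using this
  rw [run_eq_runFrom, show c₀ + 6 * N + T + 5 = 1 + (c₀ + (1 + (1 + (1 + (6 * N + (1 + T)))))) by ring,
    runFrom_add, show initial (algorithm a) n =
      Mem.cfg ⟨(initial .skip n).vars, fun _ _ => 0, fun _ _ => 0, 0⟩ [algorithm a] from rfl,
    algorithm, hseq, PMF.pure_bind, runFrom_add, h₀.runFrom_eq, PMF.pure_bind, runFrom_add, hseq,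
    PMF.pure_bind, drawTape, Program.forLoop, runFrom_add, hseq, PMF.pure_bind, runFrom_add,
    hassign, PMF.pure_bind, runFrom_add]
  have htape := runFrom_drawTapeLoop (d := d) (W := wordBound κ n) [prepare ;; solveAll] hs0
    (hs6 ▸ hNW) N hs6.ge
  rw [drawTapeLoop] at htape
  rw [htape, PMF.bind_map, ← PMF.bind_pure_comp]
  congr 1
  funext y
  obtain ⟨g1, g2, -⟩ := tapeMem_spec s₀ N y
  have hdone : Exec (wordBound κ n) d (.loop (.lt (.var 23) (.var 6))
      ((.sample 24 (.var 0) ;; .store 1 (.var 23) (.var 24)) ;; .assign 23 (.var 23 + .const 1)))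
      (tapeMem s₀ N y) (tapeMem s₀ N y) 1 := by
    refine .loop_done ?_
    simp [g1, g2, hs6]
  -- Runs on different tapes may stop at different times; a halted machine stays put, so all are
  -- padded to the common bound `T`.
  obtain ⟨e, he⟩ := Nat.exists_eq_add_of_le (hc y)
  rw [Function.comp, Function.comp, runFrom_add, hdone.runFrom_eq, PMF.pure_bind, he, runFrom_add,
    (hex y).runFrom_eq, PMF.pure_bind, runFrom_halted e ((fin y).cfg []) rfl]

theorem run_algorithm [NeZero n] (a : ℕ) (hn : 2 ≤ n) (hd : IsDistance d) (hG : GeneralPosition d) {L N : ℕ}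
    (hL : L = n.size) (hN : N = 2 ^ L * (2 * halfSamples a L)) :
    ∃ (t : ℕ) (fin : (Fin N → Fin n) → Mem),
      t ≤ L * 5 + 6 * N + n * (n * 14 + L * (n * (13 * L + 50) + 23) + 31) +
        (L + 1) * (n * n * (80 + 8 * ((a + 3) * L) + 11 * L * (150 + 70 * (2 * halfSamples a L)))
          + 30) + 66 ∧
      (∀ y, (fin y).queries = n * n ∧ ∀ i < n, Status n (11 * L) ((a + 3) * L)
        (2 * halfSamples a L) (distRank d) (tapeFn y) (L + 1) i (fin y)) ∧
      run (algorithm a) (a + 10) d t =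
        (PMF.uniformOfFintype (Fin N → Fin n)).map fun y => (fin y).cfg [] := by
  have hL2 : 2 ≤ L := hL ▸ Nat.lt_size.2 (by simpa using hn)
  have hnX : n < 2 ^ L := hL ▸ Nat.lt_size_self n
  have hXn : 2 ^ L ≤ 2 * n := by
    obtain ⟨m, rfl⟩ : ∃ m, L = m + 1 := ⟨L - 1, by omega⟩
    have : 2 ^ m ≤ n := Nat.lt_size.1 (by omega)
    rw [pow_succ]
    omega
  have hBW : 16 * (2 ^ L * (2 ^ L * (2 * halfSamples a L))) ≤ wordBound (a + 10) n :=
    hL ▸ wordBound_ge hn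
  obtain ⟨W, hW⟩ : ∃ W, W = wordBound (a + 10) n := ⟨_, rfl⟩
  rw [← hW] at hBW
  have hH1 : 11 * L + (a + 5) ≤ halfSamples a L :=
    (show 11 * L + (a + 5) ≤ 4 * (11 * L) + (a + 5) by omega).trans
      (Nat.le_mul_of_pos_right _ (by omega))
  have hEB : (a + 3) * L ≤ halfSamples a L := Nat.mul_le_mul_right _ (by omega)
  have hNX : N ≤ 2 ^ L * N := Nat.le_mul_of_pos_left _ (by positivity)
  have hHN : 2 * halfSamples a L ≤ N := hN ▸ Nat.le_mul_of_pos_left _ (by positivity)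
  have hS : WordSize n L W := by
    refine ⟨by omega, hnX, hXn, le_trans ?_ hBW⟩
    gcongr
    exact Nat.le_mul_of_pos_right _ (by omega)
  rw [← hN] at hBW
  -- The reason for `11 * L` rounds: `2 * 15 ^ 11 ≤ 16 ^ 11`, so eleven rounds at least halve the
  -- number of uncovered elements.
  have hK : 15 ^ (11 * L) * n < 16 ^ (11 * L) := by
    calc 15 ^ (11 * L) * n < 15 ^ (11 * L) * 2 ^ L := by gcongr
      _ = (15 ^ 11 * 2) ^ L := by rw [pow_mul, mul_pow]
      _ ≤ (16 ^ 11) ^ L := Nat.pow_le_pow_left (by norm_num) _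
      _ = 16 ^ (11 * L) := by rw [pow_mul]
  have hset := setup_spec (d := d) hS hL (a := a) (by omega) (hN ▸ hBW)
    (s := ⟨(initial .skip n).vars, fun _ _ => 0, fun _ _ => 0, 0⟩) (by simp [initial])
  obtain ⟨s₀, c₀, h₀, hc₀, v1, v3, v4, v5, v6⟩ := hset
  have hF := h₀.frame
  have v0 : s₀.vars 0 = n := (hF.var 0 rfl).trans (by simp [initial])
  rw [← hN] at v6
  have hrun := run_algorithm_of_wp (d := d) (a := a) (κ := a + 10) (N := N) (s₀ := s₀) (c₀ := c₀)
    (T := n * (n * 14 + L * (n * (13 * L + 50) + 23) + 31) + 10 +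
      ((L + 1) * (n * n * (80 + 8 * ((a + 3) * L) + 11 * L * (150 + 70 * (2 * halfSamples a L)))
          + 30) + 30) + 1)
    (Q := fun y s => s.queries = n * n ∧ ∀ i < n, Status n (11 * L) ((a + 3) * L)
        (2 * halfSamples a L) (distRank d) (tapeFn y) (L + 1) i s)
    (hW ▸ h₀) v0 v6 (by omega) fun y => ?_
  · obtain ⟨fin, hfin, hrun⟩ := hrun
    refine ⟨_, fin, ?_, hfin, hrun⟩
    omega
  · rw [← hW]
    obtain ⟨g1, g2, g3, g4, g5, g6⟩ := tapeMem_spec s₀ N y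
    rw [wp_seq]
    refine (prepare_spec hS hG ((g2 0 (by norm_num) (by norm_num)).trans v0)
      ((g2 1 (by norm_num) (by norm_num)).trans v1)).mono ?_
    rintro s₁ c₁ hF₁ ⟨hc₁, hq, hrank, hlist⟩
    have hv : ∀ x, prepare.writesVar x = false → x ≠ 23 → x ≠ 24 → s₁.vars x = s₀.vars x :=
      fun x hx h h' => (hF₁.var x hx).trans (g2 x h h')
    refine (solveAll_spec (K := 11 * L) (E := (a + 3) * L) (B := 2 * halfSamples a L)
      (y := tapeFn y) hS (ranking_distRank hd hG) ((hv 0 rfl (by norm_num) (by norm_num)).trans v0)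
      ((hv 1 rfl (by norm_num) (by norm_num)).trans v1)
      ((hv 3 rfl (by norm_num) (by norm_num)).trans v3)
      ((hv 4 rfl (by norm_num) (by norm_num)).trans v4)
      ((hv 5 rfl (by norm_num) (by norm_num)).trans v5) (by omega) (by omega) (by omega)
      (hN ▸ hBW) hK ?_ hrank hlist ?_).mono ?_
    · intro l hl
      rw [← hN] at hl
      rw [hF₁.word 1 rfl, g3 l hl, tapeFn_of_lt y hl]
      exact ⟨rfl, Fin.is_lt _⟩
    · intro x _
      rw [hF₁.word 8 rfl, g4 8 (by norm_num), hF.word 8 rfl]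
    · rintro s₂ c₂ hF₂ ⟨hc₂, hst⟩
      refine ⟨by omega, ?_, hst⟩
      rw [hF₂.queries rfl, hq, g6, hF.queries rfl, zero_add]

end

/-! ### Constants, and from counting to probability -/

theorem size_le_three_mul_log {n : ℕ} (hn : 2 ≤ n) : (n.size : ℝ) ≤ 3 * Real.log n := by
  obtain ⟨m, hm⟩ : ∃ m, n.size = m + 1 :=
    ⟨n.size - 1, by have := Nat.size_pos.2 (show 0 < n by omega); omega⟩
  have hm1 : (1 : ℝ) ≤ m := by
    have : 1 < n.size := Nat.lt_size.2 (by simpa using hn)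
    exact_mod_cast (show 1 ≤ m by omega)
  have h : (2 : ℝ) ^ m ≤ n := by exact_mod_cast Nat.lt_size.1 (show m < n.size by omega)
  have hlog := Real.log_le_log (by positivity) h
  rw [Real.log_pow] at hlog
  -- Here `m + 1 ≤ 2 * m` and `m * log 2 ≤ log n`, and `2 / log 2 < 3`.
  have h2 := Real.log_two_gt_d9
  rw [hm]
  push_cast
  nlinarith

/-- Leading constant of the running time. -/
def timeConst (a : ℕ) : ℕ :=
  5 + 24 * (a + 49) + 131 + 2 * (1784 + 8 * a + 1540 * (a + 49)) + 66

/-- The fourth power of `L` comes from `L + 1` guesses, `11 * L` rounds per guess, and a number of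
samples per unit of the guess that is quadratic in `L`. -/
theorem time_le (a : ℕ) {n L N : ℕ} (hn : 1 ≤ n) (hL : 1 ≤ L) (hXn : 2 ^ L ≤ 2 * n)
    (hN : N = 2 ^ L * (2 * halfSamples a L)) :
    L * 5 + 6 * N + n * (n * 14 + L * (n * (13 * L + 50) + 23) + 31) +
        (L + 1) * (n * n * (80 + 8 * ((a + 3) * L) + 11 * L * (150 + 70 * (2 * halfSamples a L)))
          + 30) + 66 ≤ timeConst a * (n ^ 2 * L ^ 4) := by
  have pn : ∀ i, 1 ≤ n ^ i := fun i => Nat.one_le_pow _ _ hn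
  have pL : ∀ i, 1 ≤ L ^ i := fun i => Nat.one_le_pow _ _ hL
  have hM : 1 ≤ n ^ 2 * L ^ 4 := Nat.mul_pos (pn 2) (pL 4)
  have hH : halfSamples a L ≤ (a + 49) * L ^ 2 := by
    calc halfSamples a L = (44 * L + (a + 5) * 1) * L := by rw [halfSamples]; ring
      _ ≤ (44 * L + (a + 5) * L) * L := by gcongr
      _ = (a + 49) * L ^ 2 := by ring
  have h1 : L * 5 ≤ 5 * (n ^ 2 * L ^ 4) := by
    calc L * 5 = 5 * (1 * (L * 1)) := by ring
      _ ≤ 5 * (n ^ 2 * (L * L ^ 3)) := by gcongr; exacts [pn 2, pL 3]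
      _ = _ := by ring
  have h2 : 6 * N ≤ 24 * (a + 49) * (n ^ 2 * L ^ 4) := by
    calc 6 * N = 6 * (2 ^ L * (2 * halfSamples a L)) := by rw [hN]
      _ ≤ 6 * (2 * n * (2 * ((a + 49) * L ^ 2))) := by gcongr
      _ = 24 * (a + 49) * (n * 1 * (L ^ 2 * 1)) := by ring
      _ ≤ 24 * (a + 49) * (n * n * (L ^ 2 * L ^ 2)) := by gcongr; exact pL 2
      _ = _ := by ring
  have h3 : n * (n * 14 + L * (n * (13 * L + 50) + 23) + 31) ≤ 131 * (n ^ 2 * L ^ 4) := by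
    calc _ = n * (n * 14 * 1 + L * (n * (13 * L + 50 * 1) + 23 * (1 * 1)) + 31 * (1 * 1)) := by ring
      _ ≤ n * (n * 14 * L ^ 2 + L * (n * (13 * L + 50 * L) + 23 * (n * L)) + 31 * (n * L ^ 2)) := by
        gcongr <;> exact pL 2
      _ = 131 * (n ^ 2 * (L ^ 2 * 1)) := by ring
      _ ≤ 131 * (n ^ 2 * (L ^ 2 * L ^ 2)) := by gcongr; exact pL 2
      _ = _ := by ring
  have h4 : (L + 1) * (n * n * (80 + 8 * ((a + 3) * L) + 11 * L *
      (150 + 70 * (2 * halfSamples a L))) + 30) ≤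
      2 * (1784 + 8 * a + 1540 * (a + 49)) * (n ^ 2 * L ^ 4) := by
    calc _ ≤ (L + L) * (n * n * (80 * L ^ 3 + 8 * ((a + 3) * (L * L ^ 2)) + 11 * L *
          (150 * L ^ 2 + 70 * (2 * ((a + 49) * L ^ 2)))) + 30 * (n * n * L ^ 3)) := by
          gcongr
          · exact Nat.le_mul_of_pos_right _ (pL 3)
          · exact Nat.le_mul_of_pos_right _ (pL 2)
          · exact Nat.le_mul_of_pos_right _ (pL 2)
          · exact Nat.le_mul_of_pos_right _ (Nat.mul_pos (Nat.mul_pos hn hn) (pL 3))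
      _ = _ := by ring
  have h5 : 66 ≤ 66 * (n ^ 2 * L ^ 4) := Nat.le_mul_of_pos_right _ hM
  calc _ ≤ 5 * (n ^ 2 * L ^ 4) + 24 * (a + 49) * (n ^ 2 * L ^ 4) + 131 * (n ^ 2 * L ^ 4) +
        2 * (1784 + 8 * a + 1540 * (a + 49)) * (n ^ 2 * L ^ 4) + 66 * (n ^ 2 * L ^ 4) := by
        gcongr
    _ = _ := by rw [timeConst]; ring

open Classical in
theorem one_sub_le_uniformOfFintype {α : Type*} [Fintype α] [Nonempty α] (P : α → Prop) {b : ℕ}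
    (hb : 0 < b) (h : (Finset.univ.filter fun y => ¬ P y).card * b ≤ Fintype.card α) :
    ENNReal.ofReal (1 - 1 / (b : ℝ)) ≤ (PMF.uniformOfFintype α).toOuterMeasure {y | P y} := by
  rw [PMF.toOuterMeasure_uniformOfFintype_apply, Fintype.card_subtype]
  have hcard : 0 < Fintype.card α := Fintype.card_pos
  have hsum := Finset.card_filter_add_card_filter_not (s := (Finset.univ : Finset α)) P
  rw [Finset.card_univ] at hsum
  have hcardR : (0 : ℝ) < Fintype.card α := by exact_mod_cast hcard
  have hbR : (0 : ℝ) < b := by exact_mod_cast hb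
  rw [← ENNReal.ofReal_natCast, ← ENNReal.ofReal_natCast (Fintype.card α),
    ← ENNReal.ofReal_div_of_pos hcardR]
  apply ENNReal.ofReal_le_ofReal
  have hR : ((Finset.univ.filter fun y => ¬ P y).card : ℝ) * b ≤ Fintype.card α := by
    exact_mod_cast h
  have hsumR : ((Finset.univ.filter P).card : ℝ) + ((Finset.univ.filter fun y => ¬ P y).card : ℝ) =
      Fintype.card α := by
    exact_mod_cast hsum
  have h1 : ((Finset.univ.filter fun y => ¬ P y).card : ℝ) / Fintype.card α ≤ 1 / b := by
    rw [div_le_div_iff₀ hcardR hbR]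
    linarith
  have h2 : ((Finset.univ.filter P).card : ℝ) / Fintype.card α =
      1 - ((Finset.univ.filter fun y => ¬ P y).card : ℝ) / Fintype.card α := by
    rw [← hsumR] at hcardR ⊢
    field_simp
    ring
  calc 1 - 1 / (b : ℝ) ≤ 1 - ((Finset.univ.filter fun y => ¬ P y).card : ℝ) / Fintype.card α := by
        linarith
    _ = _ := h2.symm

end NavGraph

open NavGraph in
theorem theorem1 :
    ∃ k : ℕ, ∀ a : ℕ, ∃ (p : NavGraph.Program) (κ : ℕ) (C c : ℝ),
      ∀ n : ℕ, 2 ≤ n → ∀ d : Fin n → Fin n → ℝ,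
        NavGraph.IsDistance d → NavGraph.GeneralPosition d →
        ∃ t q : ℕ, (t : ℝ) ≤ C * (n : ℝ) ^ 2 * Real.log n ^ k ∧ (q : ℝ) ≤ C * (n : ℝ) ^ 2 ∧
          NavGraph.HaltsWithin p κ d t q ∧
          ENNReal.ofReal (1 - 1 / (n : ℝ) ^ a) ≤
            (NavGraph.outputAfter p κ d t).toOuterMeasure
              {G | NavGraph.Navigable d G ∧
                ∀ H : Digraph (Fin n), NavGraph.Navigable d H →
                  NavGraph.avgOutDegree G ≤
                    c * Real.log n * NavGraph.avgOutDegree H} := by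
  -- Both constants absorb `L ≤ 3 * log n`: the time gets the factor `3 ^ 4`, and the degree factor
  -- `2 * (E + 2 * K) = 2 * (a + 25) * L` becomes `6 * (a + 25) * log n`.
  refine ⟨4, fun a => ⟨algorithm a, a + 10, timeConst a * 3 ^ 4, 6 * (a + 25), ?_⟩⟩
  intro n hn d hd hG
  have : NeZero n := ⟨by omega⟩
  obtain ⟨L, hL⟩ : ∃ L, L = n.size := ⟨_, rfl⟩
  obtain ⟨N, hN⟩ : ∃ N, N = 2 ^ L * (2 * halfSamples a L) := ⟨_, rfl⟩
  have hL2 : 2 ≤ L := hL ▸ Nat.lt_size.2 (by simpa using hn)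
  have hnX : n < 2 ^ L := hL ▸ Nat.lt_size_self n
  have hXn : 2 ^ L ≤ 2 * n := by
    obtain ⟨m, rfl⟩ : ∃ m, L = m + 1 := ⟨L - 1, by omega⟩
    have : 2 ^ m ≤ n := Nat.lt_size.1 (by omega)
    rw [pow_succ]
    omega
  have hlog : (L : ℝ) ≤ 3 * Real.log n := hL ▸ size_le_three_mul_log hn
  obtain ⟨t, fin, ht, hfin, hrun⟩ := run_algorithm a hn hd hG hL hN
  refine ⟨t, n * n, ?_, ?_, ?_, ?_⟩
  · calc (t : ℝ) ≤ ((timeConst a * (n ^ 2 * L ^ 4) : ℕ) : ℝ) :=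
          Nat.cast_le.2 (ht.trans (time_le a (by omega) (by omega) hXn hN))
      _ = timeConst a * (n ^ 2 * L ^ 4) := by push_cast; ring
      _ ≤ timeConst a * (n ^ 2 * (3 * Real.log n) ^ 4) := by gcongr
      _ = _ := by ring
  · have hC : (1 : ℝ) ≤ timeConst a * 3 ^ 4 := by
      have : 1 ≤ timeConst a * 3 ^ 4 := by rw [timeConst]; omega
      exact_mod_cast this
    push_cast
    nlinarith [mul_self_nonneg (n : ℝ)]
  · intro s hs
    rw [hrun, PMF.support_map] at hs
    obtain ⟨y, -, rfl⟩ := hs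
    exact ⟨rfl, (hfin y).1.le⟩
  · rw [outputAfter, hrun, PMF.map_comp, PMF.toOuterMeasure_map_apply]
    have hbad := card_not_goodTape (ranking_distRank hd hG) (a := a) hnX hL2 hN
    have hprob := one_sub_le_uniformOfFintype (fun y : Fin N → Fin n => GoodTape n L (11 * L)
      ((a + 3) * L) (2 * halfSamples a L) (distRank d) (tapeFn y)) (b := n ^ a) (by positivity)
      (by simpa using hbad)
    rw [Nat.cast_pow] at hprob
    refine hprob.trans (MeasureTheory.measure_mono fun y hy => ?_)
    have hEN : 2 ^ L * ((a + 3) * L) ≤ N := by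
      rw [hN]
      refine Nat.mul_le_mul_left _ ?_
      have : (a + 3) * L ≤ halfSamples a L := Nat.mul_le_mul_right _ (by omega)
      omega
    refine ⟨navigable_outputGraph hd hG hn hnX hy (fun l hl => tapeFn_lt y (hl.trans_le hEN))
      (hfin y).2, fun H hH => ?_⟩
    have havg : 0 ≤ avgOutDegree H := by rw [avgOutDegree]; positivity
    calc _ ≤ _ := avgOutDegree_outputGraph_le hd hn hnX hy (hfin y).2 hH
      _ = 2 * (a + 25) * L * avgOutDegree H := by push_cast; ring
      _ ≤ 2 * (a + 25) * (3 * Real.log n) * avgOutDegree H := by gcongr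
      _ = _ := by ring
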